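/- Throughout, a *ring* is an associative ring, not necessarily unital, and an ideal is a two-sided ideal. *Conventions and definitions.* For a unital ring $R$, $K_0R$ is the Grothendieck group of the commutative monoid of equivalence classes of idempotent matrices over $R$ of all finite sizes ($e\sim e'$ iff $e=xy$ and $e'=yx$ for some rectangular matrices $x,y$ over $R$) under block sum. For a ring $A$, let $\tilde A=A\oplus\mathbb Z$ be the ring obtained by adjoining a unit and put $K_0A=\ker(K_0\tilde A\to K_0\mathbb Z)$; for unital $A$ this agrees with the previous definition up to canonical isomorphism. Let $\Gamma A$ be the ring of matrices $(a_{ij})_{i,j\ge 1}$ with $a_{ij}\in A$ that have only finitely many distinct entries and for which there is an $N$ such that each row and each column has at most $N$ nonzero entries. Let $M_\infty A\subset\Gamma A$ be the ideal of matrices with finitely many nonzero entries and $\Sigma A=\Gamma A/M_\infty A$ the suspension, and for $p\ge 0$ put $K_{-p}A=K_0(\Sigma^pA)$. A sequence of ring homomorphisms $0\to A\to B\to C\to 0$ is *short exact* if it is short exact on underlying abelian groups. If moreover $B\to C$ is a unital homomorphism of unital rings, the *index* of $g\in GL_n(C)$ is $[hp_nh^{-1}]-[p_n]\in K_0A$,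 where $h\in GL_{2n}(B)$ is a lift of $\mathrm{diag}(g,g^{-1})$ and $p_n=\mathrm{diag}(1_n,0_n)$. The index does not depend on the choice of the lift. For an arbitrary short exact sequence and $p\ge0$, the boundary map $\partial:K_{-p}C\to K_{-p-1}A$ is defined as follows. Put $A_p=\Sigma^pA$, $B_p=\Sigma^pB$ and $C_p=\Sigma^pC$; the sequences $0\to A_p\to B_p\to C_p\to0$ and $0\to \Sigma A_p\to\Sigma\tilde B_p\to\Sigma\tilde C_p\to0$ are exact. On $K_0C_p\subset K_0\tilde C_p$, the map $\partial$ is the restriction of the homomorphism $K_0\tilde C_p\to K_0(\Sigma A_p)$ that sends the class of an idempotent matrix $e$ to the index of the invertible matrix $1-e+es$ over $\Sigma\tilde C_p$, where $s$ is the class of the shift $\sum_i e_{i,i+1}$ and the entries of $e$ are viewed in $\Sigma\tilde C_p$ as constant diagonal matrices. (The map $[e]\mapsto[1-e+es]$ is the inverse of the isomorphism $K_1(\Sigma R)\cong K_0R$ given by the index map of $0\to M_\infty R\to\Gamma R\to\Sigma R\to0$ for $R=\tilde C_p$.) For a ring $A$, let $A[t]$ be the polynomial ring in a central variable, $PA=\{f\in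 A[t]: f(0)=0\}$ and $\Omega A=\{f\in PA: f(1)=0\}$, so that there is a short exact sequence $$0\to\Omega A\to PA\xrightarrow{\mathrm{ev}_1}A\to0 .$$ For $n\in\mathbb Z$, Weibel's homotopy $K$-theory group is $$KH_nA=\operatorname*{colim}_{p}K_{-p}(\Omega^{n+p}A),$$ the colimit over the integers $p$ with $p\ge0$ and $n+p\ge0$, along the boundary maps $K_{-p}(\Omega^{n+p}A)\to K_{-p-1}(\Omega^{n+p+1}A)$ of the sequences $0\to\Omega^{n+p+1}A\to P\Omega^{n+p}A\to\Omega^{n+p}A\to0$. It is a functor from rings to abelian groups. **Theorem.** Homotopy $K$-theory has the following properties. (i) It is homotopy invariant, nilinvariant and $M_\infty$-stable. That is, for every $n\in\mathbb Z$: - for every ring $A$, the inclusion $A\to A[t]$ of the constant polynomials induces an isomorphism $KH_n(A)\to KH_n(A[t])$; - for every ring $B$ and every ideal $I$ of $B$ that is nilpotent ($I^N=0$ for some $N\ge1$), the projection $B\to B/I$ induces an isomorphism $KH_n(B)\to KH_n(B/I)$; - for every ring $A$, the inclusion $A\to M_\infty A$, $a\mapsto a\,e_{1,1}$, induces an isomorphism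 $KH_n(A)\to KH_n(M_\infty A)$. (ii) It satisfies excision: to each short exact sequence of rings $0\to A\to B\to C\to0$ there correspond homomorphisms $\delta_n:KH_{n+1}C\to KH_nA$ ($n\in\mathbb Z$), natural with respect to morphisms of short exact sequences, such that $$\cdots\to KH_{n+1}B\to KH_{n+1}C\xrightarrow{\delta_n}KH_nA\to KH_nB\to KH_nC\xrightarrow{\delta_{n-1}}KH_{n-1}A\to\cdots$$ is exact. -/

import Mathlib

universe u

set_option linter.unusedSectionVars false

namespace HomotopyK

/-! ### Short exact sequences, matrices of countable size, cone and suspension -/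

/-- `0 → A → B → C → 0` is exact. -/
structure IsShortExact {A B C : Type*} [Zero C] (f : A → B) (g : B → C) : Prop where
  inj : Function.Injective f
  exact : ∀ b, g b = 0 ↔ ∃ a, f a = b
  surj : Function.Surjective g

/-- The cone `Γ A`: the `ℕ × ℕ` matrices over `A` having finitely many different entries, and for
which there is `N` such that each row and each column has at most `N` nonzero entries. -/
@[ext]
structure Cone (A : Type u) [Zero A] : Type u where
  entry : ℕ → ℕ → A
  finite_range : (Set.range fun p : ℕ × ℕ => entry p.1 p.2).Finite
  bounded : ∃ N : ℕ, (∀ i, ∃ s : Finset ℕ, s.card ≤ N ∧ ∀ j, j ∉ s → entry i j = 0) ∧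
    (∀ j, ∃ s : Finset ℕ, s.card ≤ N ∧ ∀ i, i ∉ s → entry i j = 0)

namespace Cone

theorem exists_row {A : Type u} [Zero A] (a : Cone A) (i : ℕ) :
    ∃ s : Finset ℕ, ∀ j, j ∉ s → a.entry i j = 0 := by
  obtain ⟨N, h, -⟩ := a.bounded
  obtain ⟨s, -, hs⟩ := h i
  exact ⟨s, hs⟩

variable {A : Type u} [NonUnitalRing A]

/-- Entries of a matrix product. -/
noncomputable def mulEntry (a b : ℕ → ℕ → A) (i k : ℕ) : A := ∑ᶠ j, a i j * b j k

theorem mulEntry_eq {a b : ℕ → ℕ → A} {i : ℕ} {s : Finset ℕ} (hs : ∀ j, j ∉ s → a i j = 0)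
    (k : ℕ) : mulEntry a b i k = ∑ j ∈ s, a i j * b j k := by
  unfold mulEntry
  apply finsum_eq_sum_of_support_subset
  intro j hj
  by_contra h
  exact hj (by simp only [hs j (by simpa using h), zero_mul])

theorem sum_mem_nsmul (T : Set A) (h0 : (0 : A) ∈ T) (N : ℕ) :
    ∀ (s : Finset ℕ) (f : ℕ → A), s.card ≤ N → (∀ j, f j ∈ T) →
      ∑ j ∈ s, f j ∈ (fun g : Fin N → A => ∑ k, g k) '' {g | ∀ k, g k ∈ T} := by
  classical
  induction N with
  | zero =>
    intro s f hs _
    have : s = ∅ := by simpa using hs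
    subst this
    exact ⟨fun _ => 0, fun _ => h0, by simp⟩
  | succ N ih =>
    intro s f hs hf
    rcases s.eq_empty_or_nonempty with rfl | ⟨x, hx⟩
    · exact ⟨fun _ => 0, fun _ => h0, by simp⟩
    · obtain ⟨g, hg, hgs⟩ := ih (s.erase x) f (by rw [Finset.card_erase_of_mem hx]; omega) hf
      refine ⟨Fin.cons (f x) g, ?_, ?_⟩
      · intro k
        refine Fin.cases ?_ ?_ k
        · simpa using hf x
        · intro k
          simpa using hg k
      · simp only [Fin.sum_univ_succ, Fin.cons_zero, Fin.cons_succ]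
        rw [show ∑ k, g k = _ from hgs, Finset.add_sum_erase _ _ hx]

noncomputable instance : Mul (Cone A) where
  mul a b :=
    { entry := mulEntry a.entry b.entry
      finite_range := by
        obtain ⟨N, h, -⟩ := a.bounded
        let Ta : Set A := Set.range fun p : ℕ × ℕ => a.entry p.1 p.2
        let Tb : Set A := Set.range fun p : ℕ × ℕ => b.entry p.1 p.2
        let T : Set A := insert 0 (Set.image2 (· * ·) Ta Tb)
        have hT : T.Finite := (Set.Finite.image2 _ a.finite_range b.finite_range).insert 0
        refine Set.Finite.subset
          (Set.Finite.image (fun g : Fin N → A => ∑ k, g k)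
            (Set.Finite.pi' (t := fun _ => T) fun _ => hT)) ?_
        rintro _ ⟨⟨i, k⟩, rfl⟩
        obtain ⟨s, hs, hs'⟩ := h i
        dsimp only
        rw [mulEntry_eq hs' k]
        exact sum_mem_nsmul T (Set.mem_insert _ _) N s (fun j => a.entry i j * b.entry j k) hs
          fun j => Set.mem_insert_of_mem _ ⟨_, ⟨(i, j), rfl⟩, _, ⟨(j, k), rfl⟩, rfl⟩
      bounded := by
        classical
        obtain ⟨N, hr, hc⟩ := a.bounded
        obtain ⟨M, hr', hc'⟩ := b.bounded
        refine ⟨N * M + M * N, fun i => ?_, fun k => ?_⟩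
        · obtain ⟨s, hs, hs'⟩ := hr i
          choose t ht ht' using hr'
          refine ⟨s.biUnion t, ?_, ?_⟩
          · exact (Finset.card_biUnion_le_card_mul s t M fun j _ => ht j).trans
              ((Nat.mul_le_mul_right M hs).trans (Nat.le_add_right _ _))
          · intro k hk
            rw [mulEntry_eq hs']
            refine Finset.sum_eq_zero fun j hj => ?_
            rw [ht' j k fun h => hk (Finset.mem_biUnion.2 ⟨j, hj, h⟩), mul_zero]
        · obtain ⟨s, hs, hs'⟩ := hc' k
          choose t ht ht' using hc
          refine ⟨s.biUnion t, ?_, ?_⟩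
          · exact (Finset.card_biUnion_le_card_mul s t N fun j _ => ht j).trans
              ((Nat.mul_le_mul_right N hs).trans (Nat.le_add_left _ _))
          · intro i hi
            unfold mulEntry
            refine finsum_eq_zero_of_forall_eq_zero fun j => ?_
            by_cases hj : j ∈ s
            · rw [ht' j i fun h => hi (Finset.mem_biUnion.2 ⟨j, hj, h⟩), zero_mul]
            · rw [hs' j hj, mul_zero] }

instance : Zero (Cone A) where
  zero :=
    { entry := fun _ _ => 0
      finite_range := (Set.finite_singleton (0 : A)).subset (by rintro _ ⟨_, rfl⟩; rfl)
      bounded := ⟨0, fun _ => ⟨∅, by simp⟩, fun _ => ⟨∅, by simp⟩⟩ }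

instance : Add (Cone A) where
  add a b :=
    { entry := fun i j => a.entry i j + b.entry i j
      finite_range := by
        refine (Set.Finite.image2 (· + ·) a.finite_range b.finite_range).subset ?_
        rintro _ ⟨p, rfl⟩
        exact ⟨_, ⟨p, rfl⟩, _, ⟨p, rfl⟩, rfl⟩
      bounded := by
        classical
        obtain ⟨N, hr, hc⟩ := a.bounded
        obtain ⟨M, hr', hc'⟩ := b.bounded
        refine ⟨N + M, fun i => ?_, fun k => ?_⟩
        · obtain ⟨s, hs, hs'⟩ := hr i
          obtain ⟨t, ht, ht'⟩ := hr' i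
          refine ⟨s ∪ t, (Finset.card_union_le s t).trans (add_le_add hs ht), fun j hj => ?_⟩
          rw [Finset.notMem_union] at hj
          rw [hs' j hj.1, ht' j hj.2, add_zero]
        · obtain ⟨s, hs, hs'⟩ := hc k
          obtain ⟨t, ht, ht'⟩ := hc' k
          refine ⟨s ∪ t, (Finset.card_union_le s t).trans (add_le_add hs ht), fun j hj => ?_⟩
          rw [Finset.notMem_union] at hj
          rw [hs' j hj.1, ht' j hj.2, add_zero] }

/-- Apply a zero preserving function to all entries. -/
def mapFun {A B : Type*} [Zero A] [Zero B] (f : A → B) (hf : f 0 = 0) (a : Cone A) : Cone B where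
  entry i j := f (a.entry i j)
  finite_range := by
    refine (a.finite_range.image f).subset ?_
    rintro _ ⟨p, rfl⟩
    exact ⟨_, ⟨p, rfl⟩, rfl⟩
  bounded := by
    obtain ⟨N, hr, hc⟩ := a.bounded
    refine ⟨N, fun i => ?_, fun k => ?_⟩
    · obtain ⟨s, hs, hs'⟩ := hr i
      exact ⟨s, hs, fun j hj => by rw [hs' j hj, hf]⟩
    · obtain ⟨s, hs, hs'⟩ := hc k
      exact ⟨s, hs, fun j hj => by rw [hs' j hj, hf]⟩

instance : Neg (Cone A) where
  neg a := mapFun (fun x => -x) neg_zero a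

@[simp] theorem zero_entry (i j : ℕ) : (0 : Cone A).entry i j = 0 := rfl
@[simp] theorem add_entry (a b : Cone A) (i j : ℕ) :
    (a + b).entry i j = a.entry i j + b.entry i j := rfl
@[simp] theorem neg_entry (a : Cone A) (i j : ℕ) : (-a).entry i j = -a.entry i j := rfl

theorem mul_entry {a : Cone A} {i : ℕ} {s : Finset ℕ} (hs : ∀ j, j ∉ s → a.entry i j = 0)
    (b : Cone A) (k : ℕ) : (a * b).entry i k = ∑ j ∈ s, a.entry i j * b.entry j k :=
  mulEntry_eq hs k

instance : AddCommGroup (Cone A) where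
  add_assoc a b c := by ext; simp [add_assoc]
  zero_add a := by ext; simp
  add_zero a := by ext; simp
  add_comm a b := by ext; simp [add_comm]
  neg_add_cancel a := by ext; simp
  nsmul := nsmulRec
  zsmul := zsmulRec

noncomputable instance : NonUnitalRing (Cone A) where
  left_distrib a b c := by
    ext i k
    obtain ⟨s, hs⟩ := a.exists_row i
    simp [mul_entry hs, mul_add, Finset.sum_add_distrib]
  right_distrib a b c := by
    classical
    ext i k
    obtain ⟨s, hs⟩ := a.exists_row i
    obtain ⟨t, ht⟩ := b.exists_row i
    have hs' : ∀ j, j ∉ s ∪ t → a.entry i j = 0 := fun j hj =>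
      hs j fun h => hj (Finset.mem_union_left _ h)
    have ht' : ∀ j, j ∉ s ∪ t → b.entry i j = 0 := fun j hj =>
      ht j fun h => hj (Finset.mem_union_right _ h)
    have hst : ∀ j, j ∉ s ∪ t → (a + b).entry i j = 0 := fun j hj => by
      rw [add_entry, hs' j hj, ht' j hj, add_zero]
    rw [add_entry, mul_entry hs', mul_entry ht', mul_entry hst]
    simp [add_mul, Finset.sum_add_distrib]
  zero_mul a := by
    ext i k
    rw [mul_entry (s := ∅) (fun _ _ => rfl)]
    simp
  mul_zero a := by
    ext i k
    obtain ⟨s, hs⟩ := a.exists_row i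
    simp [mul_entry hs]
  mul_assoc a b c := by
    classical
    ext i l
    obtain ⟨s, hs⟩ := a.exists_row i
    choose t ht using b.exists_row
    have hu : ∀ k, k ∉ s.biUnion t → (a * b).entry i k = 0 := by
      intro k hk
      rw [mul_entry hs]
      refine Finset.sum_eq_zero fun j hj => ?_
      rw [ht j k fun h => hk (Finset.mem_biUnion.2 ⟨j, hj, h⟩), mul_zero]
    rw [mul_entry hu]
    have h1 : ∀ j ∈ s, (b * c).entry j l = ∑ k ∈ s.biUnion t, b.entry j k * c.entry k l := by
      intro j hj
      exact mul_entry (fun k hk => ht j k fun h => hk (Finset.mem_biUnion.2 ⟨j, hj, h⟩)) c l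
    rw [mul_entry (a := a) hs, Finset.sum_congr rfl fun j hj => congrArg (a.entry i j * ·) (h1 j hj)]
    simp only [mul_entry hs, Finset.sum_mul, Finset.mul_sum]
    rw [Finset.sum_comm]
    simp only [mul_assoc]

/-- The matrix with `a` at all positions `(i, i + d)` (above the diagonal); in particular the
diagonal matrix with constant value `a` if `d = 0`. -/
def upper (d : ℕ) (a : A) : Cone A where
  entry i j := if j = i + d then a else 0
  finite_range := by
    refine (Set.toFinite {a, 0}).subset ?_
    rintro _ ⟨p, rfl⟩
    dsimp only
    split_ifs <;> simp
  bounded := ⟨1, fun i => ⟨{i + d}, by simp, fun j hj => if_neg (by simpa using hj)⟩,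
    fun j => ⟨{j - d}, by simp, fun i hi => if_neg (by simp at hi; omega)⟩⟩

/-- The matrix with `a` at all positions `(i + d, i)` (below the diagonal). -/
def lower (d : ℕ) (a : A) : Cone A where
  entry i j := if i = j + d then a else 0
  finite_range := by
    refine (Set.toFinite {a, 0}).subset ?_
    rintro _ ⟨p, rfl⟩
    dsimp only
    split_ifs <;> simp
  bounded := ⟨1, fun j => ⟨{j - d}, by simp, fun i hi => if_neg (by simp at hi; omega)⟩,
    fun i => ⟨{i + d}, by simp, fun j hj => if_neg (by simpa using hj)⟩⟩

theorem upper_mul_entry (d : ℕ) (a : A) (b : Cone A) (i k : ℕ) :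
    (upper d a * b).entry i k = a * b.entry (i + d) k := by
  rw [mul_entry (s := {i + d}) (fun j hj => if_neg (by simpa using hj))]
  simp [upper]

noncomputable instance {R : Type u} [Ring R] : Ring (Cone R) where
  __ := (inferInstance : NonUnitalRing (Cone R))
  one := upper 0 1
  one_mul a := by
    ext i k
    exact (upper_mul_entry 0 1 a i k).trans (by simp)
  mul_one a := by
    ext i k
    obtain ⟨s, hs⟩ := a.exists_row i
    change (a * upper 0 1).entry i k = _
    rw [mul_entry hs]
    simp only [upper, add_zero, mul_ite, mul_one, mul_zero, Finset.sum_ite_eq]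
    split_ifs with h
    · rfl
    · exact (hs k h).symm

theorem one_def {R : Type u} [Ring R] : (1 : Cone R) = upper 0 1 := rfl

/-- Functoriality of the cone. -/
noncomputable def map {A B : Type u} [NonUnitalRing A] [NonUnitalRing B] (f : A →ₙ+* B) :
    Cone A →ₙ+* Cone B where
  toFun := mapFun f (map_zero f)
  map_zero' := by ext; exact map_zero f
  map_add' a b := by ext; exact map_add f _ _
  map_mul' a b := by
    ext i k
    obtain ⟨s, hs⟩ := a.exists_row i
    have hs' : ∀ j, j ∉ s → (mapFun f (map_zero f) a).entry i j = 0 := fun j hj => by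
      simp [mapFun, hs j hj]
    rw [mul_entry hs']
    simp only [mapFun, mul_entry hs, map_sum, map_mul]

@[simp] theorem map_entry {A B : Type u} [NonUnitalRing A] [NonUnitalRing B] (f : A →ₙ+* B)
    (a : Cone A) (i j : ℕ) : (map f a).entry i j = f (a.entry i j) := rfl

end Cone

/-- `M_∞ A`, the ideal of `Γ A` of the matrices with finitely many nonzero entries, that is, the
union of the matrix rings `M_n A`. -/
noncomputable def finiteMatrices (A : Type u) [NonUnitalRing A] : TwoSidedIdeal (Cone A) :=
  TwoSidedIdeal.mk' {a | ∃ n : ℕ, ∀ i j, n ≤ i ∨ n ≤ j → a.entry i j = 0}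
    ⟨0, fun _ _ _ => rfl⟩
    (by
      rintro x y ⟨n, hn⟩ ⟨m, hm⟩
      refine ⟨max n m, fun i j h => ?_⟩
      rw [Cone.add_entry, hn i j (by omega), hm i j (by omega), add_zero])
    (by
      rintro x ⟨n, hn⟩
      exact ⟨n, fun i j h => by rw [Cone.neg_entry, hn i j h, neg_zero]⟩)
    (by
      classical
      rintro x y ⟨n, hn⟩
      obtain ⟨N, -, hc⟩ := x.bounded
      choose t ht ht' using hc
      refine ⟨n + ((Finset.range n).biUnion t).sup id + 1, fun i k h => ?_⟩
      change ∑ᶠ j, x.entry i j * y.entry j k = 0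
      refine finsum_eq_zero_of_forall_eq_zero fun j => ?_
      by_cases hj : n ≤ j ∨ n ≤ k
      · rw [hn j k hj, mul_zero]
      · rw [ht' j i, zero_mul]
        intro hi
        have : i ≤ ((Finset.range n).biUnion t).sup id :=
          Finset.le_sup (f := id) (Finset.mem_biUnion.2 ⟨j, by simp; omega, hi⟩)
        omega)
    (by
      classical
      rintro x y ⟨n, hn⟩
      obtain ⟨N, hr, -⟩ := y.bounded
      choose t ht ht' using hr
      refine ⟨n + ((Finset.range n).biUnion t).sup id + 1, fun i k h => ?_⟩
      change ∑ᶠ j, x.entry i j * y.entry j k = 0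
      refine finsum_eq_zero_of_forall_eq_zero fun j => ?_
      by_cases hj : n ≤ i ∨ n ≤ j
      · rw [hn i j hj, zero_mul]
      · rw [ht' j k, mul_zero]
        intro hi
        have : k ≤ ((Finset.range n).biUnion t).sup id :=
          Finset.le_sup (f := id) (Finset.mem_biUnion.2 ⟨j, by simp; omega, hi⟩)
        omega)

theorem mem_finiteMatrices {A : Type u} [NonUnitalRing A] (a : Cone A) :
    a ∈ finiteMatrices A ↔ ∃ n : ℕ, ∀ i j, n ≤ i ∨ n ≤ j → a.entry i j = 0 := by
  simp [finiteMatrices]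

/-- The inclusion `A → M_∞ A` in the upper left corner. -/
noncomputable def corner (A : Type u) [NonUnitalRing A] : A →ₙ+* finiteMatrices A where
  toFun a :=
    ⟨{ entry := fun i j => if i = 0 ∧ j = 0 then a else 0
       finite_range := by
        refine (Set.toFinite {a, 0}).subset ?_
        rintro _ ⟨p, rfl⟩
        dsimp only
        split_ifs <;> simp
       bounded := ⟨1, fun i => ⟨{0}, by simp, fun j hj => if_neg (by simp at hj; omega)⟩,
        fun i => ⟨{0}, by simp, fun j hj => if_neg (by simp at hj; omega)⟩⟩ },
      (mem_finiteMatrices _).2 ⟨1, fun i j h => if_neg (by omega)⟩⟩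
  map_zero' := by
    ext i j
    change (if i = 0 ∧ j = 0 then (0 : A) else 0) = 0
    simp
  map_add' a b := by
    ext i j
    change (if i = 0 ∧ j = 0 then a + b else 0) =
      (if i = 0 ∧ j = 0 then a else 0) + (if i = 0 ∧ j = 0 then b else 0)
    split_ifs <;> simp
  map_mul' a b := by
    ext i k
    refine Eq.trans ?_ (Cone.mul_entry (s := {0})
      (fun j hj => if_neg (by simp at hj; omega)) _ _).symm
    simp only [Finset.sum_singleton]
    by_cases hi : i = 0 <;> by_cases hk : k = 0 <;> simp [hi, hk]

/-- The suspension `Σ A = Γ A / M_∞ A`. -/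
def Susp (A : Type u) [NonUnitalRing A] : Type u := (finiteMatrices A).ringCon.Quotient

namespace Susp

noncomputable instance (A : Type u) [NonUnitalRing A] : NonUnitalRing (Susp A) :=
  inferInstanceAs (NonUnitalRing (finiteMatrices A).ringCon.Quotient)

noncomputable instance (R : Type u) [Ring R] : Ring (Susp R) :=
  inferInstanceAs (Ring (finiteMatrices R).ringCon.Quotient)

/-- The projection `Γ A → Σ A`. -/
noncomputable def proj (A : Type u) [NonUnitalRing A] : Cone A →ₙ+* Susp A where
  toFun a := (a : (finiteMatrices A).ringCon.Quotient)
  map_zero' := rfl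
  map_add' _ _ := rfl
  map_mul' _ _ := rfl

theorem proj_surjective (A : Type u) [NonUnitalRing A] : Function.Surjective (proj A) :=
  Quotient.mk''_surjective

theorem proj_eq_iff {A : Type u} [NonUnitalRing A] (a b : Cone A) :
    proj A a = proj A b ↔ a - b ∈ finiteMatrices A := by
  rw [← TwoSidedIdeal.rel_iff]
  exact RingCon.eq _

theorem proj_eq_zero {A : Type u} [NonUnitalRing A] (a : Cone A) :
    proj A a = 0 ↔ ∃ n : ℕ, ∀ i j, n ≤ i ∨ n ≤ j → a.entry i j = 0 := by
  rw [← map_zero (proj A), proj_eq_iff, sub_zero, mem_finiteMatrices]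

theorem proj_one (R : Type u) [Ring R] : proj R 1 = 1 := rfl

/-- Functoriality of the suspension. -/
noncomputable def map {A B : Type u} [NonUnitalRing A] [NonUnitalRing B] (f : A →ₙ+* B) :
    Susp A →ₙ+* Susp B where
  toFun := Quotient.lift (fun a => proj B (Cone.map f a)) (by
    intro a b h
    have h' : a - b ∈ finiteMatrices A := (TwoSidedIdeal.rel_iff _ a b).1 h
    rw [proj_eq_iff, ← map_sub, mem_finiteMatrices]
    obtain ⟨n, hn⟩ := (mem_finiteMatrices _).1 h'
    exact ⟨n, fun i j hij => by rw [Cone.map_entry, hn i j hij, map_zero]⟩)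
  map_zero' := (congrArg (proj B) (map_zero (Cone.map f))).trans (map_zero (proj B))
  map_add' x y := by
    obtain ⟨a, rfl⟩ := proj_surjective A x
    obtain ⟨b, rfl⟩ := proj_surjective A y
    exact (congrArg (proj B) (map_add (Cone.map f) a b)).trans (map_add (proj B) _ _)
  map_mul' x y := by
    obtain ⟨a, rfl⟩ := proj_surjective A x
    obtain ⟨b, rfl⟩ := proj_surjective A y
    exact (congrArg (proj B) (map_mul (Cone.map f) a b)).trans (map_mul (proj B) _ _)

@[simp] theorem map_proj {A B : Type u} [NonUnitalRing A] [NonUnitalRing B] (f : A →ₙ+* B)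
    (a : Cone A) : map f (proj A a) = proj B (Cone.map f a) := rfl

/-- Functoriality of the suspension for unital homomorphisms. -/
noncomputable def mapUnital {R S : Type u} [Ring R] [Ring S] (f : R →+* S) :
    Susp R →+* Susp S where
  toFun := map (f : R →ₙ+* S)
  map_zero' := map_zero _
  map_add' := map_add _
  map_mul' := map_mul _
  map_one' := by
    rw [← proj_one, ← proj_one, map_proj]
    congr 1
    ext i j
    change f (if j = i + 0 then 1 else 0) = if j = i + 0 then 1 else 0
    split_ifs <;> simp

@[simp] theorem mapUnital_apply {R S : Type u} [Ring R] [Ring S] (f : R →+* S) (x : Susp R) :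
    mapUnital f x = map (f : R →ₙ+* S) x := rfl

theorem map_map {A B C : Type u} [NonUnitalRing A] [NonUnitalRing B] [NonUnitalRing C]
    (f : A →ₙ+* B) (g : B →ₙ+* C) (x : Susp A) : map g (map f x) = map (g.comp f) x := by
  obtain ⟨a, rfl⟩ := proj_surjective A x
  rfl

/-- The suspension is an exact functor. -/
theorem isShortExact {A B C : Type u} [NonUnitalRing A] [NonUnitalRing B] [NonUnitalRing C]
    {f : A →ₙ+* B} {g : B →ₙ+* C} (h : IsShortExact f g) : IsShortExact (map f) (map g) where
  inj := by
    rw [injective_iff_map_eq_zero]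
    intro x
    obtain ⟨a, rfl⟩ := proj_surjective A x
    rw [map_proj, proj_eq_zero, proj_eq_zero]
    rintro ⟨n, hn⟩
    exact ⟨n, fun i j hij => h.inj (by simpa using hn i j hij)⟩
  exact := by
    classical
    have hgf : ∀ a, g (f a) = 0 := fun a => (h.exact _).2 ⟨a, rfl⟩
    intro y
    constructor
    · obtain ⟨b, rfl⟩ := proj_surjective B y
      rw [map_proj, proj_eq_zero]
      rintro ⟨n, hn⟩
      have hker : ∀ i j, n ≤ i ∨ n ≤ j → ∃ a, f a = b.entry i j := fun i j hij =>
        (h.exact _).1 (hn i j hij)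
      let s : B → A := fun x => if hx : ∃ a, f a = x then hx.choose else 0
      have hs : ∀ x, (∃ a, f a = x) → f (s x) = x := fun x hx => by
        simp only [s, dif_pos hx]
        exact hx.choose_spec
      have hs0 : s 0 = 0 := h.inj (by rw [hs 0 ⟨0, map_zero f⟩, map_zero])
      refine ⟨proj A (Cone.mapFun s hs0 b), ?_⟩
      rw [map_proj, proj_eq_iff, mem_finiteMatrices]
      refine ⟨n, fun i j hij => ?_⟩
      rw [sub_eq_add_neg, Cone.add_entry, Cone.neg_entry, Cone.map_entry]
      change f (s (b.entry i j)) + _ = 0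
      rw [hs _ (hker i j hij), add_neg_cancel]
    · rintro ⟨x, rfl⟩
      obtain ⟨a, rfl⟩ := proj_surjective A x
      rw [map_proj, map_proj, proj_eq_zero]
      exact ⟨0, fun i j _ => hgf _⟩
  surj := by
    classical
    intro z
    obtain ⟨c, rfl⟩ := proj_surjective C z
    let s : C → B := fun x => if x = 0 then 0 else (h.surj x).choose
    have hs : ∀ x, g (s x) = x := by
      intro x
      by_cases hx : x = 0
      · simp [s, hx]
      · simp only [s, if_neg hx]
        exact (h.surj x).choose_spec
    refine ⟨proj B (Cone.mapFun s (by simp [s]) c), ?_⟩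
    rw [map_proj]
    congr 1
    ext i j
    exact hs _

/-- The class in `Σ R` of the matrix with `1` at all positions `(i, i + 1)`. -/
noncomputable def shift (R : Type u) [Ring R] : Susp R := proj R (Cone.upper 1 1)

/-- The class in `Σ R` of the matrix with `1` at all positions `(i + 1, i)`; this is the inverse
of `shift R`. -/
noncomputable def shiftInv (R : Type u) [Ring R] : Susp R := proj R (Cone.lower 1 1)

/-- The homomorphism `R → Σ R` that sends `a` to the class of the diagonal matrix with constant
value `a`. -/
noncomputable def const (R : Type u) [Ring R] : R →+* Susp R where
  toFun a := proj R (Cone.upper 0 a)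
  map_one' := rfl
  map_zero' := by
    rw [← map_zero (proj R)]
    congr 1
    ext i j
    simp [Cone.upper]
  map_add' a b := by
    rw [← map_add]
    congr 1
    ext i j
    simp only [Cone.upper, Cone.add_entry]
    split_ifs <;> simp
  map_mul' a b := by
    rw [← map_mul]
    congr 1
    ext i j
    rw [Cone.upper_mul_entry]
    simp [Cone.upper]

theorem shift_mul_shiftInv (R : Type u) [Ring R] : shift R * shiftInv R = 1 := by
  rw [← proj_one, shift, shiftInv, ← map_mul]
  congr 1
  ext i j
  rw [Cone.upper_mul_entry, Cone.one_def]
  simp only [Cone.upper, Cone.lower, one_mul, add_zero]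
  exact if_congr (by omega) rfl rfl

theorem shiftInv_mul_shift (R : Type u) [Ring R] : shiftInv R * shift R = 1 := by
  rw [← proj_one, shift, shiftInv, ← map_mul, proj_eq_iff, mem_finiteMatrices]
  refine ⟨1, fun i j hij => ?_⟩
  rw [sub_eq_add_neg, Cone.add_entry, Cone.neg_entry,
    Cone.mul_entry (s := {i - 1}) (fun k hk => if_neg (by simp at hk; omega)), Cone.one_def]
  simp only [Cone.upper, Cone.lower, Finset.sum_singleton, add_zero]
  have h1 : 1 ≤ i → (i = i - 1 + 1 ∧ (j = i - 1 + 1 ↔ j = i)) := by omega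
  by_cases hi : 1 ≤ i
  · obtain ⟨h2, h3⟩ := h1 hi
    rw [if_pos h2, if_congr h3 rfl rfl]
    simp
  · rw [if_neg (c := i = i - 1 + 1) (by omega), if_neg (c := j = i) (by omega)]
    simp

theorem const_mul_shift (R : Type u) [Ring R] (a : R) :
    const R a * shift R = shift R * const R a := by
  change proj R (Cone.upper 0 a) * proj R _ = proj R _ * proj R (Cone.upper 0 a)
  rw [← map_mul, ← map_mul]
  congr 1
  ext i j
  rw [Cone.upper_mul_entry, Cone.upper_mul_entry]
  simp [Cone.upper]

theorem map_shift {R S : Type u} [Ring R] [Ring S] (f : R →+* S) :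
    mapUnital f (shift R) = shift S := by
  rw [mapUnital_apply, shift, map_proj, shift]
  congr 1
  ext i j
  change f (if j = i + 1 then 1 else 0) = if j = i + 1 then 1 else 0
  split_ifs <;> simp

theorem map_const {R S : Type u} [Ring R] [Ring S] (f : R →+* S) (a : R) :
    mapUnital f (const R a) = const S (f a) := by
  change map (f : R →ₙ+* S) (proj R (Cone.upper 0 a)) = proj S (Cone.upper 0 (f a))
  rw [map_proj]
  congr 1
  ext i j
  change f (if j = i + 0 then a else 0) = if j = i + 0 then f a else 0
  split_ifs <;> simp

end Susp

/-! ### The group `K₀` -/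

/-- Two idempotent matrices `e`, `f`, of possibly different sizes, are equivalent if `e = x y` and
`f = y x` for some `x`, `y`. This says that the projective modules that are the images of `e` and
`f` are isomorphic or, equivalently, that `e ⊕ 0` and `f ⊕ 0` are conjugate by an invertible matrix
if the zero blocks are large enough. -/
def MvN {R : Type u} [Ring R] {ι κ : Type} [Fintype ι] [Fintype κ]
    (e : Matrix ι ι R) (f : Matrix κ κ R) : Prop :=
  ∃ (x : Matrix ι κ R) (y : Matrix κ ι R), x * y = e ∧ y * x = f

section MvN

variable {R : Type u} [Ring R] {ι κ μ ν : Type} [Fintype ι] [Fintype κ] [Fintype μ] [Fintype ν]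

theorem MvN.refl {e : Matrix ι ι R} (he : e * e = e) : MvN e e := ⟨e, e, he, he⟩

theorem MvN.symm {e : Matrix ι ι R} {f : Matrix κ κ R} (h : MvN e f) : MvN f e := by
  obtain ⟨x, y, h1, h2⟩ := h
  exact ⟨y, x, h2, h1⟩

theorem MvN.trans {e : Matrix ι ι R} {f : Matrix κ κ R} {g : Matrix μ μ R} (he : e * e = e)
    (hg : g * g = g) (h : MvN e f) (h' : MvN f g) : MvN e g := by
  obtain ⟨x, y, rfl, h2⟩ := h
  obtain ⟨z, w, h3, rfl⟩ := h'
  refine ⟨x * z, w * y, ?_, ?_⟩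
  · calc x * z * (w * y) = x * (z * w) * y := by simp only [Matrix.mul_assoc]
      _ = x * y := by rw [h3, ← h2]; simpa only [Matrix.mul_assoc] using he
  · calc w * y * (x * z) = w * (y * x) * z := by simp only [Matrix.mul_assoc]
      _ = w * z := by rw [h2, ← h3]; simpa only [Matrix.mul_assoc] using hg

/-- If `e = x y` and `f = y x`, then `x` and `y` can be chosen with `e x = x = x f` and
`f y = y = y e`. -/
theorem MvN.normalize {e : Matrix ι ι R} {f : Matrix κ κ R} (he : e * e = e) (hf : f * f = f)
    (h : MvN e f) : ∃ (x : Matrix ι κ R) (y : Matrix κ ι R), x * y = e ∧ y * x = f ∧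
      e * x = x ∧ x * f = x ∧ f * y = y ∧ y * e = y := by
  obtain ⟨x, y, rfl, rfl⟩ := h
  simp only [Matrix.mul_assoc] at he hf
  refine ⟨x * (y * x), y * (x * y), ?_, ?_, ?_, ?_, ?_, ?_⟩ <;>
    simp only [Matrix.mul_assoc, he, hf]

theorem MvN.reindex (e : Matrix ι ι R) (he : e * e = e) (σ : ι ≃ κ) :
    MvN e (e.submatrix σ.symm σ.symm) := by
  refine ⟨e.submatrix id σ.symm, e.submatrix σ.symm id, ?_, ?_⟩
  · rw [Matrix.submatrix_mul_equiv, he, Matrix.submatrix_id_id]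
  · rw [← Matrix.submatrix_mul _ _ _ _ _ Function.bijective_id, he]

theorem MvN.sum {e : Matrix ι ι R} {f : Matrix κ κ R} {e' : Matrix μ μ R} {f' : Matrix ν ν R}
    (h : MvN e f) (h' : MvN e' f') :
    MvN (Matrix.fromBlocks e 0 0 e') (Matrix.fromBlocks f 0 0 f') := by
  obtain ⟨x, y, rfl, rfl⟩ := h
  obtain ⟨x', y', rfl, rfl⟩ := h'
  exact ⟨Matrix.fromBlocks x 0 0 x', Matrix.fromBlocks y 0 0 y',
    by simp [Matrix.fromBlocks_multiply], by simp [Matrix.fromBlocks_multiply]⟩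

theorem idem_sum {e : Matrix ι ι R} {f : Matrix κ κ R} (he : e * e = e) (hf : f * f = f) :
    Matrix.fromBlocks e 0 0 f * Matrix.fromBlocks e 0 0 f = Matrix.fromBlocks e 0 0 f := by
  simp [Matrix.fromBlocks_multiply, he, hf]

theorem idem_submatrix {e : Matrix ι ι R} (he : e * e = e) (σ : κ ≃ ι) :
    e.submatrix σ σ * e.submatrix σ σ = e.submatrix σ σ := by
  rw [Matrix.submatrix_mul_equiv, he]

theorem map_mul_map {R S : Type*} [Ring R] [Ring S] (φ : R →+* S) {ι κ μ : Type} [Fintype κ]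
    (x : Matrix ι κ R) (y : Matrix κ μ R) : (x * y).map φ = x.map φ * y.map φ :=
  Matrix.map_mul

theorem idem_map {S : Type*} [Ring S] (φ : R →+* S) {e : Matrix ι ι R} (he : e * e = e) :
    e.map φ * e.map φ = e.map φ := by
  rw [← map_mul_map, he]

theorem MvN.map {S : Type*} [Ring S] (φ : R →+* S) {e : Matrix ι ι R} {f : Matrix κ κ R}
    (h : MvN e f) : MvN (e.map φ) (f.map φ) := by
  obtain ⟨x, y, rfl, rfl⟩ := h
  exact ⟨x.map φ, y.map φ, (map_mul_map φ x y).symm, (map_mul_map φ y x).symm⟩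

end MvN

/-- Idempotent square matrices of all finite sizes. -/
def IdemMatrix (R : Type u) [Ring R] : Type u :=
  Σ n : ℕ, {e : Matrix (Fin n) (Fin n) R // e * e = e}

instance IdemMatrix.setoid (R : Type u) [Ring R] : Setoid (IdemMatrix R) where
  r e f := MvN e.2.1 f.2.1
  iseqv :=
    { refl := fun e => MvN.refl e.2.2
      symm := fun h => h.symm
      trans := fun {e _ g} h h' => h.trans e.2.2 g.2.2 h' }

/-- The monoid of equivalence classes of idempotent matrices over `R` under direct sum, that is, of
isomorphism classes of finitely generated projective modules. -/
def IdemClass (R : Type u) [Ring R] : Type u := Quotient (IdemMatrix.setoid R)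

namespace IdemClass

variable {R : Type u} [Ring R] {ι κ : Type} [Fintype ι] [Fintype κ]

/-- The class of an idempotent matrix whose rows and columns are indexed by any finite type. -/
noncomputable def mk (e : Matrix ι ι R) (he : e * e = e) : IdemClass R :=
  Quotient.mk _ ⟨Fintype.card ι, e.submatrix (Fintype.equivFin ι).symm (Fintype.equivFin ι).symm,
    idem_submatrix he _⟩

theorem mk_eq_mk {e : Matrix ι ι R} {f : Matrix κ κ R} (he : e * e = e) (hf : f * f = f) :
    mk e he = mk f hf ↔ MvN e f := by
  refine Iff.trans Quotient.eq ?_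
  have h1 := MvN.reindex e he (Fintype.equivFin ι)
  have h2 := MvN.reindex f hf (Fintype.equivFin κ)
  constructor
  · intro h
    exact (h1.trans he (idem_submatrix hf _) h).trans he hf h2.symm
  · intro h
    exact (h1.symm.trans (idem_submatrix he _) hf h).trans (idem_submatrix he _)
      (idem_submatrix hf _) h2

theorem exists_mk (x : IdemClass R) :
    ∃ (n : ℕ) (e : Matrix (Fin n) (Fin n) R) (he : e * e = e), mk e he = x := by
  induction x using Quotient.inductionOn with
  | h e =>
    obtain ⟨n, e, he⟩ := e
    refine ⟨n, e, he, Quotient.sound ?_⟩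
    exact (MvN.reindex e he (Fintype.equivFin (Fin n))).symm

noncomputable instance : Add (IdemClass R) where
  add := Quotient.map₂
    (fun e f => ⟨e.1 + f.1, (Matrix.fromBlocks e.2.1 0 0 f.2.1).submatrix
      finSumFinEquiv.symm finSumFinEquiv.symm, idem_submatrix (idem_sum e.2.2 f.2.2) _⟩)
    (fun e e' h f f' h' =>
      ((MvN.reindex _ (idem_sum e.2.2 f.2.2) finSumFinEquiv).symm.trans
        (idem_submatrix (idem_sum e.2.2 f.2.2) _) (idem_sum e'.2.2 f'.2.2) (h.sum h')).trans
        (idem_submatrix (idem_sum e.2.2 f.2.2) _)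
        (idem_submatrix (idem_sum e'.2.2 f'.2.2) _)
        (MvN.reindex _ (idem_sum e'.2.2 f'.2.2) finSumFinEquiv))

theorem mk_add_mk {e : Matrix ι ι R} {f : Matrix κ κ R} (he : e * e = e) (hf : f * f = f) :
    mk e he + mk f hf = mk (Matrix.fromBlocks e 0 0 f) (idem_sum he hf) := by
  have h1 := MvN.reindex e he (Fintype.equivFin ι)
  have h2 := MvN.reindex f hf (Fintype.equivFin κ)
  have hs := idem_sum (idem_submatrix he (Fintype.equivFin ι).symm)
    (idem_submatrix hf (Fintype.equivFin κ).symm)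
  refine Quotient.sound ?_
  exact (((MvN.reindex _ hs finSumFinEquiv).symm.trans (idem_submatrix hs _) (idem_sum he hf)
    (h1.symm.sum h2.symm)).trans (idem_submatrix hs _) (idem_submatrix (idem_sum he hf) _)
    (MvN.reindex _ (idem_sum he hf) _))

noncomputable instance : Zero (IdemClass R) where
  zero := mk (0 : Matrix Empty Empty R) (by simp)

theorem mk_zero : mk (0 : Matrix ι ι R) (by simp) = 0 :=
  (mk_eq_mk _ _).2 ⟨0, 0, by simp, by simp⟩

noncomputable instance : AddCommMonoid (IdemClass R) where
  add_assoc x y z := by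
    obtain ⟨n, e, he, rfl⟩ := exists_mk x
    obtain ⟨m, f, hf, rfl⟩ := exists_mk y
    obtain ⟨l, g, hg, rfl⟩ := exists_mk z
    rw [mk_add_mk, mk_add_mk, mk_add_mk, mk_add_mk, mk_eq_mk]
    convert MvN.reindex _ (idem_sum (idem_sum he hf) hg) (Equiv.sumAssoc _ _ _) using 1
    ext i j
    rcases i with i | i | i <;> rcases j with j | j | j <;> rfl
  zero_add x := by
    obtain ⟨n, e, he, rfl⟩ := exists_mk x
    change mk (0 : Matrix Empty Empty R) _ + _ = _
    rw [mk_add_mk, mk_eq_mk]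
    exact ⟨Matrix.fromRows 0 e, Matrix.fromCols 0 e,
      by rw [Matrix.fromRows_mul_fromCols]; simp [he],
      by rw [Matrix.fromCols_mul_fromRows]; simp [he]⟩
  add_zero x := by
    obtain ⟨n, e, he, rfl⟩ := exists_mk x
    change _ + mk (0 : Matrix Empty Empty R) _ = _
    rw [mk_add_mk, mk_eq_mk]
    exact ⟨Matrix.fromRows e 0, Matrix.fromCols e 0,
      by rw [Matrix.fromRows_mul_fromCols]; simp [he],
      by rw [Matrix.fromCols_mul_fromRows]; simp [he]⟩
  add_comm x y := by
    obtain ⟨n, e, he, rfl⟩ := exists_mk x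
    obtain ⟨m, f, hf, rfl⟩ := exists_mk y
    rw [mk_add_mk, mk_add_mk, mk_eq_mk]
    convert MvN.reindex _ (idem_sum he hf) (Equiv.sumComm _ _) using 1
    ext i j
    rcases i with i | i <;> rcases j with j | j <;> rfl
  nsmul := nsmulRec

/-- An additive map on the monoid of classes of idempotent matrices, given by its values on
matrices. -/
noncomputable def lift {G : Type*} [AddCommGroup G]
    (φ : ∀ (ι : Type) [Fintype ι] [DecidableEq ι] (e : Matrix ι ι R), e * e = e → G)
    (hφ : ∀ (ι κ : Type) [Fintype ι] [DecidableEq ι] [Fintype κ] [DecidableEq κ]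
      (e : Matrix ι ι R) (f : Matrix κ κ R) (he : e * e = e) (hf : f * f = f),
      MvN e f → φ ι e he = φ κ f hf)
    (hadd : ∀ (ι κ : Type) [Fintype ι] [DecidableEq ι] [Fintype κ] [DecidableEq κ]
      (e : Matrix ι ι R) (f : Matrix κ κ R) (he : e * e = e) (hf : f * f = f),
      φ (ι ⊕ κ) (Matrix.fromBlocks e 0 0 f) (idem_sum he hf) = φ ι e he + φ κ f hf) :
    IdemClass R →+ G :=
  AddMonoidHom.mk'
    (Quotient.lift (fun e : IdemMatrix R => φ (Fin e.1) e.2.1 e.2.2)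
      fun _ _ h => hφ _ _ _ _ _ _ h)
    (by
      intro x y
      induction x using Quotient.inductionOn with
      | h e =>
        induction y using Quotient.inductionOn with
        | h f =>
          refine Eq.trans ?_ (hadd _ _ e.2.1 f.2.1 e.2.2 f.2.2)
          exact hφ _ _ _ _ _ _ (MvN.reindex _ (idem_sum e.2.2 f.2.2) finSumFinEquiv).symm)

theorem lift_mk {G : Type*} [AddCommGroup G]
    (φ : ∀ (ι : Type) [Fintype ι] [DecidableEq ι] (e : Matrix ι ι R), e * e = e → G)
    (hφ) (hadd) {ι : Type} [Fintype ι] [DecidableEq ι] (e : Matrix ι ι R) (he : e * e = e) :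
    lift φ hφ hadd (mk e he) = φ ι e he :=
  hφ _ _ _ _ _ _ (MvN.reindex e he _).symm

end IdemClass

/-- `K₀` of a unital ring: the group completion of the monoid of classes of idempotent matrices. -/
abbrev K0 (R : Type u) [Ring R] : Type u := Algebra.GrothendieckAddGroup (IdemClass R)

namespace K0

variable {R : Type u} [Ring R]

/-- The class in `K₀` of an idempotent matrix. -/
noncomputable def cls {ι : Type} [Fintype ι] (e : Matrix ι ι R) (he : e * e = e) : K0 R :=
  Algebra.GrothendieckAddGroup.of (IdemClass.mk e he)

theorem cls_eq {ι κ : Type} [Fintype ι] [Fintype κ] {e : Matrix ι ι R} {f : Matrix κ κ R}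
    (he : e * e = e) (hf : f * f = f) (h : MvN e f) : cls e he = cls f hf :=
  congrArg _ ((IdemClass.mk_eq_mk he hf).2 h)

theorem cls_sum {ι κ : Type} [Fintype ι] [Fintype κ] {e : Matrix ι ι R} {f : Matrix κ κ R}
    (he : e * e = e) (hf : f * f = f) :
    cls (Matrix.fromBlocks e 0 0 f) (idem_sum he hf) = cls e he + cls f hf := by
  unfold cls
  rw [← IdemClass.mk_add_mk, map_add]

/-- A homomorphism on `K₀`, given by its values on idempotent matrices. -/
noncomputable def lift {G : Type*} [AddCommGroup G]
    (φ : ∀ (ι : Type) [Fintype ι] [DecidableEq ι] (e : Matrix ι ι R), e * e = e → G)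
    (hφ : ∀ (ι κ : Type) [Fintype ι] [DecidableEq ι] [Fintype κ] [DecidableEq κ]
      (e : Matrix ι ι R) (f : Matrix κ κ R) (he : e * e = e) (hf : f * f = f),
      MvN e f → φ ι e he = φ κ f hf)
    (hadd : ∀ (ι κ : Type) [Fintype ι] [DecidableEq ι] [Fintype κ] [DecidableEq κ]
      (e : Matrix ι ι R) (f : Matrix κ κ R) (he : e * e = e) (hf : f * f = f),
      φ (ι ⊕ κ) (Matrix.fromBlocks e 0 0 f) (idem_sum he hf) = φ ι e he + φ κ f hf) :
    K0 R →+ G :=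
  Algebra.GrothendieckAddGroup.lift (IdemClass.lift φ hφ hadd)

theorem lift_cls {G : Type*} [AddCommGroup G]
    (φ : ∀ (ι : Type) [Fintype ι] [DecidableEq ι] (e : Matrix ι ι R), e * e = e → G)
    (hφ) (hadd) {ι : Type} [Fintype ι] [DecidableEq ι] (e : Matrix ι ι R) (he : e * e = e) :
    lift φ hφ hadd (cls e he) = φ ι e he := by
  rw [← IdemClass.lift_mk φ hφ hadd e he]
  exact DFunLike.congr_fun
    (Algebra.GrothendieckAddGroup.lift.symm_apply_apply (IdemClass.lift φ hφ hadd)) _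

theorem hom_ext {G : Type*} [AddCommGroup G] {f g : K0 R →+ G}
    (h : ∀ (n : ℕ) (e : Matrix (Fin n) (Fin n) R) (he : e * e = e),
      f (cls e he) = g (cls e he)) : f = g := by
  apply Algebra.GrothendieckAddGroup.lift.symm.injective
  ext x
  obtain ⟨n, e, he, rfl⟩ := IdemClass.exists_mk x
  exact h n e he

/-- Functoriality of `K₀`. -/
noncomputable def map {S : Type*} [Ring S] (φ : R →+* S) : K0 R →+ K0 S :=
  lift (fun _ _ _ e he => cls (e.map φ) (idem_map φ he))
    (fun _ _ _ _ _ _ _ _ _ _ h => cls_eq _ _ (h.map φ))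
    (fun ι κ _ _ _ _ e f he hf => by
      rw [← cls_sum (idem_map φ he) (idem_map φ hf)]
      congr 1
      rw [Matrix.fromBlocks_map]
      congr 1 <;> ext <;> simp)

@[simp] theorem map_cls {S : Type*} [Ring S] (φ : R →+* S) {ι : Type} [Fintype ι]
    (e : Matrix ι ι R) (he : e * e = e) : map φ (cls e he) = cls (e.map φ) (idem_map φ he) := by
  classical
  exact lift_cls _ _ _ e he

theorem map_map {S T : Type*} [Ring S] [Ring T] (φ : R →+* S) (ψ : S →+* T) (x : K0 R) :
    map ψ (map φ x) = map (ψ.comp φ) x := by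
  have : (map ψ).comp (map φ) = map (ψ.comp φ) := hom_ext fun n e he => by
    rw [AddMonoidHom.comp_apply, map_cls, map_cls, map_cls]
    rfl
  exact DFunLike.congr_fun this x

end K0

/-- The unital ring `Ã = ℤ ⊕ A`, the unitization of `A`. -/
def Tilde (A : Type u) [NonUnitalRing A] : Type u := Unitization ℤ A

namespace Tilde

variable {A B C : Type u} [NonUnitalRing A] [NonUnitalRing B] [NonUnitalRing C]

noncomputable instance : Ring (Tilde A) := inferInstanceAs (Ring (Unitization ℤ A))

/-- The component in `A` of an element of `Ã`. -/
def part (x : Tilde A) : A := (show Unitization ℤ A from x).snd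

/-- The unital ring homomorphism `Ã → ℤ`. -/
noncomputable def aug (A : Type u) [NonUnitalRing A] : Tilde A →+* ℤ where
  toFun x := (show Unitization ℤ A from x).fst
  map_one' := rfl
  map_zero' := rfl
  map_add' _ _ := rfl
  map_mul' _ _ := rfl

/-- The inclusion `A → Ã`. -/
noncomputable def incl (A : Type u) [NonUnitalRing A] : A →ₙ+* Tilde A where
  toFun a := Unitization.inr (R := ℤ) a
  map_zero' := Unitization.inr_zero ℤ
  map_add' := Unitization.inr_add ℤ
  map_mul' := Unitization.inr_mul ℤ

@[ext] theorem ext {x y : Tilde A} (h1 : aug A x = aug A y) (h2 : x.part = y.part) : x = y :=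
  Unitization.ext h1 h2

@[simp] theorem part_one : (1 : Tilde A).part = 0 := rfl
@[simp] theorem part_zero : (0 : Tilde A).part = 0 := rfl
@[simp] theorem part_add (x y : Tilde A) : (x + y).part = x.part + y.part := rfl
@[simp] theorem part_neg (x : Tilde A) : (-x).part = -x.part := rfl
@[simp] theorem part_mul (x y : Tilde A) :
    (x * y).part = aug A x • y.part + aug A y • x.part + x.part * y.part := rfl
@[simp] theorem part_incl (a : A) : (incl A a).part = a := rfl
@[simp] theorem aug_incl (a : A) : aug A (incl A a) = 0 := rfl

@[simp] theorem part_intCast (n : ℤ) : (n : Tilde A).part = 0 := by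
  let φ : Tilde A →+ A := ⟨⟨part, rfl⟩, fun _ _ => rfl⟩
  rw [← zsmul_one]
  exact (map_zsmul φ n 1).trans (smul_zero n)

theorem incl_part {x : Tilde A} (h : aug A x = 0) : incl A x.part = x :=
  ext h.symm rfl

/-- The unital homomorphism `Ã → S` induced by a homomorphism from `A` to a unital ring `S`. -/
noncomputable def lift {S : Type*} [Ring S] (f : A →ₙ+* S) : Tilde A →+* S where
  toFun x := (aug A x : S) + f x.part
  map_one' := by simp
  map_zero' := by simp
  map_add' x y := by
    simp only [part_add, map_add, Int.cast_add]
    abel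
  map_mul' x y := by
    simp only [part_mul, map_add, Int.cast_mul, map_mul, map_zsmul, mul_add, add_mul, zsmul_eq_mul]
    rw [(Int.cast_commute (aug A y) (f x.part)).eq]
    abel

theorem lift_apply {S : Type*} [Ring S] (f : A →ₙ+* S) (x : Tilde A) :
    lift f x = (aug A x : S) + f x.part := rfl

/-- Functoriality of the unitization. -/
noncomputable def map (f : A →ₙ+* B) : Tilde A →+* Tilde B := lift ((incl B).comp f)

@[simp] theorem aug_map (f : A →ₙ+* B) (x : Tilde A) : aug B (map f x) = aug A x := by
  simp [map, lift_apply]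

@[simp] theorem part_map (f : A →ₙ+* B) (x : Tilde A) : (map f x).part = f x.part := by
  simp [map, lift_apply]

theorem aug_comp_map (f : A →ₙ+* B) : (aug B).comp (map f) = aug A := by
  apply RingHom.ext
  intro x
  simp

/-- If `A → B → C` is short exact, then so is `A → B̃ → C̃`. -/
theorem isShortExact {f : A →ₙ+* B} {g : B →ₙ+* C} (h : IsShortExact f g) :
    IsShortExact ((incl B).comp f) (map g : Tilde B →ₙ+* Tilde C) where
  inj a b hab := h.inj (congrArg part hab)
  exact x := by
    constructor
    · intro hx
      have h1 : aug B x = 0 := by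
        rw [← aug_map g]
        exact congrArg (aug C) hx
      have h2 : g x.part = 0 := by
        rw [← part_map]
        exact congrArg part hx
      obtain ⟨a, ha⟩ := (h.exact _).1 h2
      refine ⟨a, ?_⟩
      change incl B (f a) = x
      rw [ha, incl_part h1]
    · rintro ⟨a, rfl⟩
      apply Tilde.ext
      · exact (aug_map g (incl B (f a))).trans (by simp)
      · exact (part_map g (incl B (f a))).trans ((h.exact _).2 ⟨a, rfl⟩)
  surj y := by
    obtain ⟨b, hb⟩ := h.surj y.part
    refine ⟨(aug C y : Tilde B) + incl B b, ?_⟩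
    apply Tilde.ext
    · exact (aug_map g _).trans (by simp)
    · exact (part_map g _).trans (by simp [hb])

end Tilde

/-- `K₀ A` for a ring `A` that need not be unital: the kernel of `K₀ Ã → K₀ ℤ`. -/
abbrev K0nu (A : Type u) [NonUnitalRing A] : Type u := (K0.map (Tilde.aug A)).ker

namespace K0nu

variable {A B : Type u} [NonUnitalRing A] [NonUnitalRing B]

/-- Functoriality of `K₀` of nonunital rings. -/
noncomputable def map (f : A →ₙ+* B) : K0nu A →+ K0nu B :=
  ((K0.map (Tilde.map f)).comp (K0.map (Tilde.aug A)).ker.subtype).codRestrict _ (by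
    intro x
    have hx := x.2
    rw [AddMonoidHom.mem_ker] at hx ⊢
    rw [AddMonoidHom.comp_apply, K0.map_map, Tilde.aug_comp_map]
    exact hx)

theorem coe_map (f : A →ₙ+* B) (x : K0nu A) :
    (map f x : K0 (Tilde B)) = K0.map (Tilde.map f) x := rfl

end K0nu

/-! ### The index of an invertible matrix over a quotient ring -/

section Index

variable {I : Type u} [NonUnitalRing I] {S R : Type u} [Ring S] [Ring R]
  {i : I →ₙ+* S} {π : S →+* R}

/-- If `i : I → S` is the inclusion of an ideal, and `X` is a matrix over `S` which is congruent
to the integer matrix `P` modulo `I`, this is the matrix `P + (X - P)` over `Ĩ = ℤ ⊕ I`. -/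
noncomputable def liftMat (i : I →ₙ+* S) {m n : Type} (X : Matrix m n S) (P : Matrix m n ℤ) :
    Matrix m n (Tilde I) :=
  fun a b => (P a b : Tilde I) + Tilde.incl I (Function.invFun i (X a b - P a b))

theorem liftMat_lift (h : IsShortExact i π) {m n : Type} {X : Matrix m n S} {P : Matrix m n ℤ}
    (hX : X.map π = P.map (Int.castRingHom R)) : (liftMat i X P).map (Tilde.lift i) = X := by
  ext a b
  have h1 : π (X a b - P a b) = 0 := by
    have := congrFun (congrFun hX a) b
    simp only [Matrix.map_apply, eq_intCast] at this
    rw [map_sub, this, map_intCast, sub_self]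
  have h2 := Function.invFun_eq ((h.exact _).1 h1)
  simp only [Matrix.map_apply, liftMat, Tilde.lift_apply, map_add, map_intCast, Tilde.aug_incl,
    Tilde.part_incl, h2, Int.cast_zero]
  abel

theorem liftMat_aug {m n : Type} (X : Matrix m n S) (P : Matrix m n ℤ) :
    (liftMat i X P).map (Tilde.aug I) = P := by
  ext a b
  simp [liftMat]

theorem tilde_matrix_ext (hi : Function.Injective i) {m n : Type} {e e' : Matrix m n (Tilde I)}
    (h1 : e.map (Tilde.lift i) = e'.map (Tilde.lift i))
    (h2 : e.map (Tilde.aug I) = e'.map (Tilde.aug I)) : e = e' := by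
  ext1 a b
  have h1' := congrFun (congrFun h1 a) b
  have h2' := congrFun (congrFun h2 a) b
  simp only [Matrix.map_apply] at h1' h2'
  refine Tilde.ext h2' (hi ?_)
  rw [Tilde.lift_apply, Tilde.lift_apply, h2'] at h1'
  exact add_left_cancel h1'

/-- `e` is an idempotent matrix over `Ĩ` that computes the index of `g`: there are rectangular
matrices `X`, `Y` over `S` with `Y X = 1`, whose reductions modulo `I` are `P g` and `g⁻¹ Q` for
integer matrices with `Q P = 1`, such that `e` is `X Y`, with integer part `P Q`. -/
def IsIndexMatrix (i : I →ₙ+* S) (π : S →+* R) {ι κ : Type} [Fintype ι] [DecidableEq ι] [Fintype κ]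
    (g : (Matrix ι ι R)ˣ) (e : Matrix κ κ (Tilde I)) : Prop :=
  ∃ (P : Matrix κ ι ℤ) (Q : Matrix ι κ ℤ) (X : Matrix κ ι S) (Y : Matrix ι κ S),
    Q * P = 1 ∧ Y * X = 1 ∧ X.map π = P.map (Int.castRingHom R) * g.1 ∧
    Y.map π = g⁻¹.1 * Q.map (Int.castRingHom R) ∧
    e.map (Tilde.lift i) = X * Y ∧ e.map (Tilde.aug I) = P * Q

variable {ι κ μ ν : Type} [Fintype ι] [DecidableEq ι] [Fintype κ] [Fintype μ] [DecidableEq μ]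
  [Fintype ν]

theorem IsIndexMatrix.idem (hi : Function.Injective i) {g : (Matrix ι ι R)ˣ}
    {e : Matrix κ κ (Tilde I)} (he : IsIndexMatrix i π g e) : e * e = e := by
  obtain ⟨P, Q, X, Y, h1, h2, -, -, h5, h6⟩ := he
  apply tilde_matrix_ext hi
  · rw [map_mul_map, h5, Matrix.mul_assoc, ← Matrix.mul_assoc Y, h2, Matrix.one_mul]
  · rw [map_mul_map, h6, Matrix.mul_assoc, ← Matrix.mul_assoc Q, h1, Matrix.one_mul]

theorem IsIndexMatrix.mvN (h : IsShortExact i π) {g : (Matrix ι ι R)ˣ}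
    {e : Matrix κ κ (Tilde I)} {f : Matrix ν ν (Tilde I)} (he : IsIndexMatrix i π g e)
    (hf : IsIndexMatrix i π g f) : MvN e f := by
  obtain ⟨P, Q, X, Y, h1, h2, h3, h4, h5, h6⟩ := he
  obtain ⟨P', Q', X', Y', h1', h2', h3', h4', h5', h6'⟩ := hf
  have hx : (X * Y').map π = (P * Q').map (Int.castRingHom R) := by
    rw [map_mul_map, map_mul_map, h3, h4', Matrix.mul_assoc, ← Matrix.mul_assoc g.1,
      ← Units.val_mul, mul_inv_cancel, Units.val_one, Matrix.one_mul]
  have hy : (X' * Y).map π = (P' * Q).map (Int.castRingHom R) := by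
    rw [map_mul_map, map_mul_map, h3', h4, Matrix.mul_assoc, ← Matrix.mul_assoc g.1,
      ← Units.val_mul, mul_inv_cancel, Units.val_one, Matrix.one_mul]
  refine ⟨liftMat i (X * Y') (P * Q'), liftMat i (X' * Y) (P' * Q), ?_, ?_⟩
  · apply tilde_matrix_ext h.inj
    · rw [map_mul_map, liftMat_lift h hx, liftMat_lift h hy, h5, Matrix.mul_assoc,
        ← Matrix.mul_assoc Y', h2', Matrix.one_mul]
    · rw [map_mul_map, liftMat_aug, liftMat_aug, h6, Matrix.mul_assoc,
        ← Matrix.mul_assoc Q', h1', Matrix.one_mul]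
  · apply tilde_matrix_ext h.inj
    · rw [map_mul_map, liftMat_lift h hx, liftMat_lift h hy, h5', Matrix.mul_assoc,
        ← Matrix.mul_assoc Y, h2, Matrix.one_mul]
    · rw [map_mul_map, liftMat_aug, liftMat_aug, h6', Matrix.mul_assoc,
        ← Matrix.mul_assoc Q, h1, Matrix.one_mul]

/-- The block diagonal sum of two invertible matrices. -/
def unitSum (g : (Matrix ι ι R)ˣ) (k : (Matrix μ μ R)ˣ) : (Matrix (ι ⊕ μ) (ι ⊕ μ) R)ˣ where
  val := Matrix.fromBlocks g.1 0 0 k.1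
  inv := Matrix.fromBlocks g⁻¹.1 0 0 k⁻¹.1
  val_inv := by simp [Matrix.fromBlocks_multiply]
  inv_val := by simp [Matrix.fromBlocks_multiply]

theorem unitSum_val (g : (Matrix ι ι R)ˣ) (k : (Matrix μ μ R)ˣ) :
    (unitSum g k).1 = Matrix.fromBlocks g.1 0 0 k.1 := rfl

theorem unitSum_inv_val (g : (Matrix ι ι R)ˣ) (k : (Matrix μ μ R)ˣ) :
    (unitSum g k)⁻¹.1 = Matrix.fromBlocks g⁻¹.1 0 0 k⁻¹.1 := rfl

/-- The invertible block matrix `!![1, a; 0, 1]`. -/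
def upperUnit (a : Matrix ι ι S) : (Matrix (ι ⊕ ι) (ι ⊕ ι) S)ˣ where
  val := Matrix.fromBlocks 1 a 0 1
  inv := Matrix.fromBlocks 1 (-a) 0 1
  val_inv := by simp [Matrix.fromBlocks_multiply]
  inv_val := by simp [Matrix.fromBlocks_multiply]

/-- The invertible block matrix `!![1, 0; a, 1]`. -/
def lowerUnit (a : Matrix ι ι S) : (Matrix (ι ⊕ ι) (ι ⊕ ι) S)ˣ where
  val := Matrix.fromBlocks 1 0 a 1
  inv := Matrix.fromBlocks 1 0 (-a) 1
  val_inv := by simp [Matrix.fromBlocks_multiply]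
  inv_val := by simp [Matrix.fromBlocks_multiply]

/-- The invertible block matrix `!![0, -1; 1, 0]`. -/
def rotUnit (S : Type u) [Ring S] (ι : Type) [Fintype ι] [DecidableEq ι] :
    (Matrix (ι ⊕ ι) (ι ⊕ ι) S)ˣ where
  val := Matrix.fromBlocks 0 (-1) 1 0
  inv := Matrix.fromBlocks 0 1 (-1) 0
  val_inv := by simp [Matrix.fromBlocks_multiply]
  inv_val := by simp [Matrix.fromBlocks_multiply]

/-- The invertible matrix `!![1, a; 0, 1] * !![1, 0; -b, 1] * !![1, a; 0, 1] * !![0, -1; 1, 0]`,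
which equals `!![2a - a b a, a b - 1; 1 - b a, b]`. -/
def hUnit (a b : Matrix ι ι S) : (Matrix (ι ⊕ ι) (ι ⊕ ι) S)ˣ :=
  upperUnit a * lowerUnit (-b) * upperUnit a * rotUnit S ι

theorem hUnit_val (a b : Matrix ι ι S) :
    (hUnit a b).1 = Matrix.fromBlocks (2 • a - a * b * a) (a * b - 1) (1 - b * a) b := by
  simp only [hUnit, Units.val_mul, upperUnit, lowerUnit, rotUnit, Matrix.fromBlocks_multiply]
  congr 1 <;> noncomm_ring

theorem hUnit_map {g : (Matrix ι ι R)ˣ} {a b : Matrix ι ι S} (ha : a.map π = g.1)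
    (hb : b.map π = g⁻¹.1) : (hUnit a b).1.map π = (unitSum g g⁻¹).1 := by
  have hone : (1 : Matrix ι ι S).map π = 1 := Matrix.map_one π (map_zero π) (map_one π)
  have hsub : ∀ x y : Matrix ι ι S, (x - y).map π = x.map π - y.map π := fun x y =>
    Matrix.map_sub π (map_sub π) x y
  rw [hUnit_val, Matrix.fromBlocks_map, two_smul, hsub, hsub, hsub, Matrix.map_add π (map_add π),
    map_mul_map, map_mul_map, map_mul_map, hone, ha, hb, unitSum_val]
  simp

theorem map_units_inv {w : (Matrix ι ι S)ˣ} {v : (Matrix ι ι R)ˣ} (hw : w.1.map π = v.1) :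
    w⁻¹.1.map π = v⁻¹.1 := by
  have h1 : v.1 * w⁻¹.1.map π = 1 := by
    rw [← hw, ← map_mul_map, ← Units.val_mul, mul_inv_cancel, Units.val_one,
      Matrix.map_one π (map_zero π) (map_one π)]
  exact (Units.inv_eq_of_mul_eq_one_right h1).symm

/-- The idempotent matrix `h p h⁻¹` over `Ĩ`, where `h = !![2a - a b a, a b - 1; 1 - b a, b]` and
`p = !![1, 0; 0, 0]`, for matrices `a`, `b` over `S` that are inverse to each other modulo `I`. -/
noncomputable def indexMatrix (i : I →ₙ+* S) (a b : Matrix ι ι S) :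
    Matrix (ι ⊕ ι) (ι ⊕ ι) (Tilde I) :=
  liftMat i ((hUnit a b).1 * Matrix.fromBlocks 1 0 0 0 * (hUnit a b)⁻¹.1)
    (Matrix.fromBlocks 1 0 0 0)

/-- The block column `(1, 0)`. -/
def colOne (T : Type*) [Ring T] (ι : Type) [DecidableEq ι] : Matrix (ι ⊕ ι) ι T :=
  Matrix.fromRows (1 : Matrix ι ι T) (0 : Matrix ι ι T)

/-- The block row `(1, 0)`. -/
def rowOne (T : Type*) [Ring T] (ι : Type) [DecidableEq ι] : Matrix ι (ι ⊕ ι) T :=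
  Matrix.fromCols (1 : Matrix ι ι T) (0 : Matrix ι ι T)

theorem colOne_mul_rowOne (T : Type*) [Ring T] :
    colOne T ι * rowOne T ι = Matrix.fromBlocks 1 0 0 0 := by
  rw [colOne, rowOne, Matrix.fromRows_mul_fromCols]
  simp

theorem rowOne_mul_colOne (T : Type*) [Ring T] : rowOne T ι * colOne T ι = 1 := by
  rw [colOne, rowOne, Matrix.fromCols_mul_fromRows]
  simp

theorem colOne_map {T T' : Type*} [Ring T] [Ring T'] (φ : T →+* T') :
    (colOne T ι).map φ = colOne T' ι := by
  ext x y
  rcases x with x | x <;> simp [colOne, Matrix.one_apply, apply_ite φ]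

theorem rowOne_map {T T' : Type*} [Ring T] [Ring T'] (φ : T →+* T') :
    (rowOne T ι).map φ = rowOne T' ι := by
  ext x y
  rcases y with y | y <;> simp [rowOne, Matrix.one_apply, apply_ite φ]

theorem isIndexMatrix_indexMatrix (h : IsShortExact i π) {g : (Matrix ι ι R)ˣ}
    {a b : Matrix ι ι S} (ha : a.map π = g.1) (hb : b.map π = g⁻¹.1) :
    IsIndexMatrix i π g (indexMatrix i a b) := by
  have hw := hUnit_map ha hb
  have hw' := map_units_inv hw
  have hX : ((hUnit a b).1 * colOne S ι).map π =
      (colOne ℤ ι).map (Int.castRingHom R) * g.1 := by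
    rw [map_mul_map, hw, colOne_map, colOne_map, unitSum_val, colOne,
      Matrix.fromBlocks_mul_fromRows, Matrix.fromRows_mul]
    simp
  have hY : (rowOne S ι * (hUnit a b)⁻¹.1).map π =
      g⁻¹.1 * (rowOne ℤ ι).map (Int.castRingHom R) := by
    rw [map_mul_map, hw', rowOne_map, rowOne_map, unitSum_inv_val, rowOne,
      Matrix.fromCols_mul_fromBlocks, Matrix.mul_fromCols]
    simp
  have hXY : (hUnit a b).1 * Matrix.fromBlocks 1 0 0 0 * (hUnit a b)⁻¹.1 =
      (hUnit a b).1 * colOne S ι * (rowOne S ι * (hUnit a b)⁻¹.1) := by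
    rw [← colOne_mul_rowOne]
    simp only [Matrix.mul_assoc]
  refine ⟨colOne ℤ ι, rowOne ℤ ι, (hUnit a b).1 * colOne S ι, rowOne S ι * (hUnit a b)⁻¹.1,
    rowOne_mul_colOne ℤ, ?_, hX, hY, ?_, ?_⟩
  · rw [Matrix.mul_assoc, ← Matrix.mul_assoc _ _ (colOne S ι), ← Units.val_mul, inv_mul_cancel,
      Units.val_one, Matrix.one_mul, rowOne_mul_colOne]
  · rw [indexMatrix, hXY]
    refine liftMat_lift h ?_
    rw [map_mul_map, hX, hY, ← colOne_mul_rowOne, map_mul_map, Matrix.mul_assoc,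
      ← Matrix.mul_assoc g.1, ← Units.val_mul, mul_inv_cancel, Units.val_one, Matrix.one_mul]
  · rw [indexMatrix, liftMat_aug, colOne_mul_rowOne]

theorem IsIndexMatrix.cls_sub_mem (h : IsShortExact i π) {g : (Matrix ι ι R)ˣ}
    {e : Matrix κ κ (Tilde I)} (he : IsIndexMatrix i π g e) :
    K0.cls e (he.idem h.inj) - K0.cls (1 : Matrix ι ι (Tilde I)) (mul_one 1) ∈
      (K0.map (Tilde.aug I)).ker := by
  rw [AddMonoidHom.mem_ker, map_sub, sub_eq_zero, K0.map_cls, K0.map_cls]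
  apply K0.cls_eq
  obtain ⟨P, Q, X, Y, h1, -, -, -, -, h6⟩ := he
  refine ⟨P, Q, h6.symm, ?_⟩
  rw [h1, Matrix.map_one _ (map_zero _) (map_one _)]

/-- For an exact sequence `0 → I → S → R → 0` with `S → R` a unital homomorphism of unital rings,
the index `[h p h⁻¹] - [p]` in `K₀ I` of an invertible matrix `g` over `R`, where `h` is the
invertible matrix over `S`, lifting `!![g, 0; 0, g⁻¹]`, that is built as above from lifts `a`, `b`
of `g` and `g⁻¹`. This is the boundary map from `K₁ R` to `K₀ I`. -/
noncomputable def index (h : IsShortExact i π) (g : (Matrix ι ι R)ˣ) : K0nu I :=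
  ⟨_, (isIndexMatrix_indexMatrix h (g := g) (a := g.1.map (Function.surjInv h.surj))
    (b := g⁻¹.1.map (Function.surjInv h.surj))
    (by ext; exact Function.surjInv_eq h.surj _)
    (by ext; exact Function.surjInv_eq h.surj _)).cls_sub_mem h⟩

/-- The index does not depend on choices. -/
theorem index_eq (h : IsShortExact i π) {g : (Matrix ι ι R)ˣ}
    {e : Matrix κ κ (Tilde I)} (he : IsIndexMatrix i π g e) :
    (index h g : K0 (Tilde I)) = K0.cls e (he.idem h.inj) - K0.cls (1 : Matrix ι ι (Tilde I))
      (mul_one 1) := by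
  unfold index
  dsimp only
  congr 1
  exact K0.cls_eq _ _ (IsIndexMatrix.mvN h (isIndexMatrix_indexMatrix h
    (by ext; exact Function.surjInv_eq h.surj _)
    (by ext; exact Function.surjInv_eq h.surj _)) he)

theorem exists_isIndexMatrix (h : IsShortExact i π) (g : (Matrix ι ι R)ˣ) :
    ∃ e : Matrix (ι ⊕ ι) (ι ⊕ ι) (Tilde I), IsIndexMatrix i π g e :=
  ⟨_, isIndexMatrix_indexMatrix h (g := g) (a := g.1.map (Function.surjInv h.surj))
    (b := g⁻¹.1.map (Function.surjInv h.surj))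
    (by ext; exact Function.surjInv_eq h.surj _)
    (by ext; exact Function.surjInv_eq h.surj _)⟩

theorem index_unitSum (h : IsShortExact i π) (g : (Matrix ι ι R)ˣ) (k : (Matrix μ μ R)ˣ) :
    index h (unitSum g k) = index h g + index h k := by
  obtain ⟨e, he⟩ := exists_isIndexMatrix h g
  obtain ⟨f, hf⟩ := exists_isIndexMatrix h k
  have hef : IsIndexMatrix i π (unitSum g k) (Matrix.fromBlocks e 0 0 f) := by
    obtain ⟨P, Q, X, Y, h1, h2, h3, h4, h5, h6⟩ := he
    obtain ⟨P', Q', X', Y', h1', h2', h3', h4', h5', h6'⟩ := hf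
    refine ⟨Matrix.fromBlocks P 0 0 P', Matrix.fromBlocks Q 0 0 Q', Matrix.fromBlocks X 0 0 X',
      Matrix.fromBlocks Y 0 0 Y', ?_, ?_, ?_, ?_, ?_, ?_⟩
    · simp [Matrix.fromBlocks_multiply, h1, h1']
    · simp [Matrix.fromBlocks_multiply, h2, h2']
    · simp [Matrix.fromBlocks_multiply, Matrix.fromBlocks_map, h3, h3', unitSum_val]
    · simp [Matrix.fromBlocks_multiply, Matrix.fromBlocks_map, h4, h4', unitSum_inv_val]
    · simp [Matrix.fromBlocks_multiply, Matrix.fromBlocks_map, h5, h5']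
    · simp [Matrix.fromBlocks_multiply, Matrix.fromBlocks_map, h6, h6']
  apply Subtype.ext
  rw [AddSubgroup.coe_add, index_eq h he, index_eq h hf, index_eq h hef,
    K0.cls_sum (he.idem h.inj) (hf.idem h.inj)]
  have : K0.cls (1 : Matrix (ι ⊕ μ) (ι ⊕ μ) (Tilde I)) (mul_one 1) =
      K0.cls (1 : Matrix ι ι (Tilde I)) (mul_one 1) +
      K0.cls (1 : Matrix μ μ (Tilde I)) (mul_one 1) := by
    rw [← K0.cls_sum]
    congr 1
    exact Matrix.fromBlocks_one.symm
  rw [this]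
  abel

theorem index_mul_of_lifts (h : IsShortExact i π) (g v : (Matrix ι ι R)ˣ) (w : (Matrix ι ι S)ˣ)
    (hw : w.1.map π = v.1) : index h (g * v) = index h g := by
  have hw' := map_units_inv hw
  obtain ⟨e, he⟩ := exists_isIndexMatrix h g
  have he' : IsIndexMatrix i π (g * v) e := by
    obtain ⟨P, Q, X, Y, h1, h2, h3, h4, h5, h6⟩ := he
    refine ⟨P, Q, X * w.1, w⁻¹.1 * Y, h1, ?_, ?_, ?_, ?_, h6⟩
    · rw [Matrix.mul_assoc, ← Matrix.mul_assoc Y, h2, Matrix.one_mul, ← Units.val_mul,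
        inv_mul_cancel, Units.val_one]
    · rw [map_mul_map, h3, hw, Units.val_mul, Matrix.mul_assoc]
    · rw [map_mul_map, h4, hw', mul_inv_rev, Units.val_mul, Matrix.mul_assoc]
    · rw [h5, Matrix.mul_assoc, ← Matrix.mul_assoc w.1, ← Units.val_mul, mul_inv_cancel,
        Units.val_one, Matrix.one_mul]
  apply Subtype.ext
  rw [index_eq h he, index_eq h he']

theorem index_one (h : IsShortExact i π) : index h (1 : (Matrix ι ι R)ˣ) = 0 := by
  have he : IsIndexMatrix i π (1 : (Matrix ι ι R)ˣ) (1 : Matrix ι ι (Tilde I)) := by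
    refine ⟨1, 1, 1, 1, ?_, ?_, ?_, ?_, ?_, ?_⟩ <;>
      simp [Matrix.map_one]
  apply Subtype.ext
  rw [index_eq h he, sub_self]
  rfl

theorem index_mul (h : IsShortExact i π) (g k : (Matrix ι ι R)ˣ) :
    index h (g * k) = index h g + index h k := by
  have hw := hUnit_map (π := π) (g := k) (a := k.1.map (Function.surjInv h.surj))
    (b := k⁻¹.1.map (Function.surjInv h.surj))
    (by ext; exact Function.surjInv_eq h.surj _)
    (by ext; exact Function.surjInv_eq h.surj _)
  have h1 : unitSum g k * unitSum k k⁻¹ = unitSum (g * k) 1 := by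
    apply Units.ext
    rw [Units.val_mul, unitSum_val, unitSum_val, unitSum_val, Matrix.fromBlocks_multiply]
    simp
  rw [← index_unitSum, ← index_mul_of_lifts h (unitSum g k) _ _ hw, h1, index_unitSum,
    index_one, add_zero]

end Index

section IndexNaturality

variable {I : Type u} [NonUnitalRing I] {S R : Type u} [Ring S] [Ring R]
  {i : I →ₙ+* S} {π : S →+* R}
  {I' : Type u} [NonUnitalRing I'] {S' R' : Type u} [Ring S'] [Ring R']
  {i' : I' →ₙ+* S'} {π' : S' →+* R'}
  {ι : Type} [Fintype ι] [DecidableEq ι] {κ : Type} [Fintype κ]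

/-- The image of an invertible matrix under a ring homomorphism. -/
noncomputable def unitMap (ρ : R →+* R') (g : (Matrix ι ι R)ˣ) : (Matrix ι ι R')ˣ :=
  Units.map (RingHom.mapMatrix ρ : Matrix ι ι R →+* Matrix ι ι R') g

theorem unitMap_val (ρ : R →+* R') (g : (Matrix ι ι R)ˣ) : (unitMap ρ g).1 = g.1.map ρ := rfl

theorem unitMap_inv_val (ρ : R →+* R') (g : (Matrix ι ι R)ˣ) :
    (unitMap ρ g)⁻¹.1 = g⁻¹.1.map ρ := rfl

theorem IsIndexMatrix.map {g : (Matrix ι ι R)ˣ} {e : Matrix κ κ (Tilde I)}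
    (he : IsIndexMatrix i π g e) (α : I →ₙ+* I') (σ : S →+* S') (ρ : R →+* R')
    (h1 : ∀ x, σ (i x) = i' (α x)) (h2 : ∀ x, ρ (π x) = π' (σ x)) :
    IsIndexMatrix i' π' (unitMap ρ g) (e.map (Tilde.map α)) := by
  obtain ⟨P, Q, X, Y, hQP, hYX, hX, hY, h5, h6⟩ := he
  have h2' : ∀ {m n : Type} (Z : Matrix m n S), (Z.map σ).map π' = (Z.map π).map ρ := by
    intro m n Z
    ext a b
    exact (h2 _).symm
  have hZ : ∀ {m n : Type} (Z : Matrix m n ℤ),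
      (Z.map (Int.castRingHom R)).map ρ = Z.map (Int.castRingHom R') := by
    intro m n Z
    ext a b
    simp
  refine ⟨P, Q, X.map σ, Y.map σ, hQP, ?_, ?_, ?_, ?_, ?_⟩
  · rw [← map_mul_map, hYX, Matrix.map_one _ (map_zero _) (map_one _)]
  · rw [h2', hX, map_mul_map, hZ, unitMap_val]
  · rw [h2', hY, map_mul_map, hZ, unitMap_inv_val]
  · rw [← map_mul_map, ← h5]
    ext a b
    simp [Tilde.lift_apply, h1]
  · rw [← h6]
    ext a b
    simp

theorem index_naturality (h : IsShortExact i π) (h' : IsShortExact i' π') (α : I →ₙ+* I')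
    (σ : S →+* S') (ρ : R →+* R') (h1 : ∀ x, σ (i x) = i' (α x))
    (h2 : ∀ x, ρ (π x) = π' (σ x)) (g : (Matrix ι ι R)ˣ) :
    K0nu.map α (index h g) = index h' (unitMap ρ g) := by
  obtain ⟨e, he⟩ := exists_isIndexMatrix h g
  apply Subtype.ext
  rw [K0nu.coe_map, index_eq h he, index_eq h' (he.map α σ ρ h1 h2), map_sub, K0.map_cls,
    K0.map_cls]
  congr 2
  exact Matrix.map_one _ (map_zero _) (map_one _)

end IndexNaturality

/-! ### The boundary map `K₀ C → K₋₁ A` -/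

section Deloop

variable {R : Type u} [Ring R] {ι κ : Type} [Fintype ι] [DecidableEq ι] [Fintype κ] [DecidableEq κ]

/-- The scalar matrix with entry the shift. -/
noncomputable def diagShift (R : Type u) [Ring R] (ι : Type) [DecidableEq ι] :
    Matrix ι ι (Susp R) :=
  Matrix.diagonal fun _ => Susp.shift R

/-- The scalar matrix with entry the inverse of the shift. -/
noncomputable def diagShiftInv (R : Type u) [Ring R] (ι : Type) [DecidableEq ι] :
    Matrix ι ι (Susp R) :=
  Matrix.diagonal fun _ => Susp.shiftInv R

theorem map_const_mul_shift (x : Matrix ι κ R) :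
    x.map (Susp.const R) * diagShift R κ = diagShift R ι * x.map (Susp.const R) := by
  refine Matrix.ext fun a b => ?_
  rw [diagShift, diagShift, Matrix.mul_diagonal, Matrix.diagonal_mul]
  exact Susp.const_mul_shift R _

theorem diagonal_shift_mul_inv : diagShift R ι * diagShiftInv R ι = 1 := by
  rw [diagShift, diagShiftInv, Matrix.diagonal_mul_diagonal]
  simp [Susp.shift_mul_shiftInv]

theorem diagonal_inv_mul_shift : diagShiftInv R ι * diagShift R ι = 1 := by
  rw [diagShift, diagShiftInv, Matrix.diagonal_mul_diagonal]
  simp [Susp.shiftInv_mul_shift]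

theorem deloop_aux {T : Type*} [Ring T] {e s s' : T} (he : e * e = e) (hs : e * s = s * e)
    (h1 : s * s' = 1) (h2 : s' * s = 1) : (1 - e + e * s) * (1 - e + e * s') = 1 := by
  have h3 : e * s' = s' * e := by
    calc e * s' = s' * s * (e * s') := by rw [h2, one_mul]
      _ = s' * (s * e) * s' := by simp only [mul_assoc]
      _ = s' * (e * s) * s' := by rw [hs]
      _ = s' * e * (s * s') := by simp only [mul_assoc]
      _ = s' * e := by rw [h1, mul_one]
  have a1 : (1 - e) * (1 - e) = 1 - e := by
    simp only [mul_sub, sub_mul, he, one_mul, mul_one]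
    abel
  have a2 : (1 - e) * (e * s') = 0 := by rw [← mul_assoc, sub_mul, he, one_mul, sub_self, zero_mul]
  have a3 : e * s * (1 - e) = 0 := by rw [hs, mul_assoc, mul_sub, he, mul_one, sub_self, mul_zero]
  have a4 : e * s * (e * s') = e := by
    rw [hs, mul_assoc, ← mul_assoc e e, he, h3, ← mul_assoc, h1, one_mul]
  rw [add_mul, mul_add, mul_add, a1, a2, a3, a4]
  abel

/-- The invertible matrix `1 - e + e s` over `Σ R`, where `e` is an idempotent matrix over `R` and
`s` is the shift. Its index in the extension `0 → M_∞ R → Γ R → Σ R → 0` is the image of `[e]` under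
the isomorphism `K₀ R = K₀ (M_∞ R)`, so `[e] ↦ [1 - e + e s]` is the inverse of the isomorphism
`K₁ (Σ R) = K₀ R` given by the boundary map of that extension. -/
noncomputable def deloop (e : Matrix ι ι R) (he : e * e = e) : (Matrix ι ι (Susp R))ˣ where
  val := 1 - e.map (Susp.const R) + e.map (Susp.const R) * diagShift R ι
  inv := 1 - e.map (Susp.const R) + e.map (Susp.const R) * diagShiftInv R ι
  val_inv := deloop_aux (idem_map _ he) (map_const_mul_shift e) diagonal_shift_mul_inv
    diagonal_inv_mul_shift
  inv_val := by
    refine deloop_aux (idem_map _ he) ?_ diagonal_inv_mul_shift diagonal_shift_mul_inv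
    have h := map_const_mul_shift e
    calc e.map (Susp.const R) * diagShiftInv R ι
        = diagShiftInv R ι *
          (diagShift R ι * e.map (Susp.const R)) *
          diagShiftInv R ι := by
          rw [← Matrix.mul_assoc, diagonal_inv_mul_shift, Matrix.one_mul]
      _ = diagShiftInv R ι * e.map (Susp.const R) *
          (diagShift R ι *
          diagShiftInv R ι) := by
          rw [← h]
          simp only [Matrix.mul_assoc]
      _ = diagShiftInv R ι * e.map (Susp.const R) := by
          rw [diagonal_shift_mul_inv, Matrix.mul_one]

theorem deloop_val (e : Matrix ι ι R) (he : e * e = e) : (deloop e he).1 =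
    1 - e.map (Susp.const R) + e.map (Susp.const R) * diagShift R ι := rfl

theorem deloop_sum {e : Matrix ι ι R} {f : Matrix κ κ R} (he : e * e = e) (hf : f * f = f) :
    deloop (Matrix.fromBlocks e 0 0 f) (idem_sum he hf) = unitSum (deloop e he) (deloop f hf) := by
  apply Units.ext
  refine Matrix.ext fun x y => ?_
  rw [unitSum_val, deloop_val, deloop_val, deloop_val]
  rcases x with x | x <;> rcases y with y | y <;> simp [diagShift, Matrix.one_apply]

theorem deloop_map {R' : Type u} [Ring R'] (ρ : R →+* R') (e : Matrix ι ι R) (he : e * e = e) :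
    unitMap (Susp.mapUnital ρ) (deloop e he) = deloop (e.map ρ) (idem_map ρ he) := by
  apply Units.ext
  refine Matrix.ext fun x y => ?_
  simp only [unitMap_val, deloop_val, diagShift, Matrix.map_apply, Matrix.add_apply, Matrix.sub_apply,
    Matrix.mul_diagonal, map_add, map_sub, map_mul, Susp.map_const, Susp.map_shift]
  congr 2
  simp only [Matrix.one_apply]
  split_ifs
  · exact map_one (Susp.mapUnital ρ)
  · exact map_zero (Susp.mapUnital ρ)

/-- Equivalent idempotents have conjugate stabilized deloopings. -/
theorem deloop_mvN {e : Matrix ι ι R} {f : Matrix κ κ R} (he : e * e = e) (hf : f * f = f)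
    (h : MvN e f) : ∃ w : (Matrix (ι ⊕ κ) (ι ⊕ κ) (Susp R))ˣ,
      w * unitSum (deloop e he) 1 = unitSum 1 (deloop f hf) * w := by
  obtain ⟨x, y, hxy, hyx, hex, hxf, hfy, hye⟩ := h.normalize he hf
  have hw : Matrix.fromBlocks (1 - e) x y (1 - f) * Matrix.fromBlocks (1 - e) x y (1 - f) = 1 := by
    rw [Matrix.fromBlocks_multiply, ← Matrix.fromBlocks_one]
    congr 1
    · simp only [hxy, Matrix.mul_sub, Matrix.sub_mul, he, Matrix.one_mul, Matrix.mul_one]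
      abel
    · rw [Matrix.sub_mul, Matrix.mul_sub, hex, hxf]
      simp
    · rw [Matrix.mul_sub, Matrix.sub_mul, hfy, hye]
      simp
    · simp only [hyx, Matrix.mul_sub, Matrix.sub_mul, hf, Matrix.one_mul, Matrix.mul_one]
      abel
  let w : (Matrix (ι ⊕ κ) (ι ⊕ κ) R)ˣ := ⟨_, _, hw, hw⟩
  let c := Susp.const R
  have hone : ∀ (μ : Type) [DecidableEq μ], (1 : Matrix μ μ R).map c = 1 := fun μ _ =>
    Matrix.map_one c (map_zero c) (map_one c)
  have hsub : ∀ {μ : Type} (x y : Matrix μ μ R), (x - y).map c = x.map c - y.map c := fun x y =>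
    Matrix.map_sub c (map_sub c) x y
  have hS := map_const_mul_shift y
  have hSf := map_const_mul_shift f
  have he' := idem_map c he
  have hf' := idem_map c hf
  have hfy' : f.map c * y.map c = y.map c := by rw [← map_mul_map, hfy]
  have hye' : y.map c * e.map c = y.map c := by rw [← map_mul_map, hye]
  refine ⟨unitMap c w, Units.ext ?_⟩
  rw [Units.val_mul, Units.val_mul, unitMap_val, unitSum_val, unitSum_val]
  change (Matrix.fromBlocks (1 - e) x y (1 - f)).map c * _ =
    _ * (Matrix.fromBlocks (1 - e) x y (1 - f)).map c
  rw [Matrix.fromBlocks_map, Matrix.fromBlocks_multiply, Matrix.fromBlocks_multiply, deloop_val,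
    deloop_val, hsub, hsub, hone, hone]
  change Matrix.fromBlocks ((1 - e.map c) * (1 - e.map c + e.map c * diagShift R ι) + x.map c * 0)
    ((1 - e.map c) * 0 + x.map c * 1)
    (y.map c * (1 - e.map c + e.map c * diagShift R ι) + (1 - f.map c) * 0)
    (y.map c * 0 + (1 - f.map c) * 1) = Matrix.fromBlocks (1 * (1 - e.map c) + 0 * y.map c)
    (1 * x.map c + 0 * (1 - f.map c))
    (0 * (1 - e.map c) + (1 - f.map c + f.map c * diagShift R κ) * y.map c)
    (0 * x.map c + (1 - f.map c + f.map c * diagShift R κ) * (1 - f.map c))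
  change y.map c * _ = _ * y.map c at hS
  change f.map c * _ = _ * f.map c at hSf
  simp only [Matrix.mul_zero, Matrix.zero_mul, add_zero, zero_add, Matrix.mul_one, Matrix.one_mul]
  congr 1
  · simp only [Matrix.mul_add, Matrix.mul_sub, Matrix.sub_mul, ← Matrix.mul_assoc, he',
      Matrix.one_mul, Matrix.mul_one]
    abel
  · rw [Matrix.mul_add, Matrix.add_mul, Matrix.mul_sub, Matrix.sub_mul, Matrix.mul_one,
      Matrix.one_mul, hye', hfy', ← Matrix.mul_assoc, hye', Matrix.mul_assoc (f.map c), ← hS,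
      ← Matrix.mul_assoc, hfy']
  · rw [hSf]
    simp only [Matrix.mul_sub, Matrix.sub_mul, Matrix.add_mul, Matrix.mul_assoc, hf',
      Matrix.one_mul, Matrix.mul_one]
    abel

end Deloop

section Boundary

variable {A B C : Type u} [NonUnitalRing A] [NonUnitalRing B] [NonUnitalRing C]
  {f : A →ₙ+* B} {g : B →ₙ+* C}

/-- If `A → B → C` is short exact, then so is `Σ A → Σ B̃ → Σ C̃`. -/
theorem suspTilde_isShortExact (h : IsShortExact f g) :
    IsShortExact (Susp.map ((Tilde.incl B).comp f)) (Susp.mapUnital (Tilde.map g)) :=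
  Susp.isShortExact (Tilde.isShortExact h)

/-- For a short exact sequence `0 → A → B → C → 0`, the composite of the isomorphism
`K₀ C̃ = K₁ (Σ C̃)` and of the boundary map from `K₁ (Σ C̃)` to `K₀ (Σ A)` of the exact sequence
`0 → Σ A → Σ B̃ → Σ C̃ → 0`. -/
noncomputable def boundaryTilde (h : IsShortExact f g) : K0 (Tilde C) →+ K0nu (Susp A) :=
  K0.lift (fun _ _ _ e he => index (suspTilde_isShortExact h) (deloop e he))
    (fun ι κ _ _ _ _ e e' he he' hee' => by
      obtain ⟨w, hw⟩ := deloop_mvN he he' hee'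
      have := congrArg (index (suspTilde_isShortExact h)) hw
      rw [index_mul, index_mul, index_unitSum, index_unitSum, index_one, index_one, add_zero,
        zero_add, add_comm] at this
      exact add_right_cancel this)
    (fun ι κ _ _ _ _ e e' he he' => by rw [deloop_sum, index_unitSum])

theorem boundaryTilde_cls (h : IsShortExact f g) {ι : Type} [Fintype ι] [DecidableEq ι]
    (e : Matrix ι ι (Tilde C)) (he : e * e = e) :
    boundaryTilde h (K0.cls e he) = index (suspTilde_isShortExact h) (deloop e he) :=
  K0.lift_cls _ _ _ e he

/-- The boundary map `K₀ C → K₀ (Σ A) = K₋₁ A` of a short exact sequence `0 → A → B → C → 0`: the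
restriction of `boundaryTilde` to `K₀ C ⊆ K₀ C̃`. -/
noncomputable def boundary (h : IsShortExact f g) : K0nu C →+ K0nu (Susp A) :=
  (boundaryTilde h).comp (K0.map (Tilde.aug C)).ker.subtype

variable {A' B' C' : Type u} [NonUnitalRing A'] [NonUnitalRing B'] [NonUnitalRing C']
  {f' : A' →ₙ+* B'} {g' : B' →ₙ+* C'}

theorem boundary_naturality (h : IsShortExact f g) (h' : IsShortExact f' g') (α : A →ₙ+* A')
    (β : B →ₙ+* B') (γ : C →ₙ+* C') (h1 : ∀ x, β (f x) = f' (α x)) (h2 : ∀ x, γ (g x) = g' (β x))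
    (x : K0nu C) :
    K0nu.map (Susp.map α) (boundary h x) = boundary h' (K0nu.map γ x) := by
  have key : (K0nu.map (Susp.map α)).comp (boundaryTilde h) =
      (boundaryTilde h').comp (K0.map (Tilde.map γ)) := by
    refine K0.hom_ext fun n e he => ?_
    rw [AddMonoidHom.comp_apply, AddMonoidHom.comp_apply, K0.map_cls, boundaryTilde_cls,
      boundaryTilde_cls, index_naturality _ (suspTilde_isShortExact h') (Susp.map α)
      (Susp.mapUnital (Tilde.map β)) (Susp.mapUnital (Tilde.map γ)), deloop_map]
    · intro x
      rw [Susp.mapUnital_apply, Susp.map_map, Susp.map_map]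
      refine congrArg (fun k => Susp.map k _) (NonUnitalRingHom.ext fun a => ?_)
      change Tilde.map β (Tilde.incl B (f a)) = Tilde.incl B' (f' (α a))
      apply Tilde.ext <;> simp [h1]
    · intro x
      rw [Susp.mapUnital_apply, Susp.mapUnital_apply, Susp.mapUnital_apply, Susp.mapUnital_apply,
        Susp.map_map, Susp.map_map]
      refine congrArg (fun k => Susp.map k _) (NonUnitalRingHom.ext fun a => ?_)
      change Tilde.map γ (Tilde.map g a) = Tilde.map g' (Tilde.map β a)
      apply Tilde.ext <;> simp [h2]
  exact DFunLike.congr_fun key x.1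

end Boundary

/-! ### Polynomials, paths and loops -/

/-- The kernel of a homomorphism, as a ring. -/
def kernel {A B : Type*} [NonUnitalRing A] [NonUnitalRing B] (f : A →ₙ+* B) :
    NonUnitalSubring A where
  carrier := {x | f x = 0}
  zero_mem' := map_zero f
  add_mem' {x y} (hx : f x = 0) (hy : f y = 0) :=
    show f (x + y) = 0 by rw [map_add, hx, hy, add_zero]
  neg_mem' {x} (hx : f x = 0) := show f (-x) = 0 by rw [map_neg, hx, neg_zero]
  mul_mem' {x y} (hx : f x = 0) _ := show f (x * y) = 0 by rw [map_mul, hx, zero_mul]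

theorem mem_kernel {A B : Type*} [NonUnitalRing A] [NonUnitalRing B] {f : A →ₙ+* B} {x : A} :
    x ∈ kernel f ↔ f x = 0 := Iff.rfl

/-- The homomorphism induced on kernels by a commutative square. -/
def kernelMap {A B A' B' : Type*} [NonUnitalRing A] [NonUnitalRing B] [NonUnitalRing A']
    [NonUnitalRing B'] (f : A →ₙ+* B) (f' : A' →ₙ+* B') (α : A →ₙ+* A') (β : B →ₙ+* B')
    (h : ∀ x, f' (α x) = β (f x)) : kernel f →ₙ+* kernel f' where
  toFun x := ⟨α x, by rw [mem_kernel, h, mem_kernel.1 x.2, map_zero]⟩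
  map_zero' := Subtype.ext (map_zero α)
  map_add' x y := Subtype.ext (map_add α _ _)
  map_mul' x y := Subtype.ext (map_mul α _ _)

open Polynomial in
/-- The polynomial ring `A[t]`: the ring of the polynomials over `Ã` with all coefficients in
`A`. -/
noncomputable def Poly (A : Type u) [NonUnitalRing A] : NonUnitalSubring (Tilde A)[X] where
  carrier := {p | ∀ n, Tilde.aug A (p.coeff n) = 0}
  zero_mem' n := by simp
  add_mem' {p q} hp hq n := by rw [coeff_add, map_add, hp n, hq n, add_zero]
  neg_mem' {p} hp n := by rw [coeff_neg, map_neg, hp n, neg_zero]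
  mul_mem' {p q} hp _ n := by
    rw [coeff_mul, map_sum]
    exact Finset.sum_eq_zero fun x _ => by rw [map_mul, hp, zero_mul]

namespace Poly

variable {A B : Type u} [NonUnitalRing A] [NonUnitalRing B]

/-- The homomorphism `A → A[t]` that sends `a` to the constant polynomial `a`. -/
noncomputable def const (A : Type u) [NonUnitalRing A] : A →ₙ+* Poly A where
  toFun a := ⟨Polynomial.C (Tilde.incl A a), fun n => by
    rw [Polynomial.coeff_C]
    split_ifs <;> simp⟩
  map_zero' := Subtype.ext (by simp)
  map_add' a b := Subtype.ext (by simp)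
  map_mul' a b := Subtype.ext (by simp)

/-- Evaluation of polynomials over `Ã` at an integer. -/
noncomputable def evTilde (A : Type u) [NonUnitalRing A] (r : ℤ) :
    Polynomial (Tilde A) →+* Tilde A :=
  Polynomial.eval₂RingHom' (RingHom.id _) (r : Tilde A) fun a => Int.commute_cast a r

theorem evTilde_apply (r : ℤ) (p : Polynomial (Tilde A)) : evTilde A r p = p.eval (r : Tilde A) :=
  rfl

theorem aug_evTilde (r : ℤ) {p : Polynomial (Tilde A)} (hp : p ∈ Poly A) :
    Tilde.aug A (evTilde A r p) = 0 := by
  rw [evTilde_apply, Polynomial.eval_eq_sum, Polynomial.sum, map_sum]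
  exact Finset.sum_eq_zero fun n _ => by rw [map_mul, hp n, zero_mul]

/-- Evaluation `A[t] → A` at an integer. -/
noncomputable def ev (A : Type u) [NonUnitalRing A] (r : ℤ) : Poly A →ₙ+* A where
  toFun p := (evTilde A r p).part
  map_zero' := by
    rw [ZeroMemClass.coe_zero, map_zero]
    rfl
  map_add' p q := by
    rw [AddMemClass.coe_add, map_add]
    rfl
  map_mul' p q := by
    rw [MulMemClass.coe_mul, map_mul, Tilde.part_mul, aug_evTilde r p.2, aug_evTilde r q.2,
      zero_smul, zero_smul, zero_add, zero_add]

/-- Functoriality of `A[t]`. -/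
noncomputable def map (f : A →ₙ+* B) : Poly A →ₙ+* Poly B where
  toFun p := ⟨p.1.map (Tilde.map f), fun n => by
    rw [Polynomial.coeff_map, Tilde.aug_map]
    exact p.2 n⟩
  map_zero' := Subtype.ext (Polynomial.map_zero _)
  map_add' p q := Subtype.ext (Polynomial.map_add _)
  map_mul' p q := Subtype.ext (Polynomial.map_mul _)

theorem ev_map (f : A →ₙ+* B) (r : ℤ) (p : Poly A) : ev B r (map f p) = f (ev A r p) := by
  have h : evTilde B r (p.1.map (Tilde.map f)) = Tilde.map f (evTilde A r p.1) := by
    rw [evTilde_apply, evTilde_apply, Polynomial.eval_map, ← Polynomial.eval₂_at_apply,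
      map_intCast]
  change (evTilde B r (p.1.map (Tilde.map f))).part = _
  rw [h, Tilde.part_map]
  rfl

end Poly

/-- The path ring `P A`, the kernel of evaluation `A[t] → A` at `0`. -/
noncomputable abbrev Path (A : Type u) [NonUnitalRing A] : NonUnitalSubring (Poly A) :=
  kernel (Poly.ev A 0)

/-- Evaluation `P A → A` at `1`. -/
noncomputable def Path.ev (A : Type u) [NonUnitalRing A] : Path A →ₙ+* A :=
  (Poly.ev A 1).comp (NonUnitalSubringClass.subtype (Path A))

/-- The loop ring `Ω A`, the kernel of evaluation `P A → A` at `1`. -/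
noncomputable abbrev Loop (A : Type u) [NonUnitalRing A] : NonUnitalSubring (Path A) :=
  kernel (Path.ev A)

/-- The inclusion `Ω A → P A`. -/
noncomputable def Loop.incl (A : Type u) [NonUnitalRing A] : Loop A →ₙ+* Path A :=
  NonUnitalSubringClass.subtype (Loop A)

/-- Functoriality of `P A`. -/
noncomputable def Path.map {A B : Type u} [NonUnitalRing A] [NonUnitalRing B] (f : A →ₙ+* B) :
    Path A →ₙ+* Path B :=
  kernelMap _ _ (Poly.map f) f (Poly.ev_map f 0)

theorem Path.ev_map {A B : Type u} [NonUnitalRing A] [NonUnitalRing B] (f : A →ₙ+* B)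
    (p : Path A) : Path.ev B (Path.map f p) = f (Path.ev A p) :=
  Poly.ev_map f 1 p.1

/-- Functoriality of `Ω A`. -/
noncomputable def Loop.map {A B : Type u} [NonUnitalRing A] [NonUnitalRing B] (f : A →ₙ+* B) :
    Loop A →ₙ+* Loop B :=
  kernelMap _ _ (Path.map f) f (Path.ev_map f)

/-- The exact sequence `0 → Ω A → P A → A → 0`. -/
theorem Loop.isShortExact (A : Type u) [NonUnitalRing A] :
    IsShortExact (Loop.incl A) (Path.ev A) where
  inj := Subtype.val_injective
  exact p := ⟨fun h => ⟨⟨p, h⟩, rfl⟩, by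
    rintro ⟨q, rfl⟩
    exact q.2⟩
  surj a := by
    have hmem : Polynomial.monomial 1 (Tilde.incl A a) ∈ Poly A := fun n => by
      rw [Polynomial.coeff_monomial]
      split_ifs <;> simp
    have h0 : Poly.ev A 0 ⟨_, hmem⟩ = 0 := by
      change (Poly.evTilde A 0 _).part = 0
      rw [Poly.evTilde_apply, Polynomial.eval_monomial]
      simp
    refine ⟨⟨⟨_, hmem⟩, h0⟩, ?_⟩
    change (Poly.evTilde A 1 (Polynomial.monomial 1 (Tilde.incl A a))).part = a
    rw [Poly.evTilde_apply, Polynomial.eval_monomial]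
    simp

/-! ### Iterated suspensions and loops, and negative `K`-theory -/

/-- A ring, not necessarily unital, bundled with its type. -/
structure Rng : Type (u + 1) where
  carrier : Type u
  [ring : NonUnitalRing carrier]

attribute [instance] Rng.ring

/-- `Σ^p A`. -/
noncomputable def suspIter : ℕ → Rng.{u} → Rng.{u}
  | 0, A => A
  | p + 1, A => ⟨Susp (suspIter p A).carrier⟩

/-- `Ω^m A`. -/
noncomputable def loopIter : ℕ → Rng.{u} → Rng.{u}
  | 0, A => A
  | m + 1, A => ⟨Loop (loopIter m A).carrier⟩

/-- Functoriality of `Σ^p`. -/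
noncomputable def suspIterMap : (p : ℕ) → {A B : Rng.{u}} → (A.carrier →ₙ+* B.carrier) →
    ((suspIter p A).carrier →ₙ+* (suspIter p B).carrier)
  | 0, _, _, f => f
  | p + 1, _, _, f => Susp.map (suspIterMap p f)

/-- Functoriality of `Ω^m`. -/
noncomputable def loopIterMap : (m : ℕ) → {A B : Rng.{u}} → (A.carrier →ₙ+* B.carrier) →
    ((loopIter m A).carrier →ₙ+* (loopIter m B).carrier)
  | 0, _, _, f => f
  | m + 1, _, _, f => Loop.map (loopIterMap m f)

theorem suspIter_isShortExact (p : ℕ) {A B C : Rng.{u}} {f : A.carrier →ₙ+* B.carrier}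
    {g : B.carrier →ₙ+* C.carrier} (h : IsShortExact f g) :
    IsShortExact (suspIterMap p f) (suspIterMap p g) := by
  induction p with
  | zero => exact h
  | succ p ih => exact Susp.isShortExact ih

theorem suspIterMap_map (p : ℕ) {A B C : Rng.{u}} (f : A.carrier →ₙ+* B.carrier)
    (g : B.carrier →ₙ+* C.carrier) (x : (suspIter p A).carrier) :
    suspIterMap p g (suspIterMap p f x) = suspIterMap p (g.comp f) x := by
  induction p with
  | zero => rfl
  | succ p ih =>
    refine (Susp.map_map _ _ x).trans ?_
    exact congrArg (fun k => Susp.map k x) (NonUnitalRingHom.ext ih)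

/-- The group `K₋ₚ A = K₀ (Σ^p A)`, for `p ≥ 0`. -/
abbrev negK (p : ℕ) (A : Rng.{u}) : Type u := K0nu (suspIter p A).carrier

/-- Functoriality of `K₋ₚ`. -/
noncomputable def negKMap (p : ℕ) {A B : Rng.{u}} (f : A.carrier →ₙ+* B.carrier) :
    negK p A →+ negK p B :=
  K0nu.map (suspIterMap p f)

/-- The boundary map `K₋ₚ C → K₋ₚ₋₁ A` of a short exact sequence `0 → A → B → C → 0`. -/
noncomputable def negKBoundary (p : ℕ) {A B C : Rng.{u}} {f : A.carrier →ₙ+* B.carrier}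
    {g : B.carrier →ₙ+* C.carrier} (h : IsShortExact f g) : negK p C →+ negK (p + 1) A :=
  boundary (suspIter_isShortExact p h)

theorem negKBoundary_naturality (p : ℕ) {A B C A' B' C' : Rng.{u}}
    {f : A.carrier →ₙ+* B.carrier} {g : B.carrier →ₙ+* C.carrier}
    {f' : A'.carrier →ₙ+* B'.carrier} {g' : B'.carrier →ₙ+* C'.carrier}
    (h : IsShortExact f g) (h' : IsShortExact f' g') (α : A.carrier →ₙ+* A'.carrier)
    (β : B.carrier →ₙ+* B'.carrier) (γ : C.carrier →ₙ+* C'.carrier)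
    (h1 : ∀ x, β (f x) = f' (α x)) (h2 : ∀ x, γ (g x) = g' (β x)) (x : negK p C) :
    negKMap (p + 1) α (negKBoundary p h x) = negKBoundary p h' (negKMap p γ x) := by
  refine boundary_naturality (suspIter_isShortExact p h) (suspIter_isShortExact p h')
    (suspIterMap p α) (suspIterMap p β) (suspIterMap p γ) (fun y => ?_) (fun y => ?_) x
  · rw [suspIterMap_map, suspIterMap_map]
    exact congrArg (fun k => suspIterMap p k y) (NonUnitalRingHom.ext h1)
  · rw [suspIterMap_map, suspIterMap_map]
    exact congrArg (fun k => suspIterMap p k y) (NonUnitalRingHom.ext h2)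

/-! ### Homotopy `K`-theory -/

/-- The map `K₋ₚ (Ω^m A) → K₋ₚ₋₁ (Ω^(m+1) A)`: the boundary map of the exact sequence
`0 → Ω^(m+1) A → P (Ω^m A) → Ω^m A → 0`. -/
noncomputable def loopBoundary (p m : ℕ) (A : Rng.{u}) :
    negK p (loopIter m A) →+ negK (p + 1) (loopIter (m + 1) A) :=
  negKBoundary p (A := loopIter (m + 1) A) (B := ⟨Path (loopIter m A).carrier⟩)
    (C := loopIter m A) (Loop.isShortExact (loopIter m A).carrier)

theorem loopBoundary_naturality (p m : ℕ) {A B : Rng.{u}} (f : A.carrier →ₙ+* B.carrier)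
    (x : negK p (loopIter m A)) :
    negKMap (p + 1) (loopIterMap (m + 1) f) (loopBoundary p m A x) =
      loopBoundary p m B (negKMap p (loopIterMap m f) x) :=
  negKBoundary_naturality p (A := loopIter (m + 1) A) (B := ⟨Path (loopIter m A).carrier⟩)
    (C := loopIter m A) (A' := loopIter (m + 1) B) (B' := ⟨Path (loopIter m B).carrier⟩)
    (C' := loopIter m B) (Loop.isShortExact _) (Loop.isShortExact _)
    (loopIterMap (m + 1) f) (Path.map (loopIterMap m f)) (loopIterMap m f)
    (fun _ => rfl) (fun p => (Path.ev_map (loopIterMap m f) p).symm) x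

/-- The maps `K₋ₚ (Ω^(n+p) A) → K₋q (Ω^(n+q) A)` for `p ≤ q`, where `p = b + i`, `q = b + j` and
`n = a - b`: the composites of the boundary maps above. -/
noncomputable def transition (a b : ℕ) (A : Rng.{u}) (i j : ℕ) (h : i ≤ j) :
    negK (b + i) (loopIter (a + i) A) →+ negK (b + j) (loopIter (a + j) A) :=
  Nat.leRec (motive := fun j _ =>
      negK (b + i) (loopIter (a + i) A) →+ negK (b + j) (loopIter (a + j) A))
    (AddMonoidHom.id _) (fun j _ φ => (loopBoundary (b + j) (a + j) A).comp φ) h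

theorem transition_naturality (a b : ℕ) {A B : Rng.{u}} (f : A.carrier →ₙ+* B.carrier)
    (i j : ℕ) (h : i ≤ j) :
    (negKMap (b + j) (loopIterMap (a + j) f)).comp (transition a b A i j h) =
      (transition a b B i j h).comp (negKMap (b + i) (loopIterMap (a + i) f)) := by
  induction j, h using Nat.le_induction with
  | base =>
    simp only [transition, Nat.leRec_self]
    rfl
  | succ j hij ih =>
    simp only [transition, Nat.leRec_succ _ _ hij] at ih ⊢
    rw [AddMonoidHom.comp_assoc, ← ih]
    ext x : 1
    exact loopBoundary_naturality (b + j) (a + j) f _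

/-- Weibel's homotopy `K`-theory `KH_n A`, for `n ∈ ℤ`: the colimit of the groups `K₋ₚ (Ω^(n+p) A)`
over the integers `p` with `p ≥ 0` and `n + p ≥ 0`, along the boundary maps
`K₋ₚ (Ω^(n+p) A) → K₋ₚ₋₁ (Ω^(n+p+1) A)`. Here `p = max (-n) 0 + k` for `k = 0, 1, 2, …`, so that
`n + p = max n 0 + k`. -/
def KH (n : ℤ) (A : Type u) [NonUnitalRing A] : Type u :=
  AddCommGroup.DirectLimit (fun k : ℕ => negK ((-n).toNat + k) (loopIter (n.toNat + k) ⟨A⟩))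
    (transition n.toNat (-n).toNat ⟨A⟩)

noncomputable instance (n : ℤ) (A : Type u) [NonUnitalRing A] : AddCommGroup (KH n A) :=
  inferInstanceAs (AddCommGroup (AddCommGroup.DirectLimit
    (fun k : ℕ => negK ((-n).toNat + k) (loopIter (n.toNat + k) ⟨A⟩))
    (transition n.toNat (-n).toNat ⟨A⟩)))

/-- Functoriality of `KH_n`. -/
noncomputable def KH.map (n : ℤ) {A B : Type u} [NonUnitalRing A] [NonUnitalRing B]
    (f : A →ₙ+* B) : KH n A →+ KH n B :=
  AddCommGroup.DirectLimit.map
    (f := transition n.toNat (-n).toNat ⟨A⟩) (f' := transition n.toNat (-n).toNat ⟨B⟩)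
    (fun k => negKMap ((-n).toNat + k) (loopIterMap (n.toNat + k) (A := ⟨A⟩) (B := ⟨B⟩) f))
    (fun i j h => transition_naturality n.toNat (-n).toNat (A := ⟨A⟩) (B := ⟨B⟩) f i j h)

/-- A ring is nilpotent if there is `N` such that all products of `N + 1` elements vanish. -/
def IsNilpotentRing (A : Type u) [NonUnitalRing A] : Prop :=
  ∃ N : ℕ, ∀ (a : A) (l : List A), l.length = N → l.foldl (· * ·) a = 0

end HomotopyK

namespace HomotopyK

/-! ### Stable equivalence of idempotents -/

/-! Everything rests on one fact about `K₀` and its deloopings `K₋ₚ A = K₀ (Σ^p A)`: a short exact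
sequence `A → B → C` gives exactness of `K₋ₚ A → K₋ₚ B → K₋ₚ C → K₋ₚ₋₁ A → K₋ₚ₋₁ B`. As `Σ` is
exact, only `p = 0` has to be treated. Exactness at `K₀ B` is half exactness (`K0nu.exact`): an
equivalence of idempotents over the quotient becomes, after stabilisation, conjugation by an
invertible matrix that lifts. The other two places use the index map. Its kernel consists of the
stably liftable matrices (`exists_lift_of_index_eq_zero`), and its image of the classes that die in
the middle ring (`exists_index_eq`).

Passing from indices to idempotents uses that `[e] ↦ 1 - e + e s` is a right inverse, up to the
isomorphism `K₀ R = K₀ (M_∞ R)`, of the index of `M_∞ R → Γ R → Σ R` (`index_deloop`), and that `K₀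
(Γ A) = 0` by an Eilenberg swindle (`IsFlabby.eq_zero`). The swindle needs that conjugation by an
isometry of an ambient ring acts trivially on `K₀` (`IsConj.map_eq`). The same principle, with the
truncation of matrices, gives stability of `K₀`, and then of all `K₋ₚ` by means of the cone
extension.

Excision for `KH`: `Ω^m` is exact, so each stage of the colimit has the exact sequence above. The
boundary maps of `Ω^m A → Ω^m B → Ω^m C` anticommute with the transition maps (`boundary_boundary`,
a statement on `3 × 3` diagrams), so they induce a map of colimits after multiplication by `(-1)^p`.
Exactness survives because the colimit is sequential: an element that vanishes in the colimit
vanishes at a finite stage.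

Contractible rings have vanishing `KH` (`KH.eq_zero_of_contractible`): a section of `P A → A` makes
every class of `K₋ₚ (Ω^m A)` come from `P (Ω^m A)`, so the very next transition map kills it. Path
rings are contractible by `t ↦ t s`, which gives homotopy invariance through `P A → A[t] → A`. Rings
with zero multiplication are contractible by `a ↦ a t`, which gives nilinvariance by induction on
the nilpotency degree. Finally `Ω^m (M_∞ A) ≅ M_∞ (Ω^m A)` reduces stability of `KH` to that of
`K₋ₚ`. -/

theorem MvN.idem_add_compl {R : Type u} [Ring R] {ι : Type} [Fintype ι] [DecidableEq ι]
    {e : Matrix ι ι R} (he : e * e = e) :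
    MvN (Matrix.fromBlocks e 0 0 (1 - e)) (1 : Matrix ι ι R) := by
  refine ⟨Matrix.fromRows e (1 - e), Matrix.fromCols e (1 - e), ?_, ?_⟩
  · rw [Matrix.fromRows_mul_fromCols]
    simp [Matrix.mul_sub, Matrix.sub_mul, he]
  · rw [Matrix.fromCols_mul_fromRows]
    simp [Matrix.mul_sub, Matrix.sub_mul, he]

theorem idem_compl {R : Type u} [Ring R] {ι : Type} [Fintype ι] [DecidableEq ι]
    {e : Matrix ι ι R} (he : e * e = e) : (1 - e) * (1 - e) = 1 - e := by
  simp [Matrix.mul_sub, Matrix.sub_mul, he]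

namespace K0

variable {R : Type u} [Ring R] {ι κ : Type} [Fintype ι] [Fintype κ]

theorem exists_cls_sub_cls (x : K0 R) : ∃ (n m : ℕ) (e : Matrix (Fin n) (Fin n) R) (he : e * e = e)
    (f : Matrix (Fin m) (Fin m) R) (hf : f * f = f), x = cls e he - cls f hf := by
  induction x using AddLocalization.induction_on with
  | H y =>
    obtain ⟨n, e, he, h1⟩ := IdemClass.exists_mk y.1
    obtain ⟨m, f, hf, h2⟩ := IdemClass.exists_mk y.2.1
    refine ⟨n, m, e, he, f, hf, ?_⟩
    unfold cls
    rw [h1, h2]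
    change _ = AddLocalization.mk y.1 0 - AddLocalization.mk y.2.1 0
    rw [Algebra.GrothendieckAddGroup.mk_sub_mk]
    congr 1
    · simp
    · ext; simp

/-- The class of the free module with basis `ι`. -/
noncomputable def one (R : Type u) [Ring R] (ι : Type) [Fintype ι] [DecidableEq ι] : K0 R :=
  cls (1 : Matrix ι ι R) (mul_one 1)

theorem map_one {S : Type*} [Ring S] (φ : R →+* S) [DecidableEq ι] :
    map φ (one R ι) = one S ι := by
  rw [one, map_cls, one]
  congr 1
  exact Matrix.map_one _ (map_zero _) (_root_.map_one _)

theorem one_sum [DecidableEq ι] [DecidableEq κ] : one R (ι ⊕ κ) = one R ι + one R κ := by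
  rw [one, one, one, ← cls_sum]
  congr 1
  exact Matrix.fromBlocks_one.symm

theorem cls_add_compl [DecidableEq ι] {e : Matrix ι ι R} (he : e * e = e) :
    cls e he + cls (1 - e) (idem_compl he) = one R ι := by
  rw [← cls_sum]
  exact cls_eq _ _ (MvN.idem_add_compl he)

/-- In the group completion `e` and `f` agree once some idempotent `g` has been added to both.
Adding `1 - g` as well turns `g` into an identity matrix. -/
theorem cls_eq_iff {e : Matrix ι ι R} {f : Matrix κ κ R} (he : e * e = e) (hf : f * f = f) :
    cls e he = cls f hf ↔ ∃ k : ℕ, MvN (Matrix.fromBlocks e 0 0 (1 : Matrix (Fin k) (Fin k) R))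
      (Matrix.fromBlocks f 0 0 (1 : Matrix (Fin k) (Fin k) R)) := by
  constructor
  · intro h
    obtain ⟨⟨c, hct⟩, hc⟩ := AddLocalization.r_iff_exists.1 (AddLocalization.mk_eq_mk_iff.1
      (show AddLocalization.mk (IdemClass.mk e he) (0 : (⊤ : AddSubmonoid (IdemClass R))) =
        AddLocalization.mk (IdemClass.mk f hf) 0 from h))
    obtain ⟨k, g, hg, rfl⟩ := IdemClass.exists_mk c
    refine ⟨k, ?_⟩
    have h1 : IdemClass.mk e he + IdemClass.mk g hg = IdemClass.mk f hf + IdemClass.mk g hg := by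
      simpa [add_comm] using hc
    have h2 := congrArg (· + IdemClass.mk (1 - g) (idem_compl hg)) h1
    have h3 : IdemClass.mk g hg + IdemClass.mk (1 - g) (idem_compl hg) =
        IdemClass.mk (1 : Matrix (Fin k) (Fin k) R) (mul_one 1) := by
      rw [IdemClass.mk_add_mk, IdemClass.mk_eq_mk]
      exact MvN.idem_add_compl hg
    simp only [add_assoc, h3] at h2
    rwa [IdemClass.mk_add_mk, IdemClass.mk_add_mk, IdemClass.mk_eq_mk] at h2
  · rintro ⟨k, h⟩
    have := cls_eq (idem_sum he (mul_one 1)) (idem_sum hf (mul_one 1)) h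
    rw [cls_sum he (mul_one 1), cls_sum hf (mul_one 1)] at this
    exact add_right_cancel this

theorem cls_eq_one_iff [DecidableEq κ] {e : Matrix ι ι R} (he : e * e = e) :
    cls e he = one R κ ↔ ∃ k : ℕ, MvN (Matrix.fromBlocks e 0 0 (1 : Matrix (Fin k) (Fin k) R))
      (1 : Matrix (κ ⊕ Fin k) (κ ⊕ Fin k) R) := by
  rw [one, cls_eq_iff]
  simp only [Matrix.fromBlocks_one]

/-- A difference `[e] - [f]` equals `[e ⊕ (1 - f)] - [1]`. -/
theorem exists_cls_sub_one (x : K0 R) : ∃ (n m : ℕ) (e : Matrix (Fin n) (Fin n) R) (he : e * e = e),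
    x = cls e he - one R (Fin m) := by
  obtain ⟨n, m, e, he, f, hf, rfl⟩ := exists_cls_sub_cls x
  refine ⟨n + m, m, _, idem_submatrix (idem_sum he (idem_compl hf)) finSumFinEquiv.symm, ?_⟩
  rw [← cls_add_compl hf, ← cls_eq (idem_sum he (idem_compl hf)) _
    (MvN.reindex _ (idem_sum he (idem_compl hf)) finSumFinEquiv),
    cls_sum he (idem_compl hf)]
  abel

end K0

namespace K0nu

variable {A : Type u} [NonUnitalRing A]

/-- An element of `K₀ A` is the difference of an idempotent matrix over `Ã` and of an identity
matrix to which it becomes equivalent over `ℤ`. -/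
theorem exists_cls_sub_one (x : K0nu A) : ∃ (n k : ℕ)
    (e : Matrix (Fin n ⊕ Fin k) (Fin n ⊕ Fin k) (Tilde A)) (he : e * e = e) (m : ℕ)
    (P : Matrix (Fin n ⊕ Fin k) (Fin m ⊕ Fin k) ℤ) (Q : Matrix (Fin m ⊕ Fin k) (Fin n ⊕ Fin k) ℤ),
    e.map (Tilde.aug A) = P * Q ∧ Q * P = 1 ∧
      (x : K0 (Tilde A)) = K0.cls e he - K0.one (Tilde A) (Fin m ⊕ Fin k) := by
  obtain ⟨n, m, e, he, hx⟩ := K0.exists_cls_sub_one (x : K0 (Tilde A))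
  have h := x.2
  rw [AddMonoidHom.mem_ker, hx, map_sub, sub_eq_zero, K0.map_one, K0.map_cls,
    K0.cls_eq_one_iff] at h
  obtain ⟨k, P, Q, h1, h2⟩ := h
  -- The block needed for the stable equivalence over `ℤ` is absorbed in the representative, so that
  -- its integer part is equivalent to an identity matrix on the nose.
  refine ⟨n, k, Matrix.fromBlocks e 0 0 1, idem_sum he (mul_one 1), m, P, Q, ?_, h2, ?_⟩
  · rw [h1, Matrix.fromBlocks_map, Matrix.map_one _ (map_zero _) (map_one _)]
    congr 1
  · rw [hx, K0.cls_sum he (mul_one 1), K0.one_sum]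
    change _ = K0.cls e he + K0.one (Tilde A) (Fin k) - _
    abel

@[simp] theorem map_id (x : K0nu A) : map (NonUnitalRingHom.id A) x = x := by
  apply Subtype.ext
  rw [coe_map]
  obtain ⟨n, m, e, he, f, hf, hx⟩ := K0.exists_cls_sub_cls (x : K0 (Tilde A))
  rw [hx, map_sub, K0.map_cls, K0.map_cls]
  congr 2 <;> ext <;> simp

theorem map_map {B C : Type u} [NonUnitalRing B] [NonUnitalRing C] (f : A →ₙ+* B) (g : B →ₙ+* C)
    (x : K0nu A) : map g (map f x) = map (g.comp f) x := by
  apply Subtype.ext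
  rw [coe_map, coe_map, coe_map, K0.map_map]
  refine congrArg (fun k => K0.map k _) (RingHom.ext fun a => ?_)
  apply Tilde.ext <;> simp

/-- The unital extension of the zero map factors through `Ã → ℤ`, and the elements of `K0nu A` are
those that die in `K₀ ℤ`. -/
theorem coe_lift_zero {S : Type u} [Ring S] (f : A →ₙ+* S) (hf : ∀ a, f a = 0) (x : K0nu A) :
    K0.map (Tilde.lift f) x = 0 := by
  have : Tilde.lift f = (Int.castRingHom S).comp (Tilde.aug A) := by
    ext a
    simp [Tilde.lift_apply, hf]
  rw [this, ← K0.map_map, AddMonoidHom.mem_ker.1 x.2, map_zero]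

theorem map_eq_zero {B : Type u} [NonUnitalRing B] (f : A →ₙ+* B) (hf : ∀ a, f a = 0)
    (x : K0nu A) : map f x = 0 :=
  Subtype.ext (coe_lift_zero _ (fun a => by simp [hf]) x)

end K0nu

/-! ### Exactness of the index map -/

section IndexExact

variable {I : Type u} [NonUnitalRing I] {S R : Type u} [Ring S] [Ring R]
  {i : I →ₙ+* S} {π : S →+* R} {ι : Type} [Fintype ι] [DecidableEq ι]

/-- An invertible matrix whose index vanishes can be lifted after adding an identity matrix. -/
theorem exists_lift_of_index_eq_zero (h : IsShortExact i π) {g : (Matrix ι ι R)ˣ}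
    (hg : index h g = 0) : ∃ (k : ℕ) (w : (Matrix (ι ⊕ Fin k) (ι ⊕ Fin k) S)ˣ),
      w.1.map π = (unitSum g (1 : (Matrix (Fin k) (Fin k) R)ˣ)).1 := by
  obtain ⟨e, he⟩ := exists_isIndexMatrix h g
  have h0 := index_eq h he
  rw [hg, ZeroMemClass.coe_zero, eq_comm, sub_eq_zero] at h0
  obtain ⟨k, a, b, hab, hba⟩ := (K0.cls_eq_one_iff _).1 h0
  obtain ⟨P, Q, X, Y, hQP, hYX, hX, hY, he1, he2⟩ := he
  let X' := Matrix.fromBlocks X 0 0 (1 : Matrix (Fin k) (Fin k) S)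
  let Y' := Matrix.fromBlocks Y 0 0 (1 : Matrix (Fin k) (Fin k) S)
  let P' := Matrix.fromBlocks P 0 0 (1 : Matrix (Fin k) (Fin k) ℤ)
  let Q' := Matrix.fromBlocks Q 0 0 (1 : Matrix (Fin k) (Fin k) ℤ)
  have hone : ∀ {T T' : Type u} [Ring T] [Ring T'] (φ : T →+* T') {μ : Type} [Fintype μ]
      [DecidableEq μ], (1 : Matrix μ μ T).map φ = 1 := fun φ _ _ _ =>
    Matrix.map_one _ (map_zero _) (map_one _)
  have hYX' : Y' * X' = 1 := by simp [X', Y', Matrix.fromBlocks_multiply, hYX]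
  have hQP' : Q' * P' = 1 := by simp [P', Q', Matrix.fromBlocks_multiply, hQP]
  have hXY' : a.map (Tilde.lift i) * b.map (Tilde.lift i) = X' * Y' := by
    rw [← map_mul_map, hab, Matrix.fromBlocks_map, he1, hone]
    simp [X', Y', Matrix.fromBlocks_multiply]
  have hPQ' : a.map (Tilde.aug I) * b.map (Tilde.aug I) = P' * Q' := by
    rw [← map_mul_map, hab, Matrix.fromBlocks_map, he2,
      Matrix.map_one _ (map_zero _) (map_one _)]
    simp [P', Q', Matrix.fromBlocks_multiply]
  have hba1 : b.map (Tilde.lift i) * a.map (Tilde.lift i) = 1 := by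
    rw [← map_mul_map, hba, hone]
  have hba2 : b.map (Tilde.aug I) * a.map (Tilde.aug I) = 1 := by
    rw [← map_mul_map, hba, Matrix.map_one _ (map_zero _) (map_one _)]
  have key : ∀ {T : Type u} [Ring T] {κ μ : Type} [Fintype κ] [Fintype μ] [DecidableEq μ]
      {a : Matrix κ μ T} {b : Matrix μ κ T} {x : Matrix κ μ T} {y : Matrix μ κ T},
      a * b = x * y → b * a = 1 → y * x = 1 → (b * x) * (y * a) = 1 ∧ (y * a) * (b * x) = 1 := by
    intro T _ κ μ _ _ _ a b x y h1 h2 h3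
    constructor
    · rw [Matrix.mul_assoc, ← Matrix.mul_assoc x, ← h1, Matrix.mul_assoc a, h2, Matrix.mul_one, h2]
    · rw [Matrix.mul_assoc, ← Matrix.mul_assoc a, h1, Matrix.mul_assoc x, h3, Matrix.mul_one, h3]
  have keyZ : (b.map (Tilde.aug I) * P') * (Q' * a.map (Tilde.aug I)) = 1 ∧
      (Q' * a.map (Tilde.aug I)) * (b.map (Tilde.aug I) * P') = 1 := by
    constructor
    · rw [Matrix.mul_assoc, ← Matrix.mul_assoc P', ← hPQ', Matrix.mul_assoc (a.map _), hba2,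
        Matrix.mul_one, hba2]
    · rw [Matrix.mul_assoc, ← Matrix.mul_assoc (a.map _), hPQ', Matrix.mul_assoc P', hQP',
        Matrix.mul_one, hQP']
  -- Over `S` the idempotent `e ⊕ 1` has the two factorisations `a b` and `X' Y'`, with `b a = 1`
  -- and `Y' X' = 1`. Hence `b X'` is invertible over `S`, with inverse `Y' a`. Modulo `I` it
  -- becomes `z (g ⊕ 1)`, where `z` is the invertible integer matrix obtained in the same way from
  -- the integer parts; multiplication by `z⁻¹` gives the desired lift.
  obtain ⟨ku, ku'⟩ := key hXY' hba1 hYX'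
  let u : (Matrix (ι ⊕ Fin k) (ι ⊕ Fin k) S)ˣ := ⟨_, _, ku, ku'⟩
  let z : (Matrix (ι ⊕ Fin k) (ι ⊕ Fin k) ℤ)ˣ := ⟨_, _, keyZ.1, keyZ.2⟩
  let zS : (Matrix (ι ⊕ Fin k) (ι ⊕ Fin k) S)ˣ :=
    Units.map (RingHom.mapMatrix (Int.castRingHom S)).toMonoidHom z
  let zR : (Matrix (ι ⊕ Fin k) (ι ⊕ Fin k) R)ˣ :=
    Units.map (RingHom.mapMatrix (Int.castRingHom R)).toMonoidHom z
  refine ⟨k, zS⁻¹ * u, ?_⟩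
  -- The composite `Ĩ → S → R` kills `I`, so it only sees integer parts.
  have hb : (b.map (Tilde.lift i)).map π = (b.map (Tilde.aug I)).map (Int.castRingHom R) := by
    ext x y
    simp only [Matrix.map_apply, Tilde.lift_apply, map_add, map_intCast, eq_intCast]
    rw [(h.exact _).2 ⟨_, rfl⟩, add_zero]
  have hX' : X'.map π = P'.map (Int.castRingHom R) *
      (unitSum g (1 : (Matrix (Fin k) (Fin k) R)ˣ)).1 := by
    simp only [X', P', Matrix.fromBlocks_map, hX, unitSum_val, Matrix.fromBlocks_multiply, hone,
      Matrix.map_one (Int.castRingHom R) (map_zero _) (map_one _)]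
    congr 1 <;> simp
  have hu : u.1.map π = zR.1 *
      (unitSum g (1 : (Matrix (Fin k) (Fin k) R)ˣ)).1 := by
    change (b.map (Tilde.lift i) * X').map π = (b.map (Tilde.aug I) * P').map (Int.castRingHom R) * _
    rw [map_mul_map, hb, hX', map_mul_map, Matrix.mul_assoc]
  have hz : zS⁻¹.1.map π = zR⁻¹.1 := by
    refine map_units_inv ?_
    ext x y
    simp [zS, zR]
  rw [Units.val_mul, map_mul_map, hz, hu, ← Matrix.mul_assoc, ← Units.val_mul, inv_mul_cancel,
    Units.val_one, Matrix.one_mul]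

/-- The index vanishes over the ring of which `I` is an ideal. -/
theorem map_lift_index (h : IsShortExact i π) (g : (Matrix ι ι R)ˣ) :
    K0.map (Tilde.lift i) (index h g) = 0 := by
  obtain ⟨e, he⟩ := exists_isIndexMatrix h g
  rw [index_eq h he, map_sub, sub_eq_zero, K0.map_cls, K0.map_cls]
  apply K0.cls_eq
  obtain ⟨P, Q, X, Y, hQP, hYX, hX, hY, he1, he2⟩ := he
  exact ⟨X, Y, he1.symm, by rw [hYX, Matrix.map_one _ (map_zero _) (map_one _)]⟩

/-- The elements of `K₀ I` that vanish in `K₀ S` are indices. -/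
theorem exists_index_eq (h : IsShortExact i π) {x : K0nu I} (hx : K0.map (Tilde.lift i) x = 0) :
    ∃ (n m : ℕ) (g : (Matrix (Fin n ⊕ Fin m) (Fin n ⊕ Fin m) R)ˣ), index h g = x := by
  obtain ⟨n, k, e, he, m, P, Q, hPQ, hQP, hxe⟩ := K0nu.exists_cls_sub_one x
  rw [hxe, map_sub, K0.map_one, K0.map_cls, sub_eq_zero, K0.cls_eq_one_iff] at hx
  obtain ⟨l, X, Y, hXY, hYX⟩ := hx
  have hone : ∀ {T T' : Type u} [Ring T] [Ring T'] (φ : T →+* T') {μ : Type} [Fintype μ]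
      [DecidableEq μ], (1 : Matrix μ μ T).map φ = 1 := fun φ _ _ _ =>
    Matrix.map_one _ (map_zero _) (map_one _)
  have honeZ : ∀ {μ : Type} [Fintype μ] [DecidableEq μ],
      (1 : Matrix μ μ ℤ).map (Int.castRingHom R) = 1 := fun {μ} _ _ =>
    Matrix.map_one _ (map_zero _) (map_one _)
  let e' := Matrix.fromBlocks e 0 0 (1 : Matrix (Fin l) (Fin l) (Tilde I))
  let P' := Matrix.fromBlocks P 0 0 (1 : Matrix (Fin l) (Fin l) ℤ)
  let Q' := Matrix.fromBlocks Q 0 0 (1 : Matrix (Fin l) (Fin l) ℤ)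
  have hQP' : Q' * P' = 1 := by simp [P', Q', Matrix.fromBlocks_multiply, hQP]
  have he1 : e'.map (Tilde.lift i) = X * Y := by
    rw [hXY, Matrix.fromBlocks_map, hone]
    congr 1 <;> ext <;> simp
  have he2 : e'.map (Tilde.aug I) = P' * Q' := by
    simp only [e', P', Q', Matrix.fromBlocks_map, hPQ, Matrix.fromBlocks_multiply,
      Matrix.map_one (Tilde.aug I) (map_zero _) (map_one _)]
    congr 1 <;> ext <;> simp
  have hlift : (e'.map (Tilde.lift i)).map π = (e'.map (Tilde.aug I)).map (Int.castRingHom R) := by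
    ext x y
    simp only [Matrix.map_apply, Tilde.lift_apply, map_add, map_intCast, eq_intCast]
    rw [(h.exact _).2 ⟨_, rfl⟩, add_zero]
  rw [he1, he2, map_mul_map, map_mul_map] at hlift
  have hYX' : Y.map π * X.map π = 1 := by rw [← map_mul_map, hYX, hone]
  have hQPR : Q'.map (Int.castRingHom R) * P'.map (Int.castRingHom R) = 1 := by
    rw [← map_mul_map, hQP', honeZ]
  let x' := X.map π
  let y' := Y.map π
  let p := P'.map (Int.castRingHom R)
  let q := Q'.map (Int.castRingHom R)
  change x' * y' = p * q at hlift
  change y' * x' = 1 at hYX'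
  change q * p = 1 at hQPR
  -- Over `R` the same idempotent is `x' y'` and `p q`. Comparing the two factorisations yields an
  -- invertible matrix `g = q x'` with `x' = p g` and `y' = g⁻¹ q`, so `e'` computes the index of
  -- `g`.
  let g : (Matrix ((Fin m ⊕ Fin k) ⊕ Fin l) ((Fin m ⊕ Fin k) ⊕ Fin l) R)ˣ :=
    ⟨q * x', y' * p, by
      rw [Matrix.mul_assoc, ← Matrix.mul_assoc x', hlift, Matrix.mul_assoc p, hQPR, Matrix.mul_one,
        hQPR], by
      rw [Matrix.mul_assoc, ← Matrix.mul_assoc p, ← hlift, Matrix.mul_assoc x', hYX',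
        Matrix.mul_one, hYX']⟩
  have hg : IsIndexMatrix i π g e' := by
    refine ⟨P', Q', X, Y, hQP', hYX, ?_, ?_, he1, he2⟩
    · change x' = p * (q * x')
      rw [← Matrix.mul_assoc, ← hlift, Matrix.mul_assoc, hYX', Matrix.mul_one]
    · change y' = y' * p * q
      rw [Matrix.mul_assoc, ← hlift, ← Matrix.mul_assoc, hYX', Matrix.one_mul]
  have hidx : index h g = x := by
    apply Subtype.ext
    rw [index_eq h hg, hxe, K0.cls_sum he (mul_one 1)]
    change _ + K0.one (Tilde I) (Fin l) - K0.one (Tilde I) _ = _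
    rw [K0.one_sum (ι := Fin m ⊕ Fin k) (κ := Fin l)]
    abel
  clear_value g
  subst hidx
  -- Renumbering the basis does not change the index: the same matrix `e'` computes it after
  -- renumbering `P`, `Q`, `X`, `Y`.
  let σ : ((Fin m ⊕ Fin k) ⊕ Fin l) ≃ (Fin (m + k) ⊕ Fin l) :=
    Equiv.sumCongr finSumFinEquiv (Equiv.refl _)
  let g' : (Matrix (Fin (m + k) ⊕ Fin l) (Fin (m + k) ⊕ Fin l) R)ˣ :=
    ⟨g.1.submatrix σ.symm σ.symm, g⁻¹.1.submatrix σ.symm σ.symm, by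
      rw [Matrix.submatrix_mul_equiv, ← Units.val_mul, mul_inv_cancel, Units.val_one,
        Matrix.submatrix_one_equiv], by
      rw [Matrix.submatrix_mul_equiv, ← Units.val_mul, inv_mul_cancel, Units.val_one,
        Matrix.submatrix_one_equiv]⟩
  refine ⟨m + k, l, g', ?_⟩
  have hg' : IsIndexMatrix i π g' e' := by
    obtain ⟨P, Q, X, Y, h1, h2, h3, h4, h5, h6⟩ := hg
    refine ⟨P.submatrix id σ.symm, Q.submatrix σ.symm id, X.submatrix id σ.symm,
      Y.submatrix σ.symm id, ?_, ?_, ?_, ?_, ?_, ?_⟩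
    · rw [← Matrix.submatrix_mul _ _ _ _ _ Function.bijective_id, h1, Matrix.submatrix_one_equiv]
    · rw [← Matrix.submatrix_mul _ _ _ _ _ Function.bijective_id, h2, Matrix.submatrix_one_equiv]
    · change _ = (P.map (Int.castRingHom R)).submatrix id σ.symm * g.1.submatrix σ.symm σ.symm
      rw [Matrix.submatrix_mul_equiv, ← h3]
      rfl
    · change _ = g⁻¹.1.submatrix σ.symm σ.symm * (Q.map (Int.castRingHom R)).submatrix σ.symm id
      rw [Matrix.submatrix_mul_equiv, ← h4]
      rfl
    · rw [Matrix.submatrix_mul_equiv, ← h5, Matrix.submatrix_id_id]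
    · rw [Matrix.submatrix_mul_equiv, ← h6, Matrix.submatrix_id_id]
  apply Subtype.ext
  rw [index_eq h hg', index_eq h hg]
  congr 1
  refine K0.cls_eq _ _ ?_
  convert MvN.reindex (1 : Matrix _ _ (Tilde I)) (mul_one 1) σ.symm using 1
  rw [Matrix.submatrix_one_equiv]

/-- For a split extension, `K₀ I → K₀ S` is injective. -/
theorem map_lift_injective_of_split (h : IsShortExact i π) (s : R →+* S)
    (hs : ∀ x, π (s x) = x) {x : K0nu I} (hx : K0.map (Tilde.lift i) x = 0) : x = 0 := by
  obtain ⟨n, m, g, rfl⟩ := exists_index_eq h hx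
  -- The section lifts every invertible matrix, so all indices vanish.
  have := index_mul_of_lifts h 1 g (unitMap s g) (by
    ext a b
    simp [unitMap_val, hs])
  rwa [one_mul, index_one] at this

end IndexExact

/-! ### Half exactness of `K₀` -/

section HalfExact

theorem MvN.conj {R : Type u} [Ring R] {ι : Type} [Fintype ι] [DecidableEq ι] {e : Matrix ι ι R}
    (he : e * e = e) (w : (Matrix ι ι R)ˣ) : MvN (w.1 * e * w⁻¹.1) e := by
  refine ⟨w.1 * e, e * w⁻¹.1, ?_, ?_⟩
  · rw [Matrix.mul_assoc, ← Matrix.mul_assoc e, he, Matrix.mul_assoc]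
  · rw [Matrix.mul_assoc, ← Matrix.mul_assoc w⁻¹.1, ← Units.val_mul, inv_mul_cancel, Units.val_one,
      Matrix.one_mul, he]

theorem idem_conj {R : Type u} [Ring R] {ι : Type} [Fintype ι] [DecidableEq ι] {e : Matrix ι ι R}
    (he : e * e = e) (w : (Matrix ι ι R)ˣ) :
    (w.1 * e * w⁻¹.1) * (w.1 * e * w⁻¹.1) = w.1 * e * w⁻¹.1 := by
  calc (w.1 * e * w⁻¹.1) * (w.1 * e * w⁻¹.1) = w.1 * e * (w⁻¹.1 * w.1) * e * w⁻¹.1 := by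
        simp only [Matrix.mul_assoc]
    _ = w.1 * (e * e) * w⁻¹.1 := by
        rw [← Units.val_mul, inv_mul_cancel, Units.val_one, Matrix.mul_one, Matrix.mul_assoc w.1]
    _ = _ := by rw [he]

theorem MvN.fromBlocks_zero {R : Type u} [Ring R] {ι κ : Type} [Fintype ι] [Fintype κ]
    {e : Matrix ι ι R} (he : e * e = e) :
    MvN (Matrix.fromBlocks e 0 0 (0 : Matrix κ κ R)) e := by
  refine ⟨Matrix.fromRows e 0, Matrix.fromCols e 0, ?_, ?_⟩
  · rw [Matrix.fromRows_mul_fromCols]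
    simp [he]
  · rw [Matrix.fromCols_mul_fromRows]
    simp [he]

theorem MvN.zero_fromBlocks {R : Type u} [Ring R] {ι κ : Type} [Fintype ι] [Fintype κ]
    {e : Matrix ι ι R} (he : e * e = e) :
    MvN (Matrix.fromBlocks (0 : Matrix κ κ R) 0 0 e) e := by
  refine ⟨Matrix.fromRows 0 e, Matrix.fromCols 0 e, ?_, ?_⟩
  · rw [Matrix.fromRows_mul_fromCols]
    simp [he]
  · rw [Matrix.fromCols_mul_fromRows]
    simp [he]

variable {I : Type u} [NonUnitalRing I] {S R : Type u} [Ring S] [Ring R]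
  {i : I →ₙ+* S} {π : S →+* R}

/-- Write `x = [e] - [1]`, where `e` becomes equivalent to `1` over `R`. The equivalence is realised
by conjugation with an invertible matrix over `R` that lifts to `S` after doubling the size.
Conjugating `e` by the lift gives an idempotent congruent to an integer matrix modulo `I`, that is,
an idempotent over `Ĩ`. -/
theorem exists_map_lift_eq (h : IsShortExact i π) {x : K0 S} (hx : K0.map π x = 0) :
    ∃ y : K0nu I, K0.map (Tilde.lift i) y = x := by
  obtain ⟨n, m, e₀, he₀, rfl⟩ := K0.exists_cls_sub_one x
  rw [map_sub, sub_eq_zero, K0.map_one, K0.map_cls, K0.cls_eq_one_iff] at hx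
  obtain ⟨k, hk⟩ := hx
  let e := Matrix.fromBlocks e₀ 0 0 (1 : Matrix (Fin k) (Fin k) S)
  have he : e * e = e := idem_sum he₀ (mul_one 1)
  have hek : (e.map π) = Matrix.fromBlocks (e₀.map π) 0 0 1 := by
    rw [Matrix.fromBlocks_map, Matrix.map_one _ (map_zero _) (map_one _)]
    congr 1 <;> ext <;> simp
  have hxe : K0.cls e₀ he₀ - K0.one S (Fin m) = K0.cls e he - K0.one S (Fin m ⊕ Fin k) := by
    rw [K0.cls_sum he₀ (mul_one 1), K0.one_sum]
    change _ = K0.cls e₀ he₀ + K0.one S (Fin k) - _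
    abel
  rw [hxe]
  rw [← hek] at hk
  have he' := idem_map π he
  obtain ⟨X, Y, hXY, hYX, h1, -, -, h2⟩ := hk.normalize he' (mul_one 1)
  generalize heπ : e.map π = e' at *
  -- This is the usual involution with diagonal blocks `1 - e'` and `1 - f`, for `f = 1`;
  -- conjugation by it takes `e' ⊕ 0` to `0 ⊕ 1`.
  have hw : Matrix.fromBlocks (1 - e') X Y 0 * Matrix.fromBlocks (1 - e') X Y 0 = 1 := by
    rw [Matrix.fromBlocks_multiply]
    refine Eq.trans ?_ Matrix.fromBlocks_one
    congr 1
    · rw [hXY, idem_compl he']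
      abel
    · rw [Matrix.sub_mul, h1]
      simp
    · rw [Matrix.mul_sub, h2]
      simp
    · rw [hYX]
      simp
  let w : (Matrix ((Fin n ⊕ Fin k) ⊕ (Fin m ⊕ Fin k)) ((Fin n ⊕ Fin k) ⊕ (Fin m ⊕ Fin k)) R)ˣ :=
    ⟨_, _, hw, hw⟩
  have hlift : ∀ {μ : Type} (Z : Matrix μ μ R), (Z.map (Function.surjInv h.surj)).map π = Z :=
    fun Z => by ext; exact Function.surjInv_eq h.surj _
  -- The matrix `w` need not lift to an invertible matrix, but `w ⊕ w⁻¹` does. This is why a further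
  -- zero block is added to `e` below.
  let H := hUnit (w.1.map (Function.surjInv h.surj)) (w⁻¹.1.map (Function.surjInv h.surj))
  have hH : H.1.map π = (unitSum w w⁻¹).1 := hUnit_map (hlift _) (hlift _)
  let N := Fin n ⊕ Fin k
  let M := Fin m ⊕ Fin k
  let e₁ : Matrix (N ⊕ M) (N ⊕ M) S := Matrix.fromBlocks e 0 0 0
  have he₁ : e₁ * e₁ = e₁ := idem_sum he (mul_zero 0)
  let E : Matrix ((N ⊕ M) ⊕ (N ⊕ M)) ((N ⊕ M) ⊕ (N ⊕ M)) S := Matrix.fromBlocks e₁ 0 0 0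
  have hE : E * E = E := idem_sum he₁ (mul_zero 0)
  let P₁ : Matrix (N ⊕ M) (N ⊕ M) ℤ := Matrix.fromBlocks 0 0 0 1
  have hP₁ : P₁ * P₁ = P₁ := idem_sum (mul_zero 0) (mul_one 1)
  let P : Matrix ((N ⊕ M) ⊕ (N ⊕ M)) ((N ⊕ M) ⊕ (N ⊕ M)) ℤ := Matrix.fromBlocks P₁ 0 0 0
  have hP : P * P = P := idem_sum hP₁ (mul_zero 0)
  have hEP : (H.1 * E * H⁻¹.1).map π = P.map (Int.castRingHom R) := by
    have h3 : E.map π = Matrix.fromBlocks (Matrix.fromBlocks e' 0 0 0) 0 0 0 := by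
      simp only [E, e₁, Matrix.fromBlocks_map, heπ]
      congr 1 <;> ext x y <;> rcases x with x | x <;> rcases y with y | y <;> simp
    have h4 : P.map (Int.castRingHom R) = Matrix.fromBlocks (Matrix.fromBlocks 0 0 0 1) 0 0 0 := by
      simp only [P, P₁, Matrix.fromBlocks_map,
        Matrix.map_one (Int.castRingHom R) (map_zero _) (map_one _)]
      congr 1 <;> ext x y <;> rcases x with x | x <;> rcases y with y | y <;> simp
    rw [map_mul_map, map_mul_map, hH, map_units_inv hH, h3, h4, unitSum_val, unitSum_inv_val,
      Matrix.fromBlocks_multiply, Matrix.fromBlocks_multiply]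
    congr 1
    · change (Matrix.fromBlocks (1 - e') X Y 0 * Matrix.fromBlocks e' 0 0 0 + _) *
        Matrix.fromBlocks (1 - e') X Y 0 + _ = _
      rw [Matrix.fromBlocks_multiply]
      simp [Matrix.sub_mul, he', h2, Matrix.fromBlocks_multiply, Matrix.mul_sub, hYX]
    all_goals simp
  let y := liftMat i (H.1 * E * H⁻¹.1) P
  have hy1 : y.map (Tilde.lift i) = H.1 * E * H⁻¹.1 := liftMat_lift h hEP
  have hy2 : y.map (Tilde.aug I) = P := liftMat_aug _ _
  have hy : y * y = y := by
    apply tilde_matrix_ext h.inj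
    · rw [map_mul_map, hy1, idem_conj hE]
    · rw [map_mul_map, hy2, hP]
  refine ⟨⟨K0.cls y hy - K0.one (Tilde I) M, ?_⟩, ?_⟩
  · rw [AddMonoidHom.mem_ker, map_sub, sub_eq_zero, K0.map_cls, K0.map_one]
    refine K0.cls_eq _ _ ?_
    rw [hy2]
    exact (MvN.fromBlocks_zero hP₁).trans hP (mul_one 1) (MvN.zero_fromBlocks (mul_one 1))
  · change K0.map (Tilde.lift i) (_ - _) = _
    rw [map_sub, K0.map_cls, K0.map_one]
    congr 1
    refine K0.cls_eq _ _ ?_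
    rw [hy1]
    exact (MvN.conj hE H).trans (idem_conj hE H) he
      ((MvN.fromBlocks_zero he₁).trans hE he (MvN.fromBlocks_zero he))

end HalfExact

namespace K0nu

variable {A B C : Type u} [NonUnitalRing A] [NonUnitalRing B] [NonUnitalRing C]
  {f : A →ₙ+* B} {g : B →ₙ+* C}

theorem map_map_eq_zero (h : IsShortExact f g) (x : K0nu A) : map g (map f x) = 0 := by
  rw [map_map]
  exact map_eq_zero (g.comp f) (fun a => (h.exact _).2 ⟨a, rfl⟩) x

theorem exact (h : IsShortExact f g) {x : K0nu B} (hx : map g x = 0) : ∃ y, map f y = x := by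
  obtain ⟨y, hy⟩ := exists_map_lift_eq (Tilde.isShortExact h) (congrArg Subtype.val hx)
  exact ⟨y, Subtype.ext hy⟩

/-- The difference `x - i₁ p₁ x` dies under `p₁`, so half exactness makes it an `i₂ y`, and applying
`p₂` shows `y = p₂ x`. -/
theorem eq_add_of_split {i₁ : A →ₙ+* B} {p₁ : B →ₙ+* A} {i₂ : C →ₙ+* B} {p₂ : B →ₙ+* C}
    (h : IsShortExact i₂ p₁) (h₁ : ∀ a, p₁ (i₁ a) = a) (h₂ : ∀ c, p₂ (i₂ c) = c)
    (h₃ : ∀ a, p₂ (i₁ a) = 0) (x : K0nu B) : x = map i₁ (map p₁ x) + map i₂ (map p₂ x) := by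
  have e₁ : p₁.comp i₁ = NonUnitalRingHom.id A := NonUnitalRingHom.ext h₁
  have e₂ : p₂.comp i₂ = NonUnitalRingHom.id C := NonUnitalRingHom.ext h₂
  obtain ⟨y, hy⟩ := exact h (x := x - map i₁ (map p₁ x)) (by
    rw [map_sub, map_map i₁, e₁, map_id, sub_self])
  have h3 := congrArg (map p₂) hy
  rw [map_map, e₂, map_id, map_sub, map_map i₁, map_eq_zero (p₂.comp i₁) h₃, sub_zero] at h3
  rw [← h3, hy]
  abel

end K0nu

/-! ### Conjugation by isometries acts trivially -/

section Conj

/-- The extension of `f'` to `B̃` is not conjugation by `V`, since `V W` need not be `1`: with `q =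
1 - V W` it sends `z` to `V z W + q n`, where `n` is the integer part and `z` on the right stands
for its image under the extension of `f`. As `q` is orthogonal to the isometry, an idempotent goes
to one equivalent to the sum of its image under `f` and of `q` times its integer part. The second
summand has trivial class for elements of `K0nu B`. -/
theorem K0.map_lift_eq_of_conj {B : Type u} [NonUnitalRing B] {S : Type u} [Ring S]
    (f f' : B →ₙ+* S) (V W : S) (hWV : W * V = 1) (hf : ∀ b, f' b = V * f b * W) (x : K0nu B) :
    K0.map (Tilde.lift f') x = K0.map (Tilde.lift f) x := by
  have hq : (1 - V * W) * (1 - V * W) = 1 - V * W := by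
    rw [mul_sub, mul_one, sub_mul, one_mul, mul_assoc V, ← mul_assoc W, hWV, one_mul, sub_self,
      sub_zero]
  have hqV : (1 - V * W) * V = 0 := by rw [sub_mul, one_mul, mul_assoc, hWV, mul_one, sub_self]
  have hWq : W * (1 - V * W) = 0 := by rw [mul_sub, mul_one, ← mul_assoc, hWV, one_mul, sub_self]
  set q := 1 - V * W with hqdef
  -- The equivalence between `V e W + q p` and `e ⊕ q p` is given by the row `(V e, q p)` and the
  -- column `(e W, q p)`; the mixed terms vanish because `q V = 0` and `W q = 0`.
  have key : ∀ {ι : Type} [Fintype ι] [DecidableEq ι] (e : Matrix ι ι S) (p : Matrix ι ι ℤ)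
      (he : e * e = e) (hp : p * p = p), ∃ (h1 : _) (h2 : _),
      K0.cls (e.map (fun s => V * s * W) + p.map (fun n => q * (n : S))) h1 =
        K0.cls e he + K0.cls (p.map (fun n => q * (n : S))) h2 := by
    intro ι _ _ e p he hp
    let v : Matrix ι ι S := Matrix.diagonal fun _ => V
    let w : Matrix ι ι S := Matrix.diagonal fun _ => W
    let r : Matrix ι ι S := Matrix.diagonal fun _ => q
    let P : Matrix ι ι S := p.map (Int.castRingHom S)
    have hPP : P * P = P := by rw [← Matrix.map_mul, hp]
    have hwv : w * v = 1 := by simp [w, v, Matrix.diagonal_mul_diagonal, hWV]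
    have hrr : r * r = r := by simp [r, Matrix.diagonal_mul_diagonal, hq]
    have hrv : r * v = 0 := by simp [r, v, Matrix.diagonal_mul_diagonal, hqV]
    have hwr : w * r = 0 := by simp [r, w, Matrix.diagonal_mul_diagonal, hWq]
    have hPr : P * r = r * P := by
      ext a b
      simp only [P, r, Matrix.mul_diagonal, Matrix.diagonal_mul, Matrix.map_apply, eq_intCast]
      exact (Int.cast_commute _ _).eq
    have e1 : e.map (fun s => V * s * W) = v * e * w := by
      ext a b
      simp [v, w, Matrix.mul_diagonal, Matrix.diagonal_mul]
    have e2 : p.map (fun n => q * (n : S)) = r * P := by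
      ext a b
      simp [r, P, Matrix.diagonal_mul]
    have hrP : r * P * (r * P) = r * P := by
      rw [Matrix.mul_assoc, ← Matrix.mul_assoc P, hPr, Matrix.mul_assoc r P P, hPP,
        ← Matrix.mul_assoc, hrr]
    have hX : Matrix.fromCols (v * e) (r * P) * Matrix.fromRows (e * w) (r * P) =
        v * e * w + r * P := by
      rw [Matrix.fromCols_mul_fromRows, hrP, Matrix.mul_assoc v, ← Matrix.mul_assoc e, he,
        Matrix.mul_assoc v]
    have hY : Matrix.fromRows (e * w) (r * P) * Matrix.fromCols (v * e) (r * P) =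
        Matrix.fromBlocks e 0 0 (r * P) := by
      rw [Matrix.fromRows_mul_fromCols, hrP]
      congr 1
      · rw [Matrix.mul_assoc, ← Matrix.mul_assoc w, hwv, Matrix.one_mul, he]
      · rw [Matrix.mul_assoc, ← Matrix.mul_assoc w, hwr, Matrix.zero_mul, Matrix.mul_zero]
      · rw [← hPr, Matrix.mul_assoc, ← Matrix.mul_assoc r, hrv, Matrix.zero_mul, Matrix.mul_zero]
    rw [e1, e2]
    refine ⟨?_, hrP, ?_⟩
    · rw [← hX, Matrix.mul_assoc, ← Matrix.mul_assoc (Matrix.fromRows _ _), hY,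
        Matrix.fromBlocks_mul_fromRows]
      simp only [Matrix.zero_mul, add_zero, zero_add, hrP, ← Matrix.mul_assoc, he]
    · rw [← K0.cls_sum he hrP]
      exact K0.cls_eq _ _ ⟨_, _, hX, hY⟩
  obtain ⟨n, k, e, he, m, P, Q, hPQ, hQP, hx⟩ := K0nu.exists_cls_sub_one x
  have hp : (P * Q) * (P * Q) = P * Q := by
    rw [Matrix.mul_assoc, ← Matrix.mul_assoc Q, hQP, Matrix.one_mul]
  obtain ⟨a1, a2, a3⟩ := key (e.map (Tilde.lift f)) (P * Q) (idem_map _ he) hp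
  obtain ⟨b1, b2, b3⟩ := key (1 : Matrix (Fin m ⊕ Fin k) (Fin m ⊕ Fin k) S) 1 (mul_one 1)
    (mul_one 1)
  -- The integer part `P Q` is equivalent to `1`. Since `q` commutes with integers, `q P` and `q Q`
  -- realise the equivalence after multiplication by `q`.
  have hpq : K0.cls _ a2 = K0.cls _ b2 := by
    refine K0.cls_eq _ _ ⟨P.map fun n => q * (n : S), Q.map fun n => q * (n : S), ?_, ?_⟩
    · ext a b
      simp only [Matrix.mul_apply, Matrix.map_apply, Int.cast_sum, Int.cast_mul, Finset.mul_sum]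
      refine Finset.sum_congr rfl fun c _ => ?_
      rw [mul_assoc, ← mul_assoc (_ : S) q, (Int.cast_commute _ q).eq, mul_assoc q, ← mul_assoc q q,
        hq]
    · rw [← hQP]
      ext a b
      simp only [Matrix.mul_apply, Matrix.map_apply, Int.cast_sum, Int.cast_mul, Finset.mul_sum]
      refine Finset.sum_congr rfl fun c _ => ?_
      rw [mul_assoc, ← mul_assoc (_ : S) q, (Int.cast_commute _ q).eq, mul_assoc q, ← mul_assoc q q,
        hq]
  have hone : (1 : Matrix (Fin m ⊕ Fin k) (Fin m ⊕ Fin k) S).map (fun s => V * s * W) +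
      (1 : Matrix (Fin m ⊕ Fin k) (Fin m ⊕ Fin k) ℤ).map (fun n => q * (n : S)) = 1 := by
    ext a b
    simp only [Matrix.add_apply, Matrix.map_apply, Matrix.one_apply]
    split_ifs <;> simp [q]
  -- Applied to `e = 1` and `p = 1`, `key` reads `[1] = [1] + [q 1]`, because `V W + q = 1`.
  have hb0 : K0.cls _ b2 = 0 := by
    have : K0.cls _ b1 = K0.one S (Fin m ⊕ Fin k) := by
      unfold K0.one
      congr 1
    rw [this] at b3
    exact left_eq_add.1 b3
  rw [hpq, hb0, add_zero] at a3
  rw [hx, map_sub, map_sub, K0.map_one, K0.map_one, K0.map_cls, K0.map_cls, ← a3]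
  congr 2
  rw [← hPQ]
  ext a b
  simp only [Matrix.add_apply, Matrix.map_apply, Tilde.lift_apply, hf, q, mul_add, add_mul, sub_mul,
    one_mul]
  rw [mul_assoc V W, ← (Int.cast_commute (Tilde.aug B (e a b)) W).eq]
  simp only [mul_assoc]
  abel

/-- A homomorphism `b ↦ v b w`, for elements `v`, `w` with `w v = 1` of a unital ring containing `B`
as an ideal. -/
def IsConj {B : Type u} [NonUnitalRing B] (φ : B →ₙ+* B) : Prop :=
  ∃ (S : Type u) (_ : Ring S) (i : B →ₙ+* S) (V W : S), Function.Injective i ∧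
    (∀ s b, ∃ b', i b' = s * i b) ∧ (∀ s b, ∃ b', i b' = i b * s) ∧ W * V = 1 ∧
    ∀ b, i (φ b) = V * i b * W

/-- Conjugation acts trivially after passing to `K₀ S`, but `K₀ B → K₀ S` need not be injective. So
`S` is replaced by its double along `B`, the ring `D` of pairs with difference in `B`. There `B`
sits as the pairs `(b, 0)`, the second projection onto `S` is split by the diagonal, and therefore
`K₀ B → K₀ D` is injective; the diagonal images of `V` and `W` still implement `φ`. -/
theorem IsConj.map_eq {B : Type u} [NonUnitalRing B] {φ : B →ₙ+* B} (hφ : IsConj φ) (x : K0nu B) :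
    K0nu.map φ x = x := by
  obtain ⟨S, _, i, V, W, hinj, hl, hr, hWV, hi⟩ := hφ
  let D : Subring (S × S) :=
    { carrier := {p | ∃ b, i b = p.1 - p.2}
      mul_mem' := by
        rintro ⟨a, b⟩ ⟨c, d⟩ ⟨x, hx⟩ ⟨y, hy⟩
        obtain ⟨z, hz⟩ := hl a y
        obtain ⟨w, hw⟩ := hr d x
        refine ⟨z + w, ?_⟩
        rw [map_add, hz, hw, hx, hy]
        simp only [mul_sub, sub_mul, Prod.fst_mul, Prod.snd_mul]
        abel
      one_mem' := ⟨0, by simp⟩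
      add_mem' := by
        rintro ⟨a, b⟩ ⟨c, d⟩ ⟨x, hx⟩ ⟨y, hy⟩
        refine ⟨x + y, ?_⟩
        rw [map_add, hx, hy]
        simp only [Prod.fst_add, Prod.snd_add]
        abel
      zero_mem' := ⟨0, by simp⟩
      neg_mem' := by
        rintro ⟨a, b⟩ ⟨x, hx⟩
        refine ⟨-x, ?_⟩
        rw [map_neg, hx]
        simp only [Prod.fst_neg, Prod.snd_neg]
        abel }
  let j : B →ₙ+* D :=
    { toFun := fun b => ⟨(i b, 0), b, (sub_zero _).symm⟩
      map_zero' := Subtype.ext (Prod.ext (map_zero i) rfl)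
      map_add' := fun a b => Subtype.ext (Prod.ext (map_add i a b) (add_zero 0).symm)
      map_mul' := fun a b => Subtype.ext (Prod.ext (map_mul i a b) (mul_zero 0).symm) }
  let ρ : D →+* S := (RingHom.snd S S).comp D.subtype
  let s : S →+* D := ((RingHom.id S).prod (RingHom.id S)).codRestrict D fun _ => ⟨0, by simp⟩
  have hj : IsShortExact j ρ :=
    { inj := fun a b hab => hinj (congrArg (fun d : D => d.1.1) hab)
      exact := by
        rintro ⟨⟨a, b⟩, c, hc⟩
        constructor
        · intro h0
          change b = 0 at h0
          subst h0
          exact ⟨c, Subtype.ext (Prod.ext (hc.trans (sub_zero a)) rfl)⟩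
        · rintro ⟨c, hc⟩
          exact (congrArg (fun d : D => d.1.2) hc).symm
      surj := fun b => ⟨s b, rfl⟩ }
  have h1 : K0.map (Tilde.lift j) (K0nu.map φ x) = K0.map (Tilde.lift j) x := by
    rw [← K0.map_lift_eq_of_conj j (j.comp φ) (s V) (s W) (by rw [← map_mul, hWV, map_one]) _ x,
      K0nu.coe_map, K0.map_map]
    · refine congrArg (fun k => K0.map k _) (RingHom.ext fun a => ?_)
      simp [Tilde.lift_apply]
    · intro b
      refine Subtype.ext (Prod.ext (hi b) ?_)
      change (0 : S) = V * 0 * W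
      simp
  rw [← sub_eq_zero]
  refine map_lift_injective_of_split hj s (fun _ => rfl) ?_
  rw [AddSubgroup.coe_sub, map_sub, h1, sub_self]

theorem Cone.mul_upper_entry {A : Type u} [NonUnitalRing A] (b : Cone A) (a : A) (i k : ℕ) :
    (b * Cone.upper 0 a).entry i k = b.entry i k * a := by
  obtain ⟨s, hs⟩ := b.exists_row i
  rw [Cone.mul_entry hs]
  simp only [Cone.upper, add_zero, mul_ite, mul_zero, Finset.sum_ite_eq]
  split_ifs with h
  · rfl
  · rw [hs k h, zero_mul]

/-- The constant diagonal matrices of `V` and `W` do the job in `Σ S`. That `Σ B` is an ideal there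
follows entrywise, each entry of a product being a finite sum of products. -/
theorem IsConj.susp {B : Type u} [NonUnitalRing B] {φ : B →ₙ+* B} (hφ : IsConj φ) :
    IsConj (Susp.map φ) := by
  classical
  obtain ⟨S, _, i, V, W, hinj, hl, hr, hWV, hi⟩ := hφ
  let r : S → B := fun x => if hx : ∃ a, i a = x then hx.choose else 0
  have hr' : ∀ x, (∃ a, i a = x) → i (r x) = x := fun x hx => by
    simp only [r, dif_pos hx]
    exact hx.choose_spec
  have hr0 : r 0 = 0 := hinj (by rw [hr' 0 ⟨0, map_zero i⟩, map_zero])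
  have hlift : ∀ z : Cone S, (∀ x y, ∃ a, i a = z.entry x y) →
      Susp.map i (Susp.proj B (Cone.mapFun r hr0 z)) = Susp.proj S z := fun z hz => by
    rw [Susp.map_proj]
    congr 1
    ext x y
    exact hr' _ (hz x y)
  have hmem : ∀ z, (∃ a, i a = z) ↔ z ∈ (i : B →+ S).range := fun z => Iff.rfl
  refine ⟨Susp S, inferInstance, Susp.map i, Susp.const S V, Susp.const S W, ?_, fun s b => ?_,
    fun s b => ?_, by rw [← map_mul, hWV, map_one], fun b => ?_⟩
  · rw [injective_iff_map_eq_zero]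
    intro x
    obtain ⟨a, rfl⟩ := Susp.proj_surjective B x
    rw [Susp.map_proj, Susp.proj_eq_zero, Susp.proj_eq_zero]
    rintro ⟨n, hn⟩
    exact ⟨n, fun x y hxy => hinj (by simpa using hn x y hxy)⟩
  · obtain ⟨s, rfl⟩ := Susp.proj_surjective S s
    obtain ⟨b, rfl⟩ := Susp.proj_surjective B b
    refine ⟨_, (hlift (s * Cone.map i b) fun x y => ?_).trans (map_mul (Susp.proj S) _ _)⟩
    obtain ⟨t, ht⟩ := s.exists_row x
    rw [hmem, Cone.mul_entry ht]
    exact sum_mem fun k _ => hl _ _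
  · obtain ⟨s, rfl⟩ := Susp.proj_surjective S s
    obtain ⟨b, rfl⟩ := Susp.proj_surjective B b
    refine ⟨_, (hlift (Cone.map i b * s) fun x y => ?_).trans (map_mul (Susp.proj S) _ _)⟩
    obtain ⟨t, ht⟩ := (Cone.map i b).exists_row x
    rw [hmem, Cone.mul_entry ht]
    exact sum_mem fun k _ => hr _ _
  · obtain ⟨a, rfl⟩ := Susp.proj_surjective B b
    change Susp.proj S _ =
      Susp.proj S (Cone.upper 0 V) * Susp.proj S _ * Susp.proj S (Cone.upper 0 W)
    rw [← map_mul, ← map_mul]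
    congr 1
    ext x y
    rw [Cone.mul_upper_entry, Cone.upper_mul_entry]
    exact hi _

/-- `h = f + g`, where the images of `f` and `g` are orthogonal. -/
structure IsOrthSum {A B : Type u} [NonUnitalRing A] [NonUnitalRing B] (f g h : A →ₙ+* B) :
    Prop where
  add : ∀ a, h a = f a + g a
  left : ∀ a b, f a * g b = 0
  right : ∀ a b, g a * f b = 0

/-- The inclusion of the first factor in a product. -/
def inlHom (A B : Type*) [NonUnitalRing A] [NonUnitalRing B] : A →ₙ+* A × B :=
  (NonUnitalRingHom.id A).prod 0

/-- The inclusion of the second factor in a product. -/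
def inrHom (A B : Type*) [NonUnitalRing A] [NonUnitalRing B] : B →ₙ+* A × B :=
  NonUnitalRingHom.prod 0 (NonUnitalRingHom.id B)

theorem IsShortExact.inr_fst (A B : Type u) [NonUnitalRing A] [NonUnitalRing B] :
    IsShortExact (inrHom A B) (NonUnitalRingHom.fst A B) where
  inj _ _ h := congrArg Prod.snd h
  exact b := ⟨fun h => ⟨b.2, Prod.ext h.symm rfl⟩, by
    rintro ⟨c, rfl⟩
    rfl⟩
  surj a := ⟨(a, 0), rfl⟩

/-- Orthogonality makes `(a, a') ↦ f a + g a'` a ring homomorphism on `A × A`. Then `h` is its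
composite with the diagonal, and `K₀` of the product splits. -/
theorem IsOrthSum.map_eq {A B : Type u} [NonUnitalRing A] [NonUnitalRing B] {f g h : A →ₙ+* B}
    (H : IsOrthSum f g h) (x : K0nu A) : K0nu.map h x = K0nu.map f x + K0nu.map g x := by
  let m : A × A →ₙ+* B :=
    { toFun := fun p => f p.1 + g p.2
      map_zero' := by simp
      map_add' := fun p q => by
        simp only [Prod.fst_add, Prod.snd_add, map_add]
        abel
      map_mul' := fun p q => by
        simp only [Prod.fst_mul, Prod.snd_mul, map_mul, mul_add, add_mul, H.left, H.right]
        abel }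
  let Δ : A →ₙ+* A × A := (NonUnitalRingHom.id A).prod (NonUnitalRingHom.id A)
  have h1 := K0nu.eq_add_of_split (i₁ := inlHom A A) (p₂ := NonUnitalRingHom.snd A A)
    (IsShortExact.inr_fst A A) (fun _ => rfl) (fun _ => rfl) (fun _ => rfl) (K0nu.map Δ x)
  have e0 : h = m.comp Δ := NonUnitalRingHom.ext H.add
  have e1 : f = m.comp ((inlHom A A).comp ((NonUnitalRingHom.fst A A).comp Δ)) :=
    NonUnitalRingHom.ext fun a => by
      change f a = f a + g 0
      simp
  have e2 : g = m.comp ((inrHom A A).comp ((NonUnitalRingHom.snd A A).comp Δ)) :=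
    NonUnitalRingHom.ext fun a => by
      change g a = f 0 + g a
      simp
  rw [e0, ← K0nu.map_map, h1, map_add, K0nu.map_map, K0nu.map_map, K0nu.map_map, K0nu.map_map,
    K0nu.map_map, K0nu.map_map]
  congr 1
  · exact congrArg (fun k => K0nu.map k x) e1.symm
  · exact congrArg (fun k => K0nu.map k x) e2.symm

theorem IsOrthSum.susp {A B : Type u} [NonUnitalRing A] [NonUnitalRing B] {f g h : A →ₙ+* B}
    (H : IsOrthSum f g h) : IsOrthSum (Susp.map f) (Susp.map g) (Susp.map h) where
  add x := by
    obtain ⟨a, rfl⟩ := Susp.proj_surjective A x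
    rw [Susp.map_proj, Susp.map_proj, Susp.map_proj, ← map_add]
    congr 1
    ext i j
    exact H.add _
  left x y := by
    obtain ⟨a, rfl⟩ := Susp.proj_surjective A x
    obtain ⟨b, rfl⟩ := Susp.proj_surjective A y
    rw [Susp.map_proj, Susp.map_proj, ← map_mul, ← map_zero (Susp.proj B)]
    congr 1
    ext i j
    exact finsum_eq_zero_of_forall_eq_zero fun k => H.left _ _
  right x y := by
    obtain ⟨a, rfl⟩ := Susp.proj_surjective A x
    obtain ⟨b, rfl⟩ := Susp.proj_surjective A y
    rw [Susp.map_proj, Susp.map_proj, ← map_mul, ← map_zero (Susp.proj B)]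
    congr 1
    ext i j
    exact finsum_eq_zero_of_forall_eq_zero fun k => H.right _ _

end Conj

/-! ### The cone extension -/

namespace Cone

variable {A B C : Type u} [NonUnitalRing A] [NonUnitalRing B] [NonUnitalRing C]

/-- Preimages are chosen by a single function of the entry that sends `0` to `0`; this keeps the set
of entries finite and the bounds on rows and columns intact. -/
theorem exists_map_eq {i : A →ₙ+* B} (hi : Function.Injective i) (z : Cone B)
    (hz : ∀ x y, ∃ a, i a = z.entry x y) : ∃ a, Cone.map i a = z := by
  classical
  let r : B → A := fun x => if hx : ∃ a, i a = x then hx.choose else 0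
  have hr : ∀ x, (∃ a, i a = x) → i (r x) = x := fun x hx => by
    simp only [r, dif_pos hx]
    exact hx.choose_spec
  have hr0 : r 0 = 0 := hi (by rw [hr 0 ⟨0, map_zero i⟩, map_zero])
  refine ⟨Cone.mapFun r hr0 z, ?_⟩
  ext x y
  exact hr _ (hz x y)

theorem map_injective {i : A →ₙ+* B} (hi : Function.Injective i) :
    Function.Injective (Cone.map i) := fun a b hab => by
  ext x y
  exact hi (congrArg (fun c : Cone B => c.entry x y) hab)

/-- The cone is an exact functor. -/
theorem isShortExact {f : A →ₙ+* B} {g : B →ₙ+* C} (h : IsShortExact f g) :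
    IsShortExact (Cone.map f) (Cone.map g) where
  inj := map_injective h.inj
  exact b := by
    constructor
    · intro hb
      exact exists_map_eq h.inj b fun x y =>
        (h.exact _).1 (congrArg (fun c : Cone C => c.entry x y) hb)
    · rintro ⟨a, rfl⟩
      ext x y
      exact (h.exact _).2 ⟨_, rfl⟩
  surj c := by
    classical
    let s : C → B := fun x => if x = 0 then 0 else (h.surj x).choose
    have hs : ∀ x, g (s x) = x := by
      intro x
      by_cases hx : x = 0
      · simp [s, hx]
      · simp only [s, if_neg hx]
        exact (h.surj x).choose_spec
    refine ⟨Cone.mapFun s (by simp [s]) c, ?_⟩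
    ext i j
    exact hs _

/-- Functoriality of the cone for unital homomorphisms. -/
noncomputable def mapUnital {R S : Type u} [Ring R] [Ring S] (f : R →+* S) :
    Cone R →+* Cone S where
  toFun := map (f : R →ₙ+* S)
  map_zero' := map_zero _
  map_add' := map_add _
  map_mul' := map_mul _
  map_one' := by
    ext i j
    change f (if j = i + 0 then 1 else 0) = if j = i + 0 then 1 else 0
    split_ifs <;> simp

/-- The matrix `a` with rows and columns renumbered by an injective map `σ`. -/
noncomputable def reindex (σ : ℕ → ℕ) (hσ : Function.Injective σ) : Cone A →ₙ+* Cone A := by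
  classical
  exact
  { toFun := fun a =>
      { entry := fun x y => if x ∈ Set.range σ ∧ y ∈ Set.range σ then
          a.entry (Function.invFun σ x) (Function.invFun σ y) else 0
        finite_range := by
          refine (a.finite_range.insert 0).subset ?_
          rintro _ ⟨p, rfl⟩
          dsimp only
          split_ifs
          · exact Or.inr ⟨(_, _), rfl⟩
          · exact Or.inl rfl
        bounded := by
          obtain ⟨N, hr, hc⟩ := a.bounded
          refine ⟨N, fun x => ?_, fun y => ?_⟩
          · obtain ⟨s, hs, hs'⟩ := hr (Function.invFun σ x)
            refine ⟨s.map ⟨σ, hσ⟩, by simpa using hs, fun y hy => ?_⟩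
            split_ifs with h
            · obtain ⟨-, j, rfl⟩ := h
              rw [Function.leftInverse_invFun hσ j]
              exact hs' j fun hj => hy (Finset.mem_map_of_mem ⟨σ, hσ⟩ hj)
            · rfl
          · obtain ⟨s, hs, hs'⟩ := hc (Function.invFun σ y)
            refine ⟨s.map ⟨σ, hσ⟩, by simpa using hs, fun x hx => ?_⟩
            split_ifs with h
            · obtain ⟨⟨j, rfl⟩, -⟩ := h
              rw [Function.leftInverse_invFun hσ j]
              exact hs' j fun hj => hx (Finset.mem_map_of_mem ⟨σ, hσ⟩ hj)
            · rfl }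
    map_zero' := by ext x y; simp
    map_add' := fun a b => by
      ext x y
      simp only [add_entry]
      split_ifs <;> simp
    map_mul' := fun a b => by
      ext x y
      obtain ⟨s, hs⟩ := a.exists_row (Function.invFun σ x)
      rw [mul_entry (s := s.map ⟨σ, hσ⟩)]
      · simp only [Finset.sum_map, Function.Embedding.coeFn_mk, mul_entry hs, Set.mem_range_self,
          and_true, true_and, Function.leftInverse_invFun hσ _]
        by_cases hx : x ∈ Set.range σ <;> by_cases hy : y ∈ Set.range σ <;> simp [hx, hy]
      · intro z hz
        dsimp only
        split_ifs with h
        · obtain ⟨-, j, rfl⟩ := h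
          rw [Function.leftInverse_invFun hσ j]
          exact hs j fun hj => hz (Finset.mem_map_of_mem ⟨σ, hσ⟩ hj)
        · rfl }

theorem reindex_entry_apply {σ : ℕ → ℕ} (hσ : Function.Injective σ) (a : Cone A) (i j : ℕ) :
    (reindex σ hσ a).entry (σ i) (σ j) = a.entry i j := by
  classical
  change (if σ i ∈ Set.range σ ∧ σ j ∈ Set.range σ then
    a.entry (Function.invFun σ (σ i)) (Function.invFun σ (σ j)) else 0) = _
  rw [if_pos ⟨⟨i, rfl⟩, ⟨j, rfl⟩⟩, Function.leftInverse_invFun hσ, Function.leftInverse_invFun hσ]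

theorem reindex_entry_eq_zero {σ : ℕ → ℕ} (hσ : Function.Injective σ) (a : Cone A) {x y : ℕ}
    (h : x ∉ Set.range σ ∨ y ∉ Set.range σ) : (reindex σ hσ a).entry x y = 0 := by
  classical
  exact if_neg (by tauto)

/-- The isometry `∑ e_{σ i, i}`. -/
noncomputable def isom (R : Type u) [Ring R] (σ : ℕ → ℕ) (hσ : Function.Injective σ) : Cone R where
  entry x y := if x = σ y then 1 else 0
  finite_range := by
    classical
    refine (Set.toFinite {(1 : R), 0}).subset ?_
    rintro _ ⟨p, rfl⟩
    dsimp only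
    split_ifs <;> simp
  bounded := ⟨1, fun x => ⟨{Function.invFun σ x}, by simp, fun y hy => if_neg fun h => hy (by
      rw [h, Function.leftInverse_invFun hσ y, Finset.mem_singleton])⟩,
    fun y => ⟨{σ y}, by simp, fun x hx => if_neg (by simpa using hx)⟩⟩

/-- The adjoint `∑ e_{i, σ i}` of the isometry `∑ e_{σ i, i}`. -/
noncomputable def coisom (R : Type u) [Ring R] (σ : ℕ → ℕ) (hσ : Function.Injective σ) :
    Cone R where
  entry x y := if y = σ x then 1 else 0
  finite_range := by
    classical
    refine (Set.toFinite {(1 : R), 0}).subset ?_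
    rintro _ ⟨p, rfl⟩
    dsimp only
    split_ifs <;> simp
  bounded := ⟨1, fun y => ⟨{σ y}, by simp, fun x hx => if_neg (by simpa using hx)⟩,
    fun x => ⟨{Function.invFun σ x}, by simp, fun y hy => if_neg fun h => hy (by
      rw [h, Function.leftInverse_invFun hσ y, Finset.mem_singleton])⟩⟩

theorem coisom_mul_isom (R : Type u) [Ring R] (σ : ℕ → ℕ) (hσ : Function.Injective σ) :
    coisom R σ hσ * isom R σ hσ = 1 := by
  ext x y
  rw [mul_entry (s := {σ x}) (fun j hj => if_neg (by simpa using hj)), one_def]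
  simp only [Finset.sum_singleton, coisom, isom, upper, if_true, one_mul, add_zero]
  exact if_congr ⟨fun h => (hσ h).symm, fun h => h ▸ rfl⟩ rfl rfl

theorem isom_mul_mul_coisom {R : Type u} [Ring R] (σ : ℕ → ℕ) (hσ : Function.Injective σ)
    (a : Cone R) : isom R σ hσ * a * coisom R σ hσ = reindex σ hσ a := by
  classical
  have h1 : ∀ x y, (isom R σ hσ * a).entry x y =
      if x ∈ Set.range σ then a.entry (Function.invFun σ x) y else 0 := by
    intro x y
    rw [mul_entry (s := {Function.invFun σ x}) (fun j hj => if_neg fun h => hj (by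
      rw [h, Function.leftInverse_invFun hσ j, Finset.mem_singleton]))]
    simp only [Finset.sum_singleton, isom]
    by_cases hx : x ∈ Set.range σ
    · obtain ⟨i, rfl⟩ := hx
      simp [Function.leftInverse_invFun hσ i]
    · rw [if_neg hx, if_neg fun h => hx ⟨_, h.symm⟩, zero_mul]
  ext x y
  obtain ⟨s, hs⟩ := (isom R σ hσ * a).exists_row x
  rw [mul_entry hs]
  by_cases hy : y ∈ Set.range σ
  · obtain ⟨j, rfl⟩ := hy
    have h2 : ∀ k ∈ s, (isom R σ hσ * a).entry x k * (coisom R σ hσ).entry k (σ j) =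
        if k = j then (isom R σ hσ * a).entry x j else 0 := by
      intro k _
      simp only [coisom, hσ.eq_iff]
      by_cases hk : k = j
      · subst hk
        simp
      · rw [if_neg (Ne.symm hk), if_neg hk, mul_zero]
    rw [Finset.sum_congr rfl h2, Finset.sum_ite_eq' s j]
    have h3 : (if j ∈ s then (isom R σ hσ * a).entry x j else 0) = (isom R σ hσ * a).entry x j := by
      split_ifs with h
      · rfl
      · exact (hs j h).symm
    rw [h3, h1]
    by_cases hx : x ∈ Set.range σ
    · obtain ⟨i, rfl⟩ := hx
      rw [reindex_entry_apply, if_pos ⟨i, rfl⟩, Function.leftInverse_invFun hσ i]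
    · rw [if_neg hx, reindex_entry_eq_zero hσ a (Or.inl hx)]
  · rw [reindex_entry_eq_zero hσ a (Or.inr hy)]
    refine Finset.sum_eq_zero fun k _ => ?_
    simp only [coisom]
    rw [if_neg fun h => hy ⟨k, h.symm⟩, mul_zero]

theorem map_reindex (f : A →ₙ+* B) (σ : ℕ → ℕ) (hσ : Function.Injective σ) (a : Cone A) :
    Cone.map f (reindex σ hσ a) = reindex σ hσ (Cone.map f a) := by
  classical
  ext x y
  change f (if _ then _ else _) = if _ then _ else _
  split_ifs
  · rfl
  · exact map_zero f

/-- Renumbering is conjugation by the isometry `∑ e_{σ i, i}`, which lives in `Γ Ã`; there `Γ A` is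
an ideal. -/
theorem isConj_reindex (σ : ℕ → ℕ) (hσ : Function.Injective σ) :
    IsConj (reindex (A := A) σ hσ) := by
  have hinj : Function.Injective (Tilde.incl A) := fun a b h => congrArg Tilde.part h
  have hmem : ∀ z, (∃ a, Tilde.incl A a = z) ↔ z ∈ (Tilde.incl A : A →+ Tilde A).range :=
    fun z => Iff.rfl
  have hl : ∀ s a, ∃ a', Tilde.incl A a' = s * Tilde.incl A a := fun s a =>
    ⟨_, Tilde.incl_part (by simp)⟩
  have hr : ∀ s a, ∃ a', Tilde.incl A a' = Tilde.incl A a * s := fun s a =>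
    ⟨_, Tilde.incl_part (by simp)⟩
  refine ⟨Cone (Tilde A), inferInstance, Cone.map (Tilde.incl A), isom _ σ hσ, coisom _ σ hσ,
    map_injective hinj, fun s b => exists_map_eq hinj _ fun x y => ?_,
    fun s b => exists_map_eq hinj _ fun x y => ?_, coisom_mul_isom _ σ hσ, fun b => ?_⟩
  · obtain ⟨t, ht⟩ := s.exists_row x
    rw [hmem, Cone.mul_entry ht]
    exact sum_mem fun k _ => hl _ _
  · obtain ⟨t, ht⟩ := (Cone.map (Tilde.incl A) b).exists_row x
    rw [hmem, Cone.mul_entry ht]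
    exact sum_mem fun k _ => hr _ _
  · rw [isom_mul_mul_coisom, map_reindex]

/-- Infinitely many copies of the matrix `a` along the diagonal. -/
noncomputable def infSum : Cone A →ₙ+* Cone A where
  toFun a :=
    { entry := fun x y =>
        if x.unpair.2 = y.unpair.2 then a.entry x.unpair.1 y.unpair.1 else 0
      finite_range := by
        refine (a.finite_range.insert 0).subset ?_
        rintro _ ⟨p, rfl⟩
        dsimp only
        split_ifs
        · exact Or.inr ⟨(p.1.unpair.1, p.2.unpair.1), rfl⟩
        · exact Or.inl rfl
      bounded := by
        classical
        obtain ⟨N, hr, hc⟩ := a.bounded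
        refine ⟨N, fun x => ?_, fun y => ?_⟩
        · obtain ⟨s, hs, hs'⟩ := hr x.unpair.1
          refine ⟨s.image fun j => Nat.pair j x.unpair.2, Finset.card_image_le.trans hs,
            fun y hy => ?_⟩
          split_ifs with h
          · refine hs' _ fun hj => hy (Finset.mem_image.2 ⟨_, hj, ?_⟩)
            rw [h, Nat.pair_unpair]
          · rfl
        · obtain ⟨s, hs, hs'⟩ := hc y.unpair.1
          refine ⟨s.image fun j => Nat.pair j y.unpair.2, Finset.card_image_le.trans hs,
            fun x hx => ?_⟩
          split_ifs with h
          · refine hs' _ fun hj => hx (Finset.mem_image.2 ⟨_, hj, ?_⟩)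
            rw [← h, Nat.pair_unpair]
          · rfl }
  map_zero' := by ext x y; simp
  map_add' a b := by
    ext x y
    simp only [add_entry]
    split_ifs <;> simp
  map_mul' a b := by
    classical
    ext x y
    obtain ⟨s, hs⟩ := a.exists_row x.unpair.1
    rw [mul_entry (s := s.image fun j => Nat.pair j x.unpair.2)]
    · rw [Finset.sum_image fun i _ j _ hij => (Nat.pair_eq_pair.1 hij).1]
      simp only [Nat.unpair_pair, mul_entry hs, if_true]
      split_ifs <;> simp
    · intro z hz
      dsimp only
      split_ifs with h
      · refine hs _ fun hj => hz (Finset.mem_image.2 ⟨_, hj, ?_⟩)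
        rw [h, Nat.pair_unpair]
      · rfl

theorem infSum_entry (a : Cone A) (x y : ℕ) : (infSum a).entry x y =
    if x.unpair.2 = y.unpair.2 then a.entry x.unpair.1 y.unpair.1 else 0 := rfl

/-- The numbering of the first copy of `ℕ` in `ℕ × ℕ`. -/
def first (i : ℕ) : ℕ := Nat.pair i 0

theorem first_injective : Function.Injective first := fun _ _ h => (Nat.pair_eq_pair.1 h).1

/-- The shift of the copies of `ℕ` in `ℕ × ℕ`. -/
def next (x : ℕ) : ℕ := Nat.pair x.unpair.1 (x.unpair.2 + 1)

theorem next_injective : Function.Injective next := fun x y h => by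
  obtain ⟨h1, h2⟩ := Nat.pair_eq_pair.1 h
  rw [← Nat.pair_unpair x, ← Nat.pair_unpair y, h1, Nat.succ_injective h2]

theorem eq_first_or_next (x : ℕ) : (∃ i, x = first i) ∨ ∃ y, x = next y := by
  rcases h : x.unpair.2 with _ | k
  · exact Or.inl ⟨x.unpair.1, by rw [first, ← h, Nat.pair_unpair]⟩
  · exact Or.inr ⟨Nat.pair x.unpair.1 k, by simp [next, ← h, Nat.pair_unpair]⟩

theorem first_ne_next (i x : ℕ) : first i ≠ next x := fun h => by
  simpa using (Nat.pair_eq_pair.1 h).2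

/-- The swindle `∞ = 1 + ∞`: infinitely many diagonal copies of `a` consist of the copy numbered `0`
and of all copies shifted by one. -/
theorem isOrthSum_infSum : IsOrthSum (reindex first first_injective)
    ((reindex next next_injective).comp infSum) (infSum (A := A)) := by
  have h1 : ∀ x, next x ∉ Set.range first := fun x ⟨i, hi⟩ => first_ne_next _ _ hi
  have h2 : ∀ x, first x ∉ Set.range next := fun x ⟨i, hi⟩ => first_ne_next _ _ hi.symm
  refine ⟨fun a => ?_, fun a b => ?_, fun a b => ?_⟩
  · ext x y
    rw [add_entry, NonUnitalRingHom.comp_apply]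
    rcases eq_first_or_next x with ⟨i, rfl⟩ | ⟨x, rfl⟩ <;>
      rcases eq_first_or_next y with ⟨j, rfl⟩ | ⟨y, rfl⟩
    · rw [reindex_entry_apply, reindex_entry_eq_zero _ _ (Or.inl (h2 i)), infSum_entry, first,
        first]
      simp
    · rw [reindex_entry_eq_zero _ _ (Or.inr (h1 y)), reindex_entry_eq_zero _ _ (Or.inl (h2 i)),
        infSum_entry, first, next]
      simp
    · rw [reindex_entry_eq_zero _ _ (Or.inl (h1 x)), reindex_entry_eq_zero _ _ (Or.inr (h2 j)),
        infSum_entry, first, next]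
      simp
    · rw [reindex_entry_eq_zero _ _ (Or.inl (h1 x)), reindex_entry_apply, infSum_entry,
        infSum_entry, next, next]
      simp
  · ext x y
    refine finsum_eq_zero_of_forall_eq_zero fun z => ?_
    rcases eq_first_or_next z with ⟨i, rfl⟩ | ⟨z, rfl⟩
    · rw [NonUnitalRingHom.comp_apply, reindex_entry_eq_zero next_injective _ (Or.inl (h2 i)),
        mul_zero]
    · rw [reindex_entry_eq_zero first_injective _ (Or.inr (h1 z)), zero_mul]
  · ext x y
    refine finsum_eq_zero_of_forall_eq_zero fun z => ?_
    rcases eq_first_or_next z with ⟨i, rfl⟩ | ⟨z, rfl⟩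
    · rw [NonUnitalRingHom.comp_apply, reindex_entry_eq_zero next_injective _ (Or.inr (h2 i)),
        zero_mul]
    · rw [reindex_entry_eq_zero first_injective _ (Or.inl (h1 z)), mul_zero]

end Cone

/-! ### Finite matrices -/

namespace FinMat

variable {A B C : Type u} [NonUnitalRing A] [NonUnitalRing B] [NonUnitalRing C]

/-- The entries of a finite matrix. -/
def entry (a : finiteMatrices A) (i j : ℕ) : A := a.1.entry i j

@[ext] theorem ext {a b : finiteMatrices A} (h : ∀ i j, entry a i j = entry b i j) : a = b := by
  apply Subtype.ext
  ext i j
  exact h i j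

@[simp] theorem zero_entry (i j : ℕ) : entry (0 : finiteMatrices A) i j = 0 := rfl

@[simp] theorem add_entry (a b : finiteMatrices A) (i j : ℕ) :
    entry (a + b) i j = entry a i j + entry b i j := rfl

theorem exists_bound (a : finiteMatrices A) : ∃ n : ℕ, ∀ i j, n ≤ i ∨ n ≤ j → entry a i j = 0 :=
  (mem_finiteMatrices _).1 a.2

theorem mul_entry {a : finiteMatrices A} {i : ℕ} {s : Finset ℕ}
    (hs : ∀ j, j ∉ s → entry a i j = 0) (b : finiteMatrices A) (k : ℕ) :
    entry (a * b) i k = ∑ j ∈ s, entry a i j * entry b j k :=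
  Cone.mul_entry hs b.1 k

/-- The finite matrix with given entries. -/
def ofFun (f : ℕ → ℕ → A) (hf : ∃ n : ℕ, ∀ i j, n ≤ i ∨ n ≤ j → f i j = 0) : finiteMatrices A :=
  ⟨{ entry := f
     finite_range := by
      obtain ⟨n, hn⟩ := hf
      refine (((Set.finite_Iio n).image2 f (Set.finite_Iio n)).insert 0).subset ?_
      rintro _ ⟨⟨i, j⟩, rfl⟩
      by_cases h : n ≤ i ∨ n ≤ j
      · exact Or.inl (hn i j h)
      · push Not at h
        exact Or.inr ⟨i, h.1, j, h.2, rfl⟩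
     bounded := by
      obtain ⟨n, hn⟩ := hf
      exact ⟨n, fun i => ⟨Finset.range n, by simp, fun j hj => hn i j (by simp at hj; omega)⟩,
        fun i => ⟨Finset.range n, by simp, fun j hj => hn j i (by simp at hj; omega)⟩⟩ },
    (mem_finiteMatrices _).2 hf⟩

@[simp] theorem ofFun_entry (f : ℕ → ℕ → A) (hf) (i j : ℕ) : entry (ofFun f hf) i j = f i j := rfl

/-- The inclusion `M_∞ A → Γ A`. -/
def toCone (A : Type u) [NonUnitalRing A] : finiteMatrices A →ₙ+* Cone A where
  toFun := Subtype.val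
  map_zero' := rfl
  map_add' _ _ := rfl
  map_mul' _ _ := rfl

theorem isShortExact_toCone (A : Type u) [NonUnitalRing A] :
    IsShortExact (toCone A) (Susp.proj A) where
  inj := Subtype.val_injective
  exact b := by
    rw [Susp.proj_eq_zero, ← mem_finiteMatrices]
    exact ⟨fun h => ⟨⟨b, h⟩, rfl⟩, by
      rintro ⟨a, rfl⟩
      exact a.2⟩
  surj := Susp.proj_surjective A

/-- Functoriality of `M_∞`. -/
def map (f : A →ₙ+* B) : finiteMatrices A →ₙ+* finiteMatrices B where
  toFun a := ofFun (fun i j => f (entry a i j)) (by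
    obtain ⟨n, hn⟩ := exists_bound a
    exact ⟨n, fun i j h => by rw [hn i j h, map_zero]⟩)
  map_zero' := by ext; simp
  map_add' a b := by ext; simp
  map_mul' a b := by
    ext i k
    obtain ⟨n, hn⟩ := exists_bound a
    have h1 : ∀ j, j ∉ Finset.range n → entry a i j = 0 := fun j hj =>
      hn i j (by simp at hj; omega)
    rw [ofFun_entry, mul_entry h1, mul_entry (s := Finset.range n), map_sum]
    · simp
    · intro j hj
      rw [ofFun_entry, h1 j hj, map_zero]

@[simp] theorem map_entry (f : A →ₙ+* B) (a : finiteMatrices A) (i j : ℕ) :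
    entry (map f a) i j = f (entry a i j) := rfl

@[simp] theorem corner_entry (a : A) (i j : ℕ) :
    entry (corner A a) i j = if i = 0 ∧ j = 0 then a else 0 := rfl

theorem isShortExact {f : A →ₙ+* B} {g : B →ₙ+* C} (h : IsShortExact f g) :
    IsShortExact (map f) (map g) where
  inj a b hab := by
    ext x y
    exact h.inj (congrArg (fun c => entry c x y) hab)
  exact b := by
    constructor
    · intro hb
      have hb' : ∀ x y, ∃ a, f a = entry b x y := fun x y =>
        (h.exact _).1 (congrArg (fun c => entry c x y) hb)
      choose a ha using hb'
      refine ⟨ofFun a ?_, ?_⟩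
      · obtain ⟨n, hn⟩ := exists_bound b
        exact ⟨n, fun i j hij => h.inj (by rw [ha, hn i j hij, map_zero])⟩
      · ext x y
        exact ha x y
    · rintro ⟨a, rfl⟩
      ext x y
      exact (h.exact _).2 ⟨_, rfl⟩
  surj c := by
    classical
    let s : C → B := fun x => if x = 0 then 0 else (h.surj x).choose
    have hs : ∀ x, g (s x) = x := by
      intro x
      by_cases hx : x = 0
      · simp [s, hx]
      · simp only [s, if_neg hx]
        exact (h.surj x).choose_spec
    refine ⟨ofFun (fun i j => s (entry c i j)) ?_, ?_⟩
    · obtain ⟨n, hn⟩ := exists_bound c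
      exact ⟨n, fun i j hij => by rw [hn i j hij]; simp [s]⟩
    · ext i j
      exact hs _

theorem map_corner (f : A →ₙ+* B) (a : A) : map f (corner A a) = corner B (f a) := by
  ext i j
  rw [map_entry, corner_entry, corner_entry, apply_ite f, map_zero]

theorem exists_reindex_bound {σ : ℕ → ℕ} (hσ : Function.Injective σ) (a : finiteMatrices A) :
    ∃ n : ℕ, ∀ i j, n ≤ i ∨ n ≤ j → (Cone.reindex σ hσ a.1).entry i j = 0 := by
  obtain ⟨n, hn⟩ := exists_bound a
  refine ⟨((Finset.range n).image σ).sup id + 1, fun x y hxy => ?_⟩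
  have hlt : ∀ i, i < n → σ i ≤ ((Finset.range n).image σ).sup id := fun i hi =>
    Finset.le_sup (f := id) (Finset.mem_image_of_mem σ (Finset.mem_range.2 hi))
  by_cases hx : x ∈ Set.range σ ∧ y ∈ Set.range σ
  · obtain ⟨⟨i, rfl⟩, ⟨j, rfl⟩⟩ := hx
    rw [Cone.reindex_entry_apply]
    apply hn i j
    by_contra h
    push Not at h
    have h1 := hlt i h.1
    have h2 := hlt j h.2
    omega
  · exact Cone.reindex_entry_eq_zero hσ _ (by tauto)

/-- A finite matrix with rows and columns renumbered by an injective map `σ`. -/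
noncomputable def reindex (σ : ℕ → ℕ) (hσ : Function.Injective σ) :
    finiteMatrices A →ₙ+* finiteMatrices A where
  toFun a := ⟨Cone.reindex σ hσ a.1, (mem_finiteMatrices _).2 (exists_reindex_bound hσ a)⟩
  map_zero' := Subtype.ext (map_zero (Cone.reindex σ hσ))
  map_add' a b := Subtype.ext (map_add (Cone.reindex σ hσ) a.1 b.1)
  map_mul' a b := Subtype.ext (map_mul (Cone.reindex σ hσ) a.1 b.1)

/-- The isometry is not a finite matrix, so the ambient unital ring is `Γ Ã`, in which `M_∞ A` is an
ideal. -/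
theorem isConj_reindex (σ : ℕ → ℕ) (hσ : Function.Injective σ) :
    IsConj (reindex (A := A) σ hσ) := by
  have hinj : Function.Injective (Tilde.incl A) := fun a b h => congrArg Tilde.part h
  have hmem : ∀ z, (∃ a, Tilde.incl A a = z) ↔ z ∈ (Tilde.incl A : A →+ Tilde A).range :=
    fun z => Iff.rfl
  have hl : ∀ s a, ∃ a', Tilde.incl A a' = s * Tilde.incl A a := fun s a =>
    ⟨_, Tilde.incl_part (by simp)⟩
  have hr : ∀ s a, ∃ a', Tilde.incl A a' = Tilde.incl A a * s := fun s a =>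
    ⟨_, Tilde.incl_part (by simp)⟩
  have hfin : ∀ z ∈ finiteMatrices (Tilde A), (∀ x y, ∃ a, Tilde.incl A a = z.entry x y) →
      ∃ b : finiteMatrices A, (Cone.map (Tilde.incl A)).comp (toCone A) b = z := by
    intro z hz hz'
    obtain ⟨b, rfl⟩ := Cone.exists_map_eq hinj z hz'
    obtain ⟨n, hn⟩ := (mem_finiteMatrices _).1 hz
    exact ⟨⟨b, (mem_finiteMatrices _).2 ⟨n, fun i j h => hinj ((hn i j h).trans
      (map_zero _).symm)⟩⟩, rfl⟩
  have hmem' : ∀ b : finiteMatrices A,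
      (Cone.map (Tilde.incl A)).comp (toCone A) b ∈ finiteMatrices (Tilde A) := fun b =>
    (map (Tilde.incl A) b).2
  refine ⟨Cone (Tilde A), inferInstance, (Cone.map (Tilde.incl A)).comp (toCone A),
    Cone.isom _ σ hσ, Cone.coisom _ σ hσ,
    (Cone.map_injective hinj).comp Subtype.val_injective,
    fun s b => hfin _ (TwoSidedIdeal.mul_mem_left _ _ _ (hmem' b)) fun x y => ?_,
    fun s b => hfin _ (TwoSidedIdeal.mul_mem_right _ _ _ (hmem' b)) fun x y => ?_,
    Cone.coisom_mul_isom _ σ hσ, fun b => ?_⟩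
  · obtain ⟨t, ht⟩ := s.exists_row x
    rw [hmem, Cone.mul_entry ht]
    exact sum_mem fun k _ => hl _ _
  · obtain ⟨t, ht⟩ := ((Cone.map (Tilde.incl A)).comp (toCone A) b).exists_row x
    rw [hmem, Cone.mul_entry ht]
    exact sum_mem fun k _ => hr _ _
  · rw [Cone.isom_mul_mul_coisom]
    exact Cone.map_reindex _ _ _ _

/-- Matrices of matrices as matrices. -/
noncomputable def flatten (A : Type u) [NonUnitalRing A] :
    finiteMatrices (finiteMatrices A) →ₙ+* finiteMatrices A where
  toFun a := ofFun (fun x y => entry (entry a x.unpair.1 y.unpair.1) x.unpair.2 y.unpair.2) (by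
    obtain ⟨n, hn⟩ := exists_bound a
    choose m hm using fun i j => exists_bound (entry a i j)
    -- `M` bounds the sizes of all the inner matrices that can be nonzero, and `K` bounds all codes
    -- `Nat.pair i k` with `i < n` and `k < M`.
    let M := (Finset.range n ×ˢ Finset.range n).sup fun p => m p.1 p.2
    have hM : ∀ i j, i < n → j < n → m i j ≤ M := fun i j hi hj =>
      Finset.le_sup (f := fun p : ℕ × ℕ => m p.1 p.2) (b := (i, j)) (by simp [hi, hj])
    let K := (Finset.range n ×ˢ Finset.range M).sup fun p => Nat.pair p.1 p.2
    have hK : ∀ x : ℕ, x.unpair.1 < n → x.unpair.2 < M → x ≤ K := fun x h1 h2 => by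
      conv_lhs => rw [← Nat.pair_unpair x]
      exact Finset.le_sup (f := fun p : ℕ × ℕ => Nat.pair p.1 p.2) (b := x.unpair)
        (by simp [h1, h2])
    refine ⟨K + 1, fun x y hxy => ?_⟩
    by_cases h : n ≤ x.unpair.1 ∨ n ≤ y.unpair.1
    · rw [hn _ _ h, zero_entry]
    · push Not at h
      apply hm
      have := hM _ _ h.1 h.2
      by_contra h'
      push Not at h'
      have h3 := hK x h.1 (by omega)
      have h4 := hK y h.2 (by omega)
      omega)
  map_zero' := by ext; simp
  map_add' a b := by ext; simp
  map_mul' a b := by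
    classical
    ext x y
    obtain ⟨n, hn⟩ := exists_bound a
    choose m hm using fun j => exists_bound (entry a x.unpair.1 j)
    let M := (Finset.range n).sup m
    have hM : ∀ j, j < n → m j ≤ M := fun j hj =>
      Finset.le_sup (f := m) (Finset.mem_range.2 hj)
    have h1 : ∀ j, j ∉ Finset.range n → entry a x.unpair.1 j = 0 := fun j hj =>
      hn _ j (by simp at hj; omega)
    have h2 : ∀ j ∈ Finset.range n, ∀ k, k ∉ Finset.range M →
        entry (entry a x.unpair.1 j) x.unpair.2 k = 0 := fun j hj k hk =>
      hm j _ k (by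
        have := hM j (by simpa using hj)
        simp at hk
        omega)
    rw [mul_entry (s := (Finset.range n ×ˢ Finset.range M).image fun p => Nat.pair p.1 p.2)]
    · rw [Finset.sum_image fun p _ q _ hpq => Prod.ext (Nat.pair_eq_pair.1 hpq).1
        (Nat.pair_eq_pair.1 hpq).2, Finset.sum_product, ofFun_entry, mul_entry h1]
      have hsum : ∀ (s : Finset ℕ) (f : ℕ → finiteMatrices A) (i j : ℕ),
          entry (∑ k ∈ s, f k) i j = ∑ k ∈ s, entry (f k) i j := fun s f i j =>
        map_sum (⟨⟨fun c => entry c i j, rfl⟩, fun _ _ => rfl⟩ : finiteMatrices A →+ A) f s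
      rw [hsum]
      refine Finset.sum_congr rfl fun j hj => ?_
      rw [mul_entry (h2 j hj)]
      simp
    · intro z hz
      rw [ofFun_entry]
      by_cases h : z.unpair.1 ∈ Finset.range n
      · refine h2 _ h _ fun h' => hz (Finset.mem_image.2 ⟨z.unpair, ?_, Nat.pair_unpair z⟩)
        exact Finset.mk_mem_product h h'
      · rw [h1 _ h, zero_entry]

theorem flatten_entry (a : finiteMatrices (finiteMatrices A)) (x y : ℕ) :
    entry (flatten A a) x y = entry (entry a x.unpair.1 y.unpair.1) x.unpair.2 y.unpair.2 := rfl

theorem flatten_bijective (A : Type u) [NonUnitalRing A] : Function.Bijective (flatten A) := by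
  constructor
  · intro a b hab
    ext i j k l
    have := congrArg (fun c => entry c (Nat.pair i k) (Nat.pair j l)) hab
    simpa [flatten_entry] using this
  · intro b
    obtain ⟨n, hn⟩ := exists_bound b
    refine ⟨ofFun (fun i j => ofFun (fun k l => entry b (Nat.pair i k) (Nat.pair j l)) ⟨n, ?_⟩)
      ⟨n, ?_⟩, ?_⟩
    · intro k l h
      apply hn
      have h1 := Nat.right_le_pair i k
      have h2 := Nat.right_le_pair j l
      omega
    · intro i j h
      ext k l
      apply hn
      have h1 := Nat.left_le_pair i k
      have h2 := Nat.left_le_pair j l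
      omega
    · ext x y
      simp [flatten_entry]

/-- The numbering of the second copy of `ℕ` in `ℕ × ℕ`. -/
def second (i : ℕ) : ℕ := Nat.pair 0 i

theorem second_injective : Function.Injective second := fun _ _ h => (Nat.pair_eq_pair.1 h).2

/-- This and `flatten_comp_corner` serve to compare the two corner embeddings of `M_∞ A` in `M_∞
(M_∞ A)`: after flattening both are renumberings, hence both act trivially on `K`-theory. -/
theorem flatten_comp_map_corner :
    (flatten A).comp (map (corner A)) = reindex Cone.first Cone.first_injective := by
  apply NonUnitalRingHom.ext
  intro a
  ext x y
  change entry (corner A (entry a x.unpair.1 y.unpair.1)) x.unpair.2 y.unpair.2 =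
    (Cone.reindex Cone.first Cone.first_injective a.1).entry x y
  have hr : ∀ x : ℕ, x.unpair.2 = 0 → x = Cone.first x.unpair.1 := fun x h => by
    rw [Cone.first, ← h, Nat.pair_unpair]
  rw [corner_entry]
  split_ifs with h
  · conv_rhs => rw [hr x h.1, hr y h.2]
    rw [Cone.reindex_entry_apply]
    rfl
  · rw [Cone.reindex_entry_eq_zero]
    by_contra h'
    push Not at h'
    obtain ⟨⟨i, rfl⟩, ⟨j, rfl⟩⟩ := h'
    exact h (by simp [Cone.first])

theorem flatten_comp_corner :
    (flatten A).comp (corner (finiteMatrices A)) = reindex second second_injective := by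
  apply NonUnitalRingHom.ext
  intro a
  ext x y
  change entry (entry (corner (finiteMatrices A) a) x.unpair.1 y.unpair.1) x.unpair.2 y.unpair.2 =
    (Cone.reindex second second_injective a.1).entry x y
  have hr : ∀ x : ℕ, x.unpair.1 = 0 → x = second x.unpair.2 := fun x h => by
    rw [second, ← h, Nat.pair_unpair]
  rw [corner_entry]
  split_ifs with h
  · conv_rhs => rw [hr x h.1, hr y h.2]
    rw [Cone.reindex_entry_apply]
    rfl
  · rw [Cone.reindex_entry_eq_zero, zero_entry]
    by_contra h'
    push Not at h'
    obtain ⟨⟨i, rfl⟩, ⟨j, rfl⟩⟩ := h'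
    exact h (by simp [second])

end FinMat

/-! ### Flabby rings -/

/-- A ring for which there is an Eilenberg swindle. -/
def IsFlabby (A : Type u) [NonUnitalRing A] : Prop :=
  ∃ φ a b : A →ₙ+* A, IsConj a ∧ IsConj b ∧ IsOrthSum a (b.comp φ) φ

theorem IsFlabby.susp {A : Type u} [NonUnitalRing A] (h : IsFlabby A) : IsFlabby (Susp A) := by
  obtain ⟨φ, a, b, ha, hb, H⟩ := h
  refine ⟨Susp.map φ, Susp.map a, Susp.map b, ha.susp, hb.susp, ?_⟩
  have : (Susp.map b).comp (Susp.map φ) = Susp.map (b.comp φ) :=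
    NonUnitalRingHom.ext fun x => Susp.map_map φ b x
  rw [this]
  exact H.susp

/-- The orthogonal sum gives `φ x = a x + b (φ x)`, and the conjugations `a` and `b` act as the
identity, so `φ x = x + φ x`. -/
theorem IsFlabby.eq_zero {A : Type u} [NonUnitalRing A] (h : IsFlabby A) (x : K0nu A) : x = 0 := by
  obtain ⟨φ, a, b, ha, hb, H⟩ := h
  have := H.map_eq x
  rw [ha.map_eq, ← K0nu.map_map, hb.map_eq] at this
  exact right_eq_add.1 this

theorem Cone.isFlabby (A : Type u) [NonUnitalRing A] : IsFlabby (Cone A) :=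
  ⟨infSum, _, _, isConj_reindex _ _, isConj_reindex _ _, isOrthSum_infSum⟩

/-! ### Stability of `K₀` -/

theorem K0.cls_congr {R : Type u} [Ring R] {ι : Type} [Fintype ι] {e f : Matrix ι ι R}
    (he : e * e = e) (hf : f * f = f) (h : e = f) : cls e he = cls f hf := by
  subst h
  rfl

namespace FinMat

/-! ### Truncation of matrices over `(M_∞ A)~` to finite blocks -/

section Trunc

variable {A : Type u} [NonUnitalRing A] {ι κ μ : Type}

/-- The upper left `k × k` block of an element of `(M_∞ A)~`. -/
noncomputable def truncElt (k : ℕ) :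
    Tilde (finiteMatrices A) →+ Matrix (Fin k) (Fin k) (Tilde A) where
  toFun x := (Tilde.aug _ x : Matrix (Fin k) (Fin k) (Tilde A)) +
    Matrix.of fun i j : Fin k => Tilde.incl A (entry x.part i j)
  map_zero' := by
    ext1 i j
    simp
  map_add' x y := by
    ext1 i j
    simp only [map_add, Int.cast_add, Matrix.add_apply, Matrix.of_apply, Tilde.part_add, add_entry]
    abel

theorem truncElt_apply (k : ℕ) (x : Tilde (finiteMatrices A)) :
    truncElt k x = (Tilde.aug _ x : Matrix (Fin k) (Fin k) (Tilde A)) +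
      Matrix.of fun i j : Fin k => Tilde.incl A (entry x.part i j) := rfl

theorem zsmul_entry (n : ℤ) (a : finiteMatrices A) (i j : ℕ) :
    entry (n • a) i j = n • entry a i j :=
  map_zsmul (⟨⟨fun c => entry c i j, rfl⟩, fun _ _ => rfl⟩ : finiteMatrices A →+ A) n a

/-- A bound on the left factor suffices, since it confines the summation index of the matrix product
to the block. -/
theorem truncElt_mul {k : ℕ} {x y : Tilde (finiteMatrices A)}
    (hx : ∀ i j, k ≤ i ∨ k ≤ j → entry x.part i j = 0) :
    truncElt k (x * y) = truncElt k x * truncElt k y := by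
  have h : (Matrix.of fun i j : Fin k => Tilde.incl A (entry (x * y).part i j)) =
      (Tilde.aug _ x) • (Matrix.of fun i j : Fin k => Tilde.incl A (entry y.part i j)) +
      (Tilde.aug _ y) • (Matrix.of fun i j : Fin k => Tilde.incl A (entry x.part i j)) +
      (Matrix.of fun i j : Fin k => Tilde.incl A (entry x.part i j)) *
        (Matrix.of fun i j : Fin k => Tilde.incl A (entry y.part i j)) := by
    ext1 i l
    simp only [Tilde.part_mul, Matrix.add_apply, Matrix.smul_apply, Matrix.of_apply, add_entry,
      zsmul_entry, map_add, map_zsmul, Matrix.mul_apply]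
    rw [mul_entry (s := Finset.range k) (fun j hj => hx _ _ (Or.inr (by simpa using hj))),
      Finset.sum_range, map_sum]
    simp only [map_mul]
  rw [truncElt_apply, truncElt_apply, truncElt_apply, h, map_mul, Int.cast_mul, add_mul, mul_add,
    mul_add, ← (Int.cast_commute (Tilde.aug _ y) (Matrix.of fun i j : Fin k =>
      Tilde.incl A (entry x.part i j))).eq]
  simp only [zsmul_eq_mul]
  abel

/-- The upper left blocks of the entries of a matrix over `(M_∞ A)~`. -/
noncomputable def trunc (k : ℕ) (e : Matrix ι κ (Tilde (finiteMatrices A))) :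
    Matrix (ι × Fin k) (κ × Fin k) (Tilde A) :=
  Matrix.of fun x y => truncElt k (e x.1 y.1) x.2 y.2

/-- The entries of `e` vanish, up to scalars, outside of the upper left `k × k` block. -/
def Bounded (k : ℕ) (e : Matrix ι κ (Tilde (finiteMatrices A))) : Prop :=
  ∀ a b i j, k ≤ i ∨ k ≤ j → entry (e a b).part i j = 0

theorem Bounded.mono {k l : ℕ} (hkl : k ≤ l) {e : Matrix ι κ (Tilde (finiteMatrices A))}
    (h : Bounded k e) : Bounded l e := fun a b i j hij => h a b i j (by omega)

theorem exists_bounded [Fintype ι] [Fintype κ] (e : Matrix ι κ (Tilde (finiteMatrices A))) :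
    ∃ k, Bounded k e := by
  choose n hn using fun p : ι × κ => exists_bound (e p.1 p.2).part
  refine ⟨Finset.univ.sup n, fun a b i j h => hn (a, b) i j ?_⟩
  have := Finset.le_sup (f := n) (Finset.mem_univ (a, b))
  omega

theorem trunc_mul [Fintype κ] {k : ℕ} {e : Matrix ι κ (Tilde (finiteMatrices A))}
    (he : Bounded k e) (f : Matrix κ μ (Tilde (finiteMatrices A))) :
    trunc k (e * f) = trunc k e * trunc k f := by
  ext1 x y
  simp only [trunc, Matrix.of_apply, Matrix.mul_apply, map_sum, Matrix.sum_apply,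
    truncElt_mul (he _ _), Fintype.sum_prod_type]

theorem trunc_idem [Fintype ι] {k : ℕ} {e : Matrix ι ι (Tilde (finiteMatrices A))}
    (hk : Bounded k e) (he : e * e = e) : trunc k e * trunc k e = trunc k e := by
  rw [← trunc_mul hk, he]

/-- The homomorphism `(M_∞ A)~ → ℤ → Ã`. -/
noncomputable def scalar (A : Type u) [NonUnitalRing A] : Tilde (finiteMatrices A) →+* Tilde A :=
  (Int.castRingHom (Tilde A)).comp (Tilde.aug _)

/-- Beyond the block that carries the matrix part, `e` is scalar, so each enlargement by one adds a
copy of the integer part of `e`. This is the reason for subtracting `k` such copies in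
`trunc_sub_eq`. -/
theorem trunc_succ [Fintype ι] {k : ℕ} {e : Matrix ι ι (Tilde (finiteMatrices A))}
    (hk : Bounded k e) (he : e * e = e) :
    K0.cls (trunc (k + 1) e) (trunc_idem (hk.mono (Nat.le_succ k)) he) =
      K0.cls (trunc k e) (trunc_idem hk he) + K0.cls (e.map (scalar A)) (idem_map _ he) := by
  rw [← K0.cls_sum]
  let σ : (ι × Fin k) ⊕ ι ≃ ι × Fin (k + 1) :=
    { toFun := Sum.elim (fun p => (p.1, p.2.castSucc)) (fun a => (a, Fin.last k))
      invFun := fun p => Fin.lastCases (Sum.inr p.1) (fun j => Sum.inl (p.1, j)) p.2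
      left_inv := by rintro (⟨a, i⟩ | a) <;> simp
      right_inv := by
        rintro ⟨a, i⟩
        refine Fin.lastCases ?_ (fun i => ?_) i <;> simp }
  refine K0.cls_eq _ _ ?_
  convert MvN.reindex _ (trunc_idem (hk.mono (Nat.le_succ k)) he) σ.symm using 1
  ext1 x y
  rcases x with ⟨a, i⟩ | a <;> rcases y with ⟨b, j⟩ | b
  · simp [σ, trunc, truncElt_apply, Matrix.intCast_apply]
  · simp [σ, trunc, truncElt_apply, Matrix.intCast_apply, hk a b _ k (Or.inr le_rfl)]
  · simp [σ, trunc, truncElt_apply, Matrix.intCast_apply, hk a b k _ (Or.inl le_rfl)]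
    intro h
    exact absurd h.symm (Fin.castSucc_lt_last j).ne
  · simp [σ, trunc, truncElt_apply, Matrix.intCast_apply, hk a b k _ (Or.inl le_rfl), scalar]

theorem trunc_sub_eq [Fintype ι] {k l : ℕ} {e : Matrix ι ι (Tilde (finiteMatrices A))}
    (hk : Bounded k e) (hl : Bounded l e) (he : e * e = e) :
    K0.cls (trunc k e) (trunc_idem hk he) - k • K0.cls (e.map (scalar A)) (idem_map _ he) =
      K0.cls (trunc l e) (trunc_idem hl he) - l • K0.cls (e.map (scalar A)) (idem_map _ he) := by
  have key : ∀ {k l : ℕ} (hk : Bounded k e) (hl : Bounded l e), k ≤ l →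
      K0.cls (trunc k e) (trunc_idem hk he) - k • K0.cls (e.map (scalar A)) (idem_map _ he) =
      K0.cls (trunc l e) (trunc_idem hl he) - l • K0.cls (e.map (scalar A)) (idem_map _ he) := by
    intro k l hk hl hkl
    induction l, hkl using Nat.le_induction with
    | base => rfl
    | succ l hkl ih =>
      rw [ih (hk.mono hkl), trunc_succ (hk.mono hkl) he, succ_nsmul]
      abel
  rcases le_total k l with h | h
  · exact key hk hl h
  · exact (key hl hk h).symm

/-- The homomorphism `K₀ (M_∞ A)~ → K₀ Ã` given by truncation. -/
noncomputable def truncK0Tilde (A : Type u) [NonUnitalRing A] :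
    K0 (Tilde (finiteMatrices A)) →+ K0 (Tilde A) :=
  K0.lift (fun _ _ _ e he => K0.cls (trunc (exists_bounded e).choose e)
      (trunc_idem (exists_bounded e).choose_spec he) -
      (exists_bounded e).choose • K0.cls (e.map (scalar A)) (idem_map _ he))
    (fun ι κ _ _ _ _ e f he hf hef => by
      obtain ⟨x, y, hxy, hyx⟩ := id hef
      obtain ⟨k1, h1⟩ := exists_bounded e
      obtain ⟨k2, h2⟩ := exists_bounded f
      obtain ⟨k3, h3⟩ := exists_bounded x
      obtain ⟨k4, h4⟩ := exists_bounded y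
      -- A common bound for `e`, `f`, `x` and `y`, so that the equivalence itself can be truncated.
      let k := k1 + k2 + k3 + k4
      rw [trunc_sub_eq (exists_bounded e).choose_spec (h1.mono (show k1 ≤ k by omega)) he,
        trunc_sub_eq (exists_bounded f).choose_spec (h2.mono (show k2 ≤ k by omega)) hf,
        K0.cls_eq _ _ (hef.map (scalar A)),
        K0.cls_eq _ (trunc_idem (h2.mono (show k2 ≤ k by omega)) hf)]
      refine ⟨trunc k x, trunc k y, ?_, ?_⟩
      · rw [← trunc_mul (h3.mono (show k3 ≤ k by omega)), hxy]
      · rw [← trunc_mul (h4.mono (show k4 ≤ k by omega)), hyx])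
    (fun ι κ _ _ _ _ e f he hf => by
      obtain ⟨k1, h1⟩ := exists_bounded e
      obtain ⟨k2, h2⟩ := exists_bounded f
      obtain ⟨k3, h3⟩ := exists_bounded (Matrix.fromBlocks e 0 0 f)
      let k := k1 + k2 + k3
      have h1' := h1.mono (show k1 ≤ k by omega)
      have h2' := h2.mono (show k2 ≤ k by omega)
      have h3' := h3.mono (show k3 ≤ k by omega)
      have e1 : K0.cls _ (trunc_idem h3' (idem_sum he hf)) =
          K0.cls _ (trunc_idem h1' he) + K0.cls _ (trunc_idem h2' hf) := by
        rw [← K0.cls_sum]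
        refine K0.cls_eq _ _ ?_
        convert MvN.reindex _ (trunc_idem h3' (idem_sum he hf)) (Equiv.sumProdDistrib _ _ _) using 1
        ext1 x y
        rcases x with ⟨a, i⟩ | ⟨a, i⟩ <;> rcases y with ⟨b, j⟩ | ⟨b, j⟩ <;>
          simp [trunc, Equiv.sumProdDistrib]
      have e2 : K0.cls _ (idem_map (scalar A) (idem_sum he hf)) =
          K0.cls _ (idem_map (scalar A) he) + K0.cls _ (idem_map (scalar A) hf) := by
        rw [← K0.map_cls _ _ (idem_sum he hf), K0.cls_sum he hf, map_add, K0.map_cls, K0.map_cls]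
      rw [trunc_sub_eq (exists_bounded e).choose_spec h1' he,
        trunc_sub_eq (exists_bounded f).choose_spec h2' hf,
        trunc_sub_eq (exists_bounded (Matrix.fromBlocks e 0 0 f)).choose_spec h3'
          (idem_sum he hf), e1, e2,
        smul_add]
      abel)

theorem truncK0Tilde_cls [Fintype ι] [DecidableEq ι] {k : ℕ}
    {e : Matrix ι ι (Tilde (finiteMatrices A))} (hk : Bounded k e) (he : e * e = e) :
    truncK0Tilde A (K0.cls e he) = K0.cls (trunc k e) (trunc_idem hk he) -
      k • K0.cls (e.map (scalar A)) (idem_map _ he) := by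
  rw [truncK0Tilde, K0.lift_cls, trunc_sub_eq (exists_bounded e).choose_spec hk he]

theorem truncK0Tilde_naturality {B : Type u} [NonUnitalRing B] (f : A →ₙ+* B)
    (x : K0 (Tilde (finiteMatrices A))) :
    K0.map (Tilde.map f) (truncK0Tilde A x) = truncK0Tilde B (K0.map (Tilde.map (map f)) x) := by
  have : (K0.map (Tilde.map f)).comp (truncK0Tilde A) =
      (truncK0Tilde B).comp (K0.map (Tilde.map (map f))) := by
    refine K0.hom_ext fun n e he => ?_
    obtain ⟨k, hk⟩ := exists_bounded e
    have hk' : Bounded k (e.map (Tilde.map (map f))) := fun a b i j h => by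
      rw [Matrix.map_apply, Tilde.part_map, map_entry, hk a b i j h, map_zero]
    rw [AddMonoidHom.comp_apply, AddMonoidHom.comp_apply, truncK0Tilde_cls hk, K0.map_cls,
      truncK0Tilde_cls hk', map_sub, map_nsmul, K0.map_cls, K0.map_cls]
    refine congr (congrArg _ (K0.cls_congr _ _ ?_)) (congrArg _ (K0.cls_congr _ _ ?_))
    · ext1 x y
      simp only [trunc, Matrix.map_apply, Matrix.of_apply, truncElt_apply, Matrix.add_apply,
        Matrix.intCast_apply, map_add, Tilde.aug_map, Tilde.part_map, map_entry]
      congr 1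
      · split_ifs <;> simp
      · apply Tilde.ext <;> simp
    · ext1 x y
      simp [scalar]
  exact DFunLike.congr_fun this x

/-- A matrix coming from the corner can be truncated at `k = 1`, which gives back the original
matrix. The correction term is the class of its integer part, which vanishes on `K0nu A`. -/
theorem truncK0Tilde_map_corner (x : K0nu A) :
    truncK0Tilde A (K0nu.map (corner A) x : K0nu (finiteMatrices A)) = x := by
  rw [K0nu.coe_map]
  have key : ∀ y : K0 (Tilde A), truncK0Tilde A (K0.map (Tilde.map (corner A)) y) =
      y - K0.map ((Int.castRingHom (Tilde A)).comp (Tilde.aug A)) y := by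
    suffices H : (truncK0Tilde A).comp (K0.map (Tilde.map (corner A))) = AddMonoidHom.id _ -
        K0.map ((Int.castRingHom (Tilde A)).comp (Tilde.aug A)) from DFunLike.congr_fun H
    refine K0.hom_ext fun n e he => ?_
    have hk : Bounded 1 (e.map (Tilde.map (corner A))) := fun a b i j h => by
      rw [Matrix.map_apply, Tilde.part_map, corner_entry, if_neg (by omega)]
    rw [AddMonoidHom.comp_apply, AddMonoidHom.sub_apply, AddMonoidHom.id_apply, K0.map_cls,
      truncK0Tilde_cls hk, K0.map_cls, one_smul]
    congr 1
    · refine K0.cls_eq _ _ ?_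
      let σ : Fin n ≃ Fin n × Fin 1 := (Equiv.prodUnique (Fin n) (Fin 1)).symm
      convert (MvN.reindex e he σ).symm using 1
      ext1 x y
      rw [show x = (x.1, 0) from Prod.ext rfl (Subsingleton.elim _ _),
        show y = (y.1, 0) from Prod.ext rfl (Subsingleton.elim _ _)]
      simp only [trunc, Matrix.map_apply, Matrix.of_apply, truncElt_apply, Matrix.add_apply,
        Matrix.intCast_apply, Tilde.aug_map, Tilde.part_map, corner_entry]
      apply Tilde.ext <;> simp [σ]
    · refine K0.cls_congr _ _ ?_
      ext1 x y
      simp [scalar]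
  rw [key, ← K0.map_map, AddMonoidHom.mem_ker.1 x.2, map_zero, sub_zero]

/-- The homomorphism `K₀ (M_∞ A) → K₀ A` given by truncation. -/
noncomputable def truncK0 (A : Type u) [NonUnitalRing A] : K0nu (finiteMatrices A) →+ K0nu A :=
  ((truncK0Tilde A).comp (K0.map (Tilde.aug _)).ker.subtype).codRestrict _ (by
    intro x
    rw [AddMonoidHom.mem_ker]
    -- The augmentation of `Ã` factors through the unitization of the zero ring, so naturality of
    -- the truncation for `A → 0` shows that the values lie in the kernel.
    have h1 : K0.map (Tilde.map (0 : A →ₙ+* PUnit.{u + 1})) (truncK0Tilde A x) = 0 := by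
      rw [truncK0Tilde_naturality]
      have h2 := congrArg Subtype.val (K0nu.map_eq_zero (map (0 : A →ₙ+* PUnit.{u + 1}))
        (fun a => by ext) x)
      rw [K0nu.coe_map] at h2
      rw [h2, ZeroMemClass.coe_zero, map_zero]
    rw [AddMonoidHom.comp_apply, ← Tilde.aug_comp_map (0 : A →ₙ+* PUnit.{u + 1}), ← K0.map_map]
    exact (congrArg _ h1).trans (map_zero _))

theorem truncK0_naturality {B : Type u} [NonUnitalRing B] (f : A →ₙ+* B)
    (x : K0nu (finiteMatrices A)) :
    K0nu.map f (truncK0 A x) = truncK0 B (K0nu.map (map f) x) :=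
  Subtype.ext (truncK0Tilde_naturality f x)

theorem truncK0_map_corner (x : K0nu A) : truncK0 A (K0nu.map (corner A) x) = x :=
  Subtype.ext (truncK0Tilde_map_corner x)

end Trunc

end FinMat

theorem exists_inverse_of_bijective {A B : Type*} [NonUnitalRing A] [NonUnitalRing B]
    {f : A →ₙ+* B} (hf : Function.Bijective f) :
    ∃ g : B →ₙ+* A, (∀ a, g (f a) = a) ∧ ∀ b, f (g b) = b := by
  let e := RingEquiv.ofBijective f hf
  exact ⟨(e.symm : B →ₙ+* A), fun a => e.symm_apply_apply a, fun b => e.apply_symm_apply b⟩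

theorem K0nu.map_bijective {A B : Type u} [NonUnitalRing A] [NonUnitalRing B]
    {f : A →ₙ+* B} (hf : Function.Bijective f) : Function.Bijective (K0nu.map f) := by
  obtain ⟨g, h1, h2⟩ := exists_inverse_of_bijective hf
  refine Function.bijective_iff_has_inverse.2 ⟨K0nu.map g, fun x => ?_, fun x => ?_⟩
  · rw [K0nu.map_map, show g.comp f = NonUnitalRingHom.id A from NonUnitalRingHom.ext h1,
      K0nu.map_id]
  · rw [K0nu.map_map, show f.comp g = NonUnitalRingHom.id B from NonUnitalRingHom.ext h2,
      K0nu.map_id]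

namespace FinMat

variable {A : Type u} [NonUnitalRing A]

/-- `K₀` is stable under passage to `M_∞`. -/
theorem corner_K0nu_bijective (A : Type u) [NonUnitalRing A] :
    Function.Bijective (K0nu.map (corner A)) := by
  refine Function.bijective_iff_has_inverse.2 ⟨truncK0 A, truncK0_map_corner, fun x => ?_⟩
  -- Truncation is a left inverse. For it to be a right inverse, naturality for the corner map
  -- leaves the task of exchanging the two corner embeddings of `M_∞ A`, and these agree on `K₀`
  -- after flattening.
  have h : K0nu.map (map (corner A)) x = K0nu.map (corner (finiteMatrices A)) x := by
    apply (K0nu.map_bijective (flatten_bijective A)).1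
    rw [K0nu.map_map, K0nu.map_map, flatten_comp_corner, flatten_comp_map_corner,
      (isConj_reindex _ _).map_eq, (isConj_reindex _ _).map_eq]
  rw [truncK0_naturality, h, truncK0_map_corner]

end FinMat

/-! ### The cone extension and the boundary map -/

/-- The projection `Γ R → Σ R` for unital `R`. -/
noncomputable def Susp.projUnital (R : Type u) [Ring R] : Cone R →+* Susp R where
  toFun := Susp.proj R
  map_zero' := map_zero _
  map_add' := map_add _
  map_mul' := map_mul _
  map_one' := rfl

theorem cone_isShortExact (R : Type u) [Ring R] :
    IsShortExact (FinMat.toCone R) (Susp.projUnital R) :=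
  FinMat.isShortExact_toCone R

/-- The homomorphism `K₀ S → K₀ S̃` that views idempotent matrices over `S` as matrices over
`S̃`. -/
noncomputable def K0.toTilde (S : Type u) [Ring S] : K0 S →+ K0 (Tilde S) :=
  K0.lift (fun _ _ _ e he => K0.cls (e.map (Tilde.incl S))
      (by rw [← Matrix.map_mul, he]))
    (fun _ _ _ _ _ _ _ _ _ _ h => by
      obtain ⟨x, y, rfl, rfl⟩ := h
      exact K0.cls_eq _ _ ⟨x.map (Tilde.incl S), y.map (Tilde.incl S), Matrix.map_mul.symm,
        Matrix.map_mul.symm⟩)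
    (fun ι κ _ _ _ _ e f he hf => by
      rw [← K0.cls_sum]
      refine K0.cls_congr _ _ ?_
      rw [Matrix.fromBlocks_map]
      congr 1)

theorem K0.toTilde_cls {S : Type u} [Ring S] {ι : Type} [Fintype ι] [DecidableEq ι]
    (e : Matrix ι ι S) (he : e * e = e) :
    K0.toTilde S (K0.cls e he) =
      K0.cls (e.map (Tilde.incl S)) (by rw [← Matrix.map_mul, he]) :=
  K0.lift_cls _ _ _ e he

theorem K0.map_aug_toTilde {S : Type u} [Ring S] (x : K0 S) :
    K0.map (Tilde.aug S) (K0.toTilde S x) = 0 := by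
  have : (K0.map (Tilde.aug S)).comp (K0.toTilde S) = 0 := K0.hom_ext fun n e he => by
    rw [AddMonoidHom.comp_apply, K0.toTilde_cls, K0.map_cls, AddMonoidHom.zero_apply]
    have h0 : K0.cls (0 : Matrix (Fin n) (Fin n) ℤ) (mul_zero 0) = 0 :=
      (congrArg _ IdemClass.mk_zero).trans (map_zero _)
    rw [← h0]
    refine K0.cls_congr _ _ ?_
    ext
    simp
  exact DFunLike.congr_fun this x

/-- For unital `S`, the homomorphism from `K₀ S` to `K₀` of `S` as a nonunital ring. -/
noncomputable def K0.toNu (S : Type u) [Ring S] : K0 S →+ K0nu S :=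
  (K0.toTilde S).codRestrict _ fun x => AddMonoidHom.mem_ker.2 (K0.map_aug_toTilde x)

theorem K0.coe_toNu_cls {S : Type u} [Ring S] {ι : Type} [Fintype ι] [DecidableEq ι]
    (e : Matrix ι ι S) (he : e * e = e) :
    (K0.toNu S (K0.cls e he) : K0 (Tilde S)) =
      K0.cls (e.map (Tilde.incl S)) (by rw [← Matrix.map_mul, he]) :=
  K0.toTilde_cls e he

theorem K0.map_lift_id_toNu {S : Type u} [Ring S] (x : K0 S) :
    K0.map (Tilde.lift (NonUnitalRingHom.id S)) (K0.toNu S x : K0 (Tilde S)) = x := by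
  have : (K0.map (Tilde.lift (NonUnitalRingHom.id S))).comp
      ((K0.map (Tilde.aug S)).ker.subtype.comp (K0.toNu S)) = AddMonoidHom.id _ :=
    K0.hom_ext fun n e he => by
      rw [AddMonoidHom.comp_apply, AddMonoidHom.comp_apply, AddSubgroup.subtype_apply,
        K0.coe_toNu_cls, K0.map_cls]
      refine K0.cls_congr _ _ ?_
      ext
      simp [Tilde.lift_apply]
  exact DFunLike.congr_fun this x

/-- For surjectivity view `S` as an ideal of itself, with quotient the zero ring. A class of `K0nu
S` that dies in `K₀ S` is then the index of an invertible matrix over the zero ring, which is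
trivial. -/
theorem K0.toNu_bijective (S : Type u) [Ring S] : Function.Bijective (K0.toNu S) := by
  refine ⟨fun x y h => ?_, fun x => ⟨K0.map (Tilde.lift (NonUnitalRingHom.id S)) x, ?_⟩⟩
  · rw [← K0.map_lift_id_toNu x, h, K0.map_lift_id_toNu]
  · have hS : IsShortExact (NonUnitalRingHom.id S)
        (⟨⟨⟨fun _ => 0, rfl⟩, fun _ _ => rfl⟩, rfl, fun _ _ => rfl⟩ : S →+* PUnit.{u + 1}) :=
      { inj := fun _ _ h => h
        exact := fun b => ⟨fun _ => ⟨b, rfl⟩, fun _ => rfl⟩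
        surj := fun _ => ⟨0, rfl⟩ }
    rw [← sub_eq_zero]
    obtain ⟨n, m, g, hg⟩ := exists_index_eq hS
      (x := K0.toNu S (K0.map (Tilde.lift (NonUnitalRingHom.id S)) x) - x) (by
        rw [AddSubgroup.coe_sub, map_sub, K0.map_lift_id_toNu, sub_self])
    have h1 : g = 1 := Units.ext (Matrix.ext fun _ _ => rfl)
    rw [← hg, h1, index_one]

/-- For unital `R`, the isomorphism `K₀ R → K₀ (M_∞ R)`. -/
noncomputable def K0.toFinMat (R : Type u) [Ring R] : K0 R →+ K0nu (finiteMatrices R) :=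
  (K0nu.map (corner R)).comp (K0.toNu R)

theorem K0.toFinMat_bijective (R : Type u) [Ring R] : Function.Bijective (K0.toFinMat R) :=
  (FinMat.corner_K0nu_bijective R).comp (K0.toNu_bijective R)

theorem K0.coe_toFinMat_cls {R : Type u} [Ring R] {ι : Type} [Fintype ι] [DecidableEq ι]
    (e : Matrix ι ι R) (he : e * e = e) :
    (K0.toFinMat R (K0.cls e he) : K0 (Tilde (finiteMatrices R))) =
      K0.cls (e.map fun a => Tilde.incl _ (corner R a))
        (by
          rw [show (fun a => Tilde.incl _ (corner R a)) =
            ((Tilde.incl _).comp (corner R) : R →ₙ+* Tilde (finiteMatrices R)) from rfl,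
            ← Matrix.map_mul, he]) := by
  rw [K0.toFinMat, AddMonoidHom.comp_apply, K0nu.coe_map, K0.coe_toNu_cls, K0.map_cls]
  refine K0.cls_congr _ _ ?_
  ext1 a b
  apply Tilde.ext <;> simp

theorem K0.toFinMat_naturality {R S : Type u} [Ring R] [Ring S] (ρ : R →+* S) (x : K0 R) :
    K0nu.map (FinMat.map (ρ : R →ₙ+* S)) (K0.toFinMat R x) = K0.toFinMat S (K0.map ρ x) := by
  have : (K0nu.map (FinMat.map (ρ : R →ₙ+* S))).comp (K0.toFinMat R) =
      (K0.toFinMat S).comp (K0.map ρ) := K0.hom_ext fun n e he => by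
    apply Subtype.ext
    rw [AddMonoidHom.comp_apply, AddMonoidHom.comp_apply, K0nu.coe_map, K0.coe_toFinMat_cls,
      K0.map_cls, K0.map_cls, K0.coe_toFinMat_cls]
    refine K0.cls_congr _ _ ?_
    ext1 a b
    apply Tilde.ext
    · simp
    · simp only [Matrix.map_apply, Tilde.part_map, Tilde.part_incl]
      exact FinMat.map_corner (ρ : R →ₙ+* S) _
  exact DFunLike.congr_fun this x

/-! ### The index of the delooping in the cone extension -/

section ConeIndex

variable {R : Type u} [Ring R]

/-- The constant diagonal matrices in the cone. -/
noncomputable def Cone.const (R : Type u) [Ring R] : R →+* Cone R where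
  toFun := Cone.upper 0
  map_one' := rfl
  map_zero' := by ext; simp [Cone.upper]
  map_add' a b := by
    ext i j
    simp only [Cone.upper, Cone.add_entry]
    split_ifs <;> simp
  map_mul' a b := by
    ext i j
    rw [Cone.upper_mul_entry]
    simp [Cone.upper]

theorem Cone.const_mul_comm {c : Cone R} (hc : ∀ i j (a : R), a * c.entry i j = c.entry i j * a)
    (a : R) : Cone.const R a * c = c * Cone.const R a := by
  ext i j
  change (Cone.upper 0 a * c).entry i j = (c * Cone.upper 0 a).entry i j
  rw [Cone.upper_mul_entry, Cone.mul_upper_entry]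
  exact hc i j a

/-- The matrix unit `e_{0,0}`. -/
noncomputable def Cone.unitZero (R : Type u) [Ring R] : Cone R := FinMat.toCone R (corner R 1)

theorem Cone.unitZero_entry (i j : ℕ) :
    (Cone.unitZero R).entry i j = if i = 0 ∧ j = 0 then 1 else 0 := rfl

theorem Cone.upper_mul_lower : (Cone.upper 1 1 : Cone R) * Cone.lower 1 1 = 1 := by
  ext i j
  rw [Cone.upper_mul_entry, Cone.one_def]
  simp only [Cone.upper, Cone.lower, one_mul, add_zero]
  exact if_congr (by omega) rfl rfl

theorem Cone.lower_mul_upper :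
    (Cone.lower 1 1 : Cone R) * Cone.upper 1 1 + Cone.unitZero R = 1 := by
  ext i j
  rw [Cone.add_entry, Cone.mul_entry (s := {i - 1}) (fun k hk => if_neg (by simp at hk; omega)),
    Cone.one_def, Cone.unitZero_entry]
  simp only [Cone.upper, Cone.lower, Finset.sum_singleton, add_zero]
  rcases i with _ | i
  · simp
  · simp

theorem Cone.upper_mul_unitZero : (Cone.upper 1 1 : Cone R) * Cone.unitZero R = 0 := by
  ext i j
  rw [Cone.upper_mul_entry, Cone.unitZero_entry]
  simp

theorem Cone.unitZero_mul_lower : Cone.unitZero R * (Cone.lower 1 1 : Cone R) = 0 := by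
  ext i j
  rw [Cone.mul_entry (s := {0}) (fun k hk => if_neg (by simp at hk; omega))]
  simp [Cone.lower]

theorem Cone.unitZero_mul_unitZero : Cone.unitZero R * Cone.unitZero R = Cone.unitZero R := by
  rw [Cone.unitZero, ← map_mul, ← map_mul, mul_one]

theorem Cone.unitZero_mul_const (a : R) :
    Cone.unitZero R * Cone.const R a = FinMat.toCone R (corner R a) := by
  ext i j
  change (Cone.unitZero R * Cone.upper 0 a).entry i j = if i = 0 ∧ j = 0 then a else 0
  rw [Cone.mul_upper_entry, Cone.unitZero_entry]
  split_ifs <;> simp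

/-- The index of the delooping of an idempotent `e`, with respect to the cone extension, is the
class of `e`. -/
theorem index_deloop {ι : Type} [Fintype ι] [DecidableEq ι] (e : Matrix ι ι R) (he : e * e = e) :
    index (cone_isShortExact R) (deloop e he) = K0.toFinMat R (K0.cls e he) := by
  let E : Matrix ι ι (Cone R) := e.map (Cone.const R)
  let U : Matrix ι ι (Cone R) := Matrix.diagonal fun _ => Cone.upper 1 1
  let L : Matrix ι ι (Cone R) := Matrix.diagonal fun _ => Cone.lower 1 1
  let Z : Matrix ι ι (Cone R) := Matrix.diagonal fun _ => Cone.unitZero R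
  have hEE : E * E = E := idem_map _ he
  have hcomm : ∀ c : Cone R, (∀ i j (a : R), a * c.entry i j = c.entry i j * a) →
      E * (Matrix.diagonal fun _ => c) = (Matrix.diagonal fun _ => c) * E := fun c hc => by
    ext1 a b
    rw [Matrix.mul_diagonal, Matrix.diagonal_mul]
    exact Cone.const_mul_comm hc _
  have hEU : E * U = U * E := hcomm _ fun i j a => by
    simp only [Cone.upper]
    split_ifs <;> simp
  have hEL : E * L = L * E := hcomm _ fun i j a => by
    simp only [Cone.lower]
    split_ifs <;> simp
  have hEZ : E * Z = Z * E := hcomm _ fun i j a => by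
    simp only [Cone.unitZero_entry]
    split_ifs <;> simp
  have hUL : U * L = 1 := by
    simp only [U, L, Matrix.diagonal_mul_diagonal, Cone.upper_mul_lower, Matrix.diagonal_one]
  have hLU : L * U + Z = 1 := by
    simp only [U, L, Z, Matrix.diagonal_mul_diagonal, Matrix.diagonal_add, Cone.lower_mul_upper,
      Matrix.diagonal_one]
  have hUZ : U * Z = 0 := by
    simp only [U, Z, Matrix.diagonal_mul_diagonal, Cone.upper_mul_unitZero, Matrix.diagonal_zero]
  have hZL : Z * L = 0 := by
    simp only [L, Z, Matrix.diagonal_mul_diagonal, Cone.unitZero_mul_lower, Matrix.diagonal_zero]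
  have hZZ : Z * Z = Z := by
    simp only [Z, Matrix.diagonal_mul_diagonal, Cone.unitZero_mul_unitZero]
  let T := 1 - E
  have hTE : T * E = 0 := by simp [T, Matrix.sub_mul, hEE]
  have hET : E * T = 0 := by simp [T, Matrix.mul_sub, hEE]
  have hTT : T * T = T := idem_compl hEE
  -- `a` and `b` lift `1 - e + e s` and its inverse to the cone. In the cone `U L = 1` while `L U =
  -- 1 - Z`, so `a b = 1` but `b a = 1 - Z E`; the defect `Z E` is `e` placed at position `(0, 0)`.
  let a := T + U * E
  let b := T + E * L
  have hab : a * b = 1 := by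
    have : a * b = T * T + T * E * L + U * (E * T) + U * (E * E) * L := by
      simp only [a, b]
      noncomm_ring
    rw [this, hTE, hET, hEE, hTT, Matrix.mul_assoc, hEL, ← Matrix.mul_assoc, hUL]
    simp [T]
  have hba : b * a + Z * E = 1 := by
    have : b * a = T * T + T * (U * E) + E * L * T + E * (L * U) * E := by
      simp only [a, b]
      noncomm_ring
    rw [this, ← hEU, ← Matrix.mul_assoc T, hTE, hEL, Matrix.mul_assoc L, hET, hTT,
      eq_sub_of_add_eq hLU, Matrix.mul_sub, Matrix.mul_one, hEZ, Matrix.sub_mul, hEE,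
      Matrix.mul_assoc, hEE]
    simp [T]
  have haZ : a * (Z * E) = 0 := by
    have : a * (Z * E) = T * (Z * E) + U * (E * Z) * E := by
      simp only [a]
      noncomm_ring
    rw [this, ← hEZ, ← Matrix.mul_assoc T, hTE, hEZ, ← Matrix.mul_assoc, hUZ]
    simp
  have hZb : Z * E * b = 0 := by
    have : Z * E * b = Z * (E * T) + Z * (E * E) * L := by
      simp only [b]
      noncomm_ring
    rw [this, hET, hEE, Matrix.mul_assoc, hEL, ← Matrix.mul_assoc, hZL]
    simp
  have hZE : Z * E * (Z * E) = Z * E := by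
    rw [Matrix.mul_assoc, ← Matrix.mul_assoc E, hEZ, Matrix.mul_assoc Z E E, hEE,
      ← Matrix.mul_assoc, hZZ]
  have haπ : a.map (Susp.projUnital R) = (deloop e he).1 := by
    simp only [a]
    rw [← hEU]
    ext1 x y
    rw [deloop_val]
    simp only [T, E, U, diagShift, Matrix.map_apply, Matrix.add_apply, Matrix.sub_apply,
      Matrix.mul_diagonal, map_add, map_sub, map_mul]
    congr 2
    rw [Matrix.one_apply, Matrix.one_apply, apply_ite (Susp.projUnital R), map_one, map_zero]
  have hbπ : b.map (Susp.projUnital R) = (deloop e he)⁻¹.1 := by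
    ext1 x y
    change Susp.projUnital R (b x y) =
      (1 - e.map (Susp.const R) + e.map (Susp.const R) * diagShiftInv R ι) x y
    simp only [b, T, E, L, diagShiftInv, Matrix.map_apply, Matrix.add_apply, Matrix.sub_apply,
      Matrix.mul_diagonal, map_add, map_sub, map_mul]
    congr 2
    rw [Matrix.one_apply, Matrix.one_apply, apply_ite (Susp.projUnital R), map_one, map_zero]
  have hZEe : Z * E = e.map fun a => FinMat.toCone R (corner R a) := by
    ext1 x y
    simp only [Z, E, Matrix.diagonal_mul, Matrix.map_apply, Cone.unitZero_mul_const]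
  have hZEπ : (Z * E).map (Susp.projUnital R) = 0 := by
    rw [hZEe]
    ext1 x y
    exact ((FinMat.isShortExact_toCone R).exact _).2 ⟨_, rfl⟩
  let f : Matrix ι ι (Tilde (finiteMatrices R)) := e.map fun a => Tilde.incl _ (corner R a)
  have hf : f * f = f := by
    simp only [f]
    rw [show (fun a => Tilde.incl _ (corner R a)) =
      ((Tilde.incl _).comp (corner R) : R →ₙ+* Tilde (finiteMatrices R)) from rfl,
      ← Matrix.map_mul, he]
  -- The defect completes `a` and `b` to a column `(a, Z E)` and a row `(b, Z E)` with row times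
  -- column equal to `b a + Z E = 1`. Column times row is `1 ⊕ Z E`, so the index is `[1 ⊕ f] - [1]
  -- = [f]`.
  have hidx : IsIndexMatrix (FinMat.toCone R) (Susp.projUnital R) (deloop e he)
      (Matrix.fromBlocks (1 : Matrix ι ι _) 0 0 f) := by
    refine ⟨colOne ℤ ι, rowOne ℤ ι, Matrix.fromRows a (Z * E), Matrix.fromCols b (Z * E),
      rowOne_mul_colOne ℤ, ?_, ?_, ?_, ?_, ?_⟩
    · rw [Matrix.fromCols_mul_fromRows, hZE, hba]
    · rw [colOne_map, colOne, Matrix.fromRows_mul, Matrix.fromRows_map, haπ, hZEπ]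
      simp
    · rw [rowOne_map, rowOne, Matrix.mul_fromCols, Matrix.fromCols_map, hbπ, hZEπ]
      simp
    · rw [Matrix.fromRows_mul_fromCols, hab, haZ, hZb, hZE, Matrix.fromBlocks_map,
        Matrix.map_one _ (map_zero _) (map_one _), hZEe]
      congr 1 <;> ext1 x y <;> simp [f, Tilde.lift_apply]
    · rw [colOne_mul_rowOne, Matrix.fromBlocks_map, Matrix.map_one _ (map_zero _) (map_one _)]
      congr 1
  apply Subtype.ext
  rw [index_eq _ hidx, K0.cls_sum (mul_one (1 : Matrix ι ι (Tilde (finiteMatrices R)))) hf,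
    K0.coe_toFinMat_cls]
  abel

end ConeIndex

theorem index_inv {I : Type u} [NonUnitalRing I] {S R : Type u} [Ring S] [Ring R]
    {i : I →ₙ+* S} {π : S →+* R} {ι : Type} [Fintype ι] [DecidableEq ι] (h : IsShortExact i π)
    (g : (Matrix ι ι R)ˣ) : index h g⁻¹ = -index h g := by
  rw [eq_neg_iff_add_eq_zero, ← index_mul, inv_mul_cancel, index_one]

/-! ### Exactness of the long exact sequence -/

section Boundary

variable {A B C : Type u} [NonUnitalRing A] [NonUnitalRing B] [NonUnitalRing C]
  {f : A →ₙ+* B} {g : B →ₙ+* C}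

theorem coneIndex_naturality {R S : Type u} [Ring R] [Ring S] (ρ : R →+* S) {ι : Type} [Fintype ι]
    [DecidableEq ι] (w : (Matrix ι ι (Susp R))ˣ) :
    K0nu.map (FinMat.map (ρ : R →ₙ+* S)) (index (cone_isShortExact R) w) =
      index (cone_isShortExact S) (unitMap (Susp.mapUnital ρ) w) :=
  index_naturality (cone_isShortExact R) (cone_isShortExact S) (FinMat.map (ρ : R →ₙ+* S))
    (Cone.mapUnital ρ) (Susp.mapUnital ρ) (fun _ => Cone.ext (funext fun _ => funext fun _ => rfl))
    (fun x => Susp.map_proj (ρ : R →ₙ+* S) x) w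

/-- The delooping of the image of an idempotent over `B̃` lifts to the delooping over `B̃`, so its
index is zero. -/
theorem boundaryTilde_map (h : IsShortExact f g) (z : K0 (Tilde B)) :
    boundaryTilde h (K0.map (Tilde.map g) z) = 0 := by
  have : (boundaryTilde h).comp (K0.map (Tilde.map g)) = 0 := K0.hom_ext fun n e he => by
    rw [AddMonoidHom.comp_apply, K0.map_cls, boundaryTilde_cls,
      ← deloop_map (Tilde.map g) e he, AddMonoidHom.zero_apply,
      ← one_mul (unitMap (Susp.mapUnital (Tilde.map g)) (deloop e he)),
      index_mul_of_lifts (suspTilde_isShortExact h) 1 _ (deloop e he) rfl, index_one]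
  exact DFunLike.congr_fun this z

theorem boundary_map (h : IsShortExact f g) (y : K0nu B) : boundary h (K0nu.map g y) = 0 :=
  boundaryTilde_map h y

/-- For `x = [e] - [e']` the delooping of `e` plus the inverse delooping of `e'` has index zero, so
it lifts stably to an invertible `w` over `Σ B̃`. The index of `w` in the cone extension of `B̃` is
the wanted class: by naturality its image is the cone index over `C̃`, which recovers `x`. -/
theorem exists_map_eq_of_boundaryTilde_eq_zero (h : IsShortExact f g) {x : K0 (Tilde C)}
    (hx : boundaryTilde h x = 0) : ∃ z, K0.map (Tilde.map g) z = x := by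
  obtain ⟨n, m, e, he, e', he', rfl⟩ := K0.exists_cls_sub_cls x
  rw [map_sub, boundaryTilde_cls, boundaryTilde_cls, sub_eq_add_neg, ← index_inv,
    ← index_unitSum] at hx
  obtain ⟨k, w, hw⟩ := exists_lift_of_index_eq_zero _ hx
  obtain ⟨z, hz⟩ := (K0.toFinMat_bijective (Tilde B)).2 (index (cone_isShortExact _) w)
  refine ⟨z, (K0.toFinMat_bijective (Tilde C)).1 ?_⟩
  rw [← K0.toFinMat_naturality, hz, coneIndex_naturality,
    show unitMap (Susp.mapUnital (Tilde.map g)) w = _ from Units.ext hw, index_unitSum,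
    index_unitSum, index_one, index_inv, index_deloop, index_deloop, map_sub]
  abel

/-- Exactness of `K₀ B → K₀ C → K₋₁ A`. -/
theorem boundary_exact (h : IsShortExact f g) {x : K0nu C} (hx : boundary h x = 0) :
    ∃ y, K0nu.map g y = x := by
  obtain ⟨z, hz⟩ := exists_map_eq_of_boundaryTilde_eq_zero h hx
  refine ⟨⟨z, ?_⟩, Subtype.ext hz⟩
  rw [AddMonoidHom.mem_ker, ← Tilde.aug_comp_map g, ← K0.map_map, hz]
  exact AddMonoidHom.mem_ker.1 x.2

/-- The extension `0 → B → B → 0 → 0`. -/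
theorem isShortExact_id_zero (B : Type u) [NonUnitalRing B] :
    IsShortExact (NonUnitalRingHom.id B) (0 : B →ₙ+* PUnit.{u + 1}) where
  inj _ _ h := h
  exact b := ⟨fun _ => ⟨b, rfl⟩, fun _ => rfl⟩
  surj _ := ⟨0, rfl⟩

/-- `Σ B` is an ideal of `Σ B̃` whose quotient, the suspension of the unitization of the zero ring,
splits off. Hence vanishing in `K₀ (Σ B)` can be tested in `K₀ (Σ B̃)`. -/
theorem susp_map_lift_injective (B : Type u) [NonUnitalRing B] {y : K0nu (Susp B)}
    (hy : K0.map (Tilde.lift (Susp.map (Tilde.incl B))) y = 0) : y = 0 :=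
  map_lift_injective_of_split (suspTilde_isShortExact (isShortExact_id_zero B))
    (Susp.mapUnital (Tilde.map (0 : PUnit.{u + 1} →ₙ+* B))) (fun x => by
      obtain ⟨c, rfl⟩ := Susp.proj_surjective _ x
      change Susp.proj _ _ = _
      congr 1
      ext i j
      · change Tilde.aug _ (Tilde.map _ (Tilde.map _ _)) = _
        simp) hy

theorem map_lift_susp_comp (f : A →ₙ+* B) (x : K0nu (Susp A)) :
    K0.map (Tilde.lift (Susp.map (Tilde.incl B))) (K0nu.map (Susp.map f) x : K0nu (Susp B)) =
      K0.map (Tilde.lift (Susp.map ((Tilde.incl B).comp f))) x := by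
  rw [K0nu.coe_map, K0.map_map]
  refine congrArg (fun k => K0.map k _) (RingHom.ext fun a => ?_)
  simp only [RingHom.comp_apply, Tilde.lift_apply, Tilde.aug_map, Tilde.part_map]
  rw [Susp.map_map]

/-- An index dies in `K₀` of the middle ring, here `Σ B̃`, and `K₀ (Σ B)` injects into that group.
-/
theorem map_boundaryTilde (h : IsShortExact f g) (x : K0 (Tilde C)) :
    K0nu.map (Susp.map f) (boundaryTilde h x) = 0 := by
  have : (K0nu.map (Susp.map f)).comp (boundaryTilde h) = 0 := K0.hom_ext fun n e he => by
    rw [AddMonoidHom.comp_apply, boundaryTilde_cls, AddMonoidHom.zero_apply]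
    apply susp_map_lift_injective
    rw [map_lift_susp_comp]
    exact map_lift_index _ _
  exact DFunLike.congr_fun this x

theorem map_boundary (h : IsShortExact f g) (x : K0nu C) :
    K0nu.map (Susp.map f) (boundary h x) = 0 := map_boundaryTilde h x

/-- An invertible matrix over `Σ C̃` with vanishing index in the cone extension has vanishing index
in `K₀ (Σ A)`. -/
theorem index_eq_zero_of_coneIndex (h : IsShortExact f g) {ι : Type} [Fintype ι] [DecidableEq ι]
    {w : (Matrix ι ι (Susp (Tilde C)))ˣ} (hw : index (cone_isShortExact (Tilde C)) w = 0) :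
    index (suspTilde_isShortExact h) w = 0 := by
  obtain ⟨k, v, hv⟩ := exists_lift_of_index_eq_zero _ hw
  -- The stabilised `w` lifts to an invertible matrix `v` over `Γ C̃`. By naturality its index is
  -- the image of the index of `v` in `K₀ (Γ A)`, and this group vanishes.
  have hcone : IsShortExact (Cone.map ((Tilde.incl B).comp f)) (Cone.mapUnital (Tilde.map g)) :=
    Cone.isShortExact (g := (Tilde.map g : Tilde B →ₙ+* Tilde C)) (Tilde.isShortExact h)
  have h1 := index_naturality hcone (suspTilde_isShortExact h) (Susp.proj A)
    (Susp.projUnital (Tilde B)) (Susp.projUnital (Tilde C)) (fun _ => rfl) (fun _ => rfl) v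
  rw [(Cone.isFlabby A).eq_zero (index hcone v), map_zero,
    show unitMap (Susp.projUnital (Tilde C)) v = _ from Units.ext hv, index_unitSum, index_one,
    add_zero] at h1
  exact h1.symm

/-- Exactness of `K₀ C → K₋₁ A → K₋₁ B`. -/
theorem exists_boundary_eq (h : IsShortExact f g) {y : K0nu (Susp A)}
    (hy : K0nu.map (Susp.map f) y = 0) : ∃ x, boundary h x = y := by
  obtain ⟨n, m, w, rfl⟩ := exists_index_eq (suspTilde_isShortExact h) (x := y) (by
    rw [← map_lift_susp_comp, hy, ZeroMemClass.coe_zero, map_zero])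
  obtain ⟨z, hz⟩ := (K0.toFinMat_bijective (Tilde C)).2 (index (cone_isShortExact _) w)
  -- `z` is chosen so that its delooping and `w` have the same index in the cone extension; the
  -- preceding lemma, applied to their quotient, equates their indices in `K₀ (Σ A)`.
  have h1 : boundaryTilde h z = index (suspTilde_isShortExact h) w := by
    obtain ⟨n, m, e, he, e', he', rfl⟩ := K0.exists_cls_sub_cls z
    rw [map_sub, ← index_deloop, ← index_deloop, sub_eq_add_neg, ← index_inv, ← index_unitSum] at hz
    have h2 := index_eq_zero_of_coneIndex h
      (w := unitSum w (unitSum (deloop e he) (deloop e' he')⁻¹)⁻¹) (by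
        rw [index_unitSum, index_inv, hz, add_neg_cancel])
    rw [index_unitSum, index_inv, index_unitSum, index_inv, add_neg_eq_zero] at h2
    rw [map_sub, boundaryTilde_cls, boundaryTilde_cls, h2, sub_eq_add_neg]
  -- `z` lies only in `K₀ C̃`. Subtracting its integer part moves it to `K₀ C` and leaves the
  -- boundary unchanged, since that part already comes from `B̃`.
  let c := (Int.castRingHom (Tilde C)).comp (Tilde.aug C)
  have hc : boundaryTilde h (K0.map c z) = 0 := by
    have : c = (Tilde.map g).comp ((Int.castRingHom (Tilde B)).comp (Tilde.aug C)) := by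
      ext a <;> simp [c]
    rw [this, ← K0.map_map]
    exact boundaryTilde_map h _
  refine ⟨⟨z - K0.map c z, ?_⟩, ?_⟩
  · rw [AddMonoidHom.mem_ker, map_sub, K0.map_map, sub_eq_zero]
    refine congrArg (fun k => K0.map k z) (RingHom.ext fun a => ?_)
    simp [c]
  · change boundaryTilde h (z - K0.map c z) = _
    rw [map_sub, hc, sub_zero, h1]

end Boundary

/-! ### The long exact sequence in nonpositive degrees -/

theorem Susp.map_id (A : Type u) [NonUnitalRing A] (x : Susp A) :
    Susp.map (NonUnitalRingHom.id A) x = x := by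
  obtain ⟨a, rfl⟩ := Susp.proj_surjective A x
  rfl

theorem suspIterMap_id (p : ℕ) (A : Rng.{u}) (x : (suspIter p A).carrier) :
    suspIterMap p (NonUnitalRingHom.id A.carrier) x = x := by
  induction p with
  | zero => rfl
  | succ p ih =>
    refine Eq.trans ?_ (Susp.map_id _ x)
    exact congrArg (fun k => Susp.map k x) (NonUnitalRingHom.ext ih)

theorem negKMap_map (p : ℕ) {A B C : Rng.{u}} (f : A.carrier →ₙ+* B.carrier)
    (g : B.carrier →ₙ+* C.carrier) (x : negK p A) :
    negKMap p g (negKMap p f x) = negKMap p (g.comp f) x := by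
  refine (K0nu.map_map _ _ x).trans ?_
  exact congrArg (fun k => K0nu.map k x) (NonUnitalRingHom.ext fun y => suspIterMap_map p f g y)

theorem negKMap_id (p : ℕ) (A : Rng.{u}) (x : negK p A) :
    negKMap p (NonUnitalRingHom.id A.carrier) x = x := by
  refine Eq.trans ?_ (K0nu.map_id x)
  exact congrArg (fun k => K0nu.map k x) (NonUnitalRingHom.ext fun y => suspIterMap_id p A y)

theorem negKMap_bijective (p : ℕ) {A B : Rng.{u}} {f : A.carrier →ₙ+* B.carrier}
    (hf : Function.Bijective f) : Function.Bijective (negKMap p f) := by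
  obtain ⟨g, h1, h2⟩ := exists_inverse_of_bijective hf
  refine Function.bijective_iff_has_inverse.2 ⟨negKMap p g, fun x => ?_, fun x => ?_⟩
  · rw [negKMap_map, show g.comp f = NonUnitalRingHom.id _ from NonUnitalRingHom.ext h1,
      negKMap_id]
  · rw [negKMap_map, show f.comp g = NonUnitalRingHom.id _ from NonUnitalRingHom.ext h2,
      negKMap_id]

theorem IsConj.negKMap_eq (p : ℕ) {A : Rng.{u}} {φ : A.carrier →ₙ+* A.carrier} (h : IsConj φ)
    (x : negK p A) : negKMap p φ x = x := by
  have : IsConj (suspIterMap p φ) := by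
    clear x
    induction p with
    | zero => exact h
    | succ p ih => exact ih.susp
  exact this.map_eq x

theorem IsFlabby.negK_eq_zero (p : ℕ) {A : Rng.{u}} (h : IsFlabby A.carrier) (x : negK p A) :
    x = 0 := by
  have : IsFlabby (suspIter p A).carrier := by
    clear x
    induction p with
    | zero => exact h
    | succ p ih => exact ih.susp
  exact this.eq_zero x

section Exact

variable (p : ℕ) {A B C : Rng.{u}} {f : A.carrier →ₙ+* B.carrier} {g : B.carrier →ₙ+* C.carrier}

theorem negKMap_map_eq_zero (h : IsShortExact f g) (x : negK p A) :
    negKMap p g (negKMap p f x) = 0 :=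
  K0nu.map_map_eq_zero (suspIter_isShortExact p h) x

theorem negKMap_exact (h : IsShortExact f g) {x : negK p B} (hx : negKMap p g x = 0) :
    ∃ y, negKMap p f y = x :=
  K0nu.exact (suspIter_isShortExact p h) hx

theorem negKBoundary_map (h : IsShortExact f g) (x : negK p B) :
    negKBoundary p h (negKMap p g x) = 0 :=
  boundary_map (suspIter_isShortExact p h) x

theorem negKBoundary_exact (h : IsShortExact f g) {x : negK p C} (hx : negKBoundary p h x = 0) :
    ∃ y, negKMap p g y = x :=
  boundary_exact (suspIter_isShortExact p h) hx

theorem negKMap_boundary (h : IsShortExact f g) (x : negK p C) :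
    negKMap (p + 1) f (negKBoundary p h x) = 0 :=
  map_boundary (suspIter_isShortExact p h) x

theorem exists_negKBoundary_eq (h : IsShortExact f g) {y : negK (p + 1) A}
    (hy : negKMap (p + 1) f y = 0) : ∃ x, negKBoundary p h x = y :=
  exists_boundary_eq (suspIter_isShortExact p h) hy

end Exact

/-! ### Stability in nonpositive degrees -/

theorem Susp.map_bijective {A B : Type u} [NonUnitalRing A] [NonUnitalRing B] {f : A →ₙ+* B}
    (hf : Function.Bijective f) : Function.Bijective (Susp.map f) := by
  obtain ⟨g, h1, h2⟩ := exists_inverse_of_bijective hf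
  refine Function.bijective_iff_has_inverse.2 ⟨Susp.map g, fun x => ?_, fun x => ?_⟩
  · rw [Susp.map_map, show g.comp f = NonUnitalRingHom.id _ from NonUnitalRingHom.ext h1,
      Susp.map_id]
  · rw [Susp.map_map, show f.comp g = NonUnitalRingHom.id _ from NonUnitalRingHom.ext h2,
      Susp.map_id]

/-- The isomorphism `Σ^p (Σ A) ≅ Σ^(p+1) A`. -/
noncomputable def suspIterSusp : (p : ℕ) → (A : Rng.{u}) →
    ((suspIter p ⟨Susp A.carrier⟩).carrier →ₙ+* (suspIter (p + 1) A).carrier)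
  | 0, _ => NonUnitalRingHom.id _
  | p + 1, A => Susp.map (suspIterSusp p A)

theorem suspIterSusp_bijective (p : ℕ) (A : Rng.{u}) : Function.Bijective (suspIterSusp p A) := by
  induction p with
  | zero => exact Function.bijective_id
  | succ p ih => exact Susp.map_bijective ih

theorem suspIterSusp_naturality (p : ℕ) {A B : Rng.{u}} (f : A.carrier →ₙ+* B.carrier)
    (x : (suspIter p ⟨Susp A.carrier⟩).carrier) :
    suspIterSusp p B (suspIterMap p (A := ⟨Susp A.carrier⟩) (B := ⟨Susp B.carrier⟩)
      (Susp.map f) x) = suspIterMap (p + 1) f (suspIterSusp p A x) := by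
  induction p with
  | zero => rfl
  | succ p ih =>
    refine (Susp.map_map _ _ x).trans (Eq.trans ?_ (Susp.map_map _ _ x).symm)
    exact congrArg (fun k => Susp.map k x) (NonUnitalRingHom.ext ih)

/-- The boundary map has the vanishing groups of the flabby ring `Γ A` on both sides in the exact
sequence. -/
theorem coneBoundary_bijective (p : ℕ) (A : Rng.{u}) :
    Function.Bijective (negKBoundary p (A := ⟨finiteMatrices A.carrier⟩) (B := ⟨Cone A.carrier⟩)
      (C := ⟨Susp A.carrier⟩) (FinMat.isShortExact_toCone A.carrier)) := by
  have h0 := fun q => IsFlabby.negK_eq_zero q (A := ⟨Cone A.carrier⟩) (Cone.isFlabby A.carrier)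
  constructor
  · rw [injective_iff_map_eq_zero]
    intro x hx
    obtain ⟨y, rfl⟩ := negKBoundary_exact p (A := ⟨finiteMatrices A.carrier⟩)
      (B := ⟨Cone A.carrier⟩) (C := ⟨Susp A.carrier⟩) _ hx
    rw [h0 p y, map_zero]
  · intro y
    exact exists_negKBoundary_eq p (A := ⟨finiteMatrices A.carrier⟩)
      (B := ⟨Cone A.carrier⟩) (C := ⟨Susp A.carrier⟩) _ (h0 (p + 1) _)

/-- In degree `-(p + 1)` no induction is needed: `K₋ₚ₋₁ A` is `K₋ₚ (Σ A)`, and the cone boundary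
identifies the map induced by `Σ` of the corner with the one induced by `M_∞` of the corner. After
flattening the latter is a renumbering of `M_∞ A`, which acts as the identity. -/
theorem negKMap_corner_bijective (p : ℕ) (A : Rng.{u}) :
    Function.Bijective (negKMap p (B := ⟨finiteMatrices A.carrier⟩) (corner A.carrier)) := by
  cases p with
  | zero => exact FinMat.corner_K0nu_bijective A.carrier
  | succ p =>
    let MA : Rng.{u} := ⟨finiteMatrices A.carrier⟩
    let MMA : Rng.{u} := ⟨finiteMatrices MA.carrier⟩
    have h1 : Function.Bijective (negKMap (p + 1) (A := MA) (B := MMA)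
        (FinMat.map (corner A.carrier))) := by
      have hfl := negKMap_bijective (p + 1) (A := MMA) (B := MA)
        (FinMat.flatten_bijective A.carrier)
      refine (Function.Bijective.of_comp_iff' hfl _).1 ?_
      rw [show negKMap (p + 1) (A := MMA) (B := MA) (FinMat.flatten A.carrier) ∘
        negKMap (p + 1) (A := MA) (B := MMA) (FinMat.map (corner A.carrier)) = id from ?_]
      · exact Function.bijective_id
      · funext x
        refine (negKMap_map (p + 1) (A := MA) (B := MMA) (C := MA) _ _ x).trans ?_
        rw [FinMat.flatten_comp_map_corner]
        exact IsConj.negKMap_eq (p + 1) (A := MA) (FinMat.isConj_reindex _ _) x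
    have h2 : Function.Bijective (negKMap p (A := ⟨Susp A.carrier⟩) (B := ⟨Susp MA.carrier⟩)
        (Susp.map (corner A.carrier))) := by
      refine (Function.Bijective.of_comp_iff' (coneBoundary_bijective p MA) _).1 ?_
      rw [show _ ∘ _ = negKMap (p + 1) (A := MA) (B := MMA) (FinMat.map (corner A.carrier)) ∘
        negKBoundary p (A := ⟨finiteMatrices A.carrier⟩) (B := ⟨Cone A.carrier⟩)
          (C := ⟨Susp A.carrier⟩) (FinMat.isShortExact_toCone A.carrier) from ?_]
      · exact h1.comp (coneBoundary_bijective p A)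
      · funext x
        exact (negKBoundary_naturality p (A := MA) (B := ⟨Cone A.carrier⟩)
          (C := ⟨Susp A.carrier⟩) (A' := MMA) (B' := ⟨Cone MA.carrier⟩)
          (C' := ⟨Susp MA.carrier⟩) (FinMat.isShortExact_toCone A.carrier)
          (FinMat.isShortExact_toCone MA.carrier) (FinMat.map (corner A.carrier))
          (Cone.map (corner A.carrier)) (Susp.map (corner A.carrier)) (fun _ => rfl)
          (fun _ => rfl) x).symm
    have hS := fun X : Rng.{u} => K0nu.map_bijective (suspIterSusp_bijective p X)
    refine (Function.Bijective.of_comp_iff _ (hS A)).1 ?_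
    rw [show _ ∘ _ = K0nu.map (suspIterSusp p MA) ∘ negKMap p (A := ⟨Susp A.carrier⟩)
      (B := ⟨Susp MA.carrier⟩) (Susp.map (corner A.carrier)) from ?_]
    · exact (hS MA).comp h2
    · funext x
      refine (K0nu.map_map _ _ x).trans (Eq.trans ?_ (K0nu.map_map _ _ x).symm)
      exact congrArg (fun k => K0nu.map k x) (NonUnitalRingHom.ext fun y =>
        (suspIterSusp_naturality p (A := A) (B := MA) (corner A.carrier) y).symm)

/-! ### Boundary maps anticommute -/

theorem IsShortExact.exists_factor {A B C E : Type*} [NonUnitalRing A] [NonUnitalRing B]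
    [NonUnitalRing C] [NonUnitalRing E] {f : A →ₙ+* B} {g : B →ₙ+* C} (h : IsShortExact f g)
    (φ : E →ₙ+* B) (hφ : ∀ e, g (φ e) = 0) : ∃ ψ : E →ₙ+* A, ∀ e, f (ψ e) = φ e := by
  choose ψ hψ using fun e => (h.exact _).1 (hφ e)
  exact ⟨{ toFun := ψ
           map_zero' := h.inj (by rw [hψ, map_zero, map_zero])
           map_add' := fun x y => h.inj (by rw [hψ, map_add, map_add, hψ, hψ])
           map_mul' := fun x y => h.inj (by rw [hψ, map_mul, map_mul, hψ, hψ]) }, hψ⟩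

/-- In a `3 × 3` diagram with exact rows and columns, the two ways of composing boundary maps
agree up to sign. -/
theorem boundary_boundary {A₁ A₂ A₃ B₁ B₂ B₃ C₁ C₂ C₃ : Type u} [NonUnitalRing A₁]
    [NonUnitalRing A₂] [NonUnitalRing A₃] [NonUnitalRing B₁] [NonUnitalRing B₂] [NonUnitalRing B₃]
    [NonUnitalRing C₁] [NonUnitalRing C₂] [NonUnitalRing C₃]
    {f₁ : A₁ →ₙ+* B₁} {g₁ : B₁ →ₙ+* C₁} {f₂ : A₂ →ₙ+* B₂} {g₂ : B₂ →ₙ+* C₂}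
    {f₃ : A₃ →ₙ+* B₃} {g₃ : B₃ →ₙ+* C₃} {a₁ : A₁ →ₙ+* A₂} {a₂ : A₂ →ₙ+* A₃}
    {b₁ : B₁ →ₙ+* B₂} {b₂ : B₂ →ₙ+* B₃} {c₁ : C₁ →ₙ+* C₂} {c₂ : C₂ →ₙ+* C₃}
    (h₁ : IsShortExact f₁ g₁) (h₂ : IsShortExact f₂ g₂) (h₃ : IsShortExact f₃ g₃)
    (ha : IsShortExact a₁ a₂) (hb : IsShortExact b₁ b₂) (hc : IsShortExact c₁ c₂)
    (e₁ : ∀ x, b₁ (f₁ x) = f₂ (a₁ x)) (e₂ : ∀ x, b₂ (f₂ x) = f₃ (a₂ x))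
    (e₃ : ∀ x, c₁ (g₁ x) = g₂ (b₁ x)) (e₄ : ∀ x, c₂ (g₂ x) = g₃ (b₂ x)) (x : K0nu C₃) :
    boundary (Susp.isShortExact ha) (boundary h₃ x) =
      -boundary (Susp.isShortExact h₁) (boundary hc x) := by
  -- The extension `E → B₂ → C₃` maps to both `A₃ → B₃ → C₃` and `C₁ → C₂ → C₃`, so its boundary
  -- refines both first boundary maps.
  let E := kernel (g₃.comp b₂)
  let ι : E →ₙ+* B₂ := NonUnitalSubringClass.subtype E
  have hE : IsShortExact ι (g₃.comp b₂) :=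
    { inj := Subtype.val_injective
      exact := fun b => ⟨fun h => ⟨⟨b, h⟩, rfl⟩, by
        rintro ⟨e, rfl⟩
        exact e.2⟩
      surj := h₃.surj.comp hb.surj }
  obtain ⟨π₁, hπ₁⟩ := h₃.exists_factor (b₂.comp ι) fun e => e.2
  obtain ⟨π₂, hπ₂⟩ := hc.exists_factor (g₂.comp ι) fun e => (e₄ _).trans e.2
  let fE : A₂ →ₙ+* E :=
    { toFun := fun a => ⟨f₂ a, show g₃ (b₂ (f₂ a)) = 0 by
        rw [e₂]
        exact (h₃.exact _).2 ⟨_, rfl⟩⟩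
      map_zero' := Subtype.ext (map_zero f₂)
      map_add' := fun x y => Subtype.ext (map_add f₂ x y)
      map_mul' := fun x y => Subtype.ext (map_mul f₂ x y) }
  let bE : B₁ →ₙ+* E :=
    { toFun := fun a => ⟨b₁ a, show g₃ (b₂ (b₁ a)) = 0 by
        rw [(hb.exact _).2 ⟨_, rfl⟩, map_zero]⟩
      map_zero' := Subtype.ext (map_zero b₁)
      map_add' := fun x y => Subtype.ext (map_add b₁ x y)
      map_mul' := fun x y => Subtype.ext (map_mul b₁ x y) }
  have h1f : ∀ a, π₁ (fE a) = a₂ a := fun a => h₃.inj ((hπ₁ _).trans (e₂ a))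
  have h2f : ∀ a, π₂ (fE a) = 0 := fun a => hc.inj ((hπ₂ _).trans (by
    rw [map_zero]
    exact (h₂.exact _).2 ⟨a, rfl⟩))
  have h1b : ∀ b, π₁ (bE b) = 0 := fun b => h₃.inj ((hπ₁ _).trans (by
    rw [map_zero]
    exact (hb.exact _).2 ⟨b, rfl⟩))
  have h2b : ∀ b, π₂ (bE b) = g₁ b := fun b => hc.inj ((hπ₂ _).trans (e₃ b).symm)
  -- This extension of `A₃ × C₁` by `A₁` restricts to `A₁ → A₂ → A₃` over the first factor and to
  -- `A₁ → B₁ → C₁` over the second; its boundary is therefore the sum of the two second boundary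
  -- maps.
  have hk : IsShortExact (fE.comp a₁) (π₁.prod π₂) :=
    { inj := fun x y hxy => ha.inj (h₂.inj (congrArg Subtype.val hxy))
      exact := fun e => by
        constructor
        · intro he
          have he1 : b₂ e = 0 := by
            rw [← map_zero f₃, ← show π₁ e = 0 from congrArg Prod.fst he]
            exact (hπ₁ e).symm
          have he2 : g₂ e = 0 := by
            rw [← map_zero c₁, ← show π₂ e = 0 from congrArg Prod.snd he]
            exact (hπ₂ e).symm
          obtain ⟨a, ha'⟩ := (h₂.exact _).1 he2
          obtain ⟨a', rfl⟩ := (ha.exact a).1 (h₃.inj (by rw [← e₂, ha', he1, map_zero]))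
          exact ⟨a', Subtype.ext ha'⟩
        · rintro ⟨a, rfl⟩
          exact Prod.ext ((h1f _).trans ((ha.exact _).2 ⟨a, rfl⟩)) (h2f _)
      surj := by
        rintro ⟨a, c⟩
        obtain ⟨a, rfl⟩ := ha.surj a
        obtain ⟨b, rfl⟩ := h₁.surj c
        refine ⟨fE a + bE b, Prod.ext ?_ ?_⟩
        · change π₁ _ = _
          rw [map_add, h1f, h1b, add_zero]
        · change π₂ _ = _
          rw [map_add, h2f, h2b, zero_add] }
  have n₁ := boundary_naturality hE h₃ π₁ b₂ (NonUnitalRingHom.id C₃) (fun e => (hπ₁ e).symm)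
    (fun _ => rfl) x
  have n₂ := boundary_naturality hE hc π₂ g₂ (NonUnitalRingHom.id C₃) (fun e => (hπ₂ e).symm)
    (fun b => (e₄ b).symm) x
  rw [K0nu.map_id] at n₁ n₂
  have n₃ := boundary_naturality (Susp.isShortExact ha) (Susp.isShortExact hk)
    (NonUnitalRingHom.id (Susp A₁)) (Susp.map fE) (Susp.map (inlHom A₃ C₁))
    (fun x => (Susp.map_map _ _ x)) (fun x => by
      rw [Susp.map_map, Susp.map_map]
      exact congrArg (fun k => Susp.map k x) (NonUnitalRingHom.ext fun a =>
        Prod.ext (h1f a).symm (h2f a).symm)) (boundary h₃ x)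
  have n₄ := boundary_naturality (Susp.isShortExact h₁) (Susp.isShortExact hk)
    (NonUnitalRingHom.id (Susp A₁)) (Susp.map bE) (Susp.map (inrHom A₃ C₁))
    (fun x => by
      rw [Susp.map_map]
      exact congrArg (fun k => Susp.map k x) (NonUnitalRingHom.ext fun a =>
        Subtype.ext (e₁ a))) (fun x => by
      rw [Susp.map_map, Susp.map_map]
      exact congrArg (fun k => Susp.map k x) (NonUnitalRingHom.ext fun b =>
        Prod.ext (h1b b).symm (h2b b).symm)) (boundary hc x)
  have hid : Susp.map (NonUnitalRingHom.id (Susp A₁)) = NonUnitalRingHom.id _ :=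
    NonUnitalRingHom.ext (Susp.map_id _)
  rw [hid, K0nu.map_id] at n₃ n₄
  have hsum := K0nu.eq_add_of_split (i₁ := Susp.map (inlHom A₃ C₁))
    (p₁ := Susp.map (NonUnitalRingHom.fst A₃ C₁)) (i₂ := Susp.map (inrHom A₃ C₁))
    (p₂ := Susp.map (NonUnitalRingHom.snd A₃ C₁)) (Susp.isShortExact (IsShortExact.inr_fst A₃ C₁))
    (fun x => (Susp.map_map _ _ x).trans (Susp.map_id _ x))
    (fun x => (Susp.map_map _ _ x).trans (Susp.map_id _ x))
    (fun x => by
      obtain ⟨a, rfl⟩ := Susp.proj_surjective _ x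
      rfl) (K0nu.map (Susp.map (π₁.prod π₂)) (boundary hE x))
  have q₁ : (Susp.map (NonUnitalRingHom.fst A₃ C₁)).comp (Susp.map (π₁.prod π₂)) = Susp.map π₁ :=
    NonUnitalRingHom.ext fun x => Susp.map_map _ _ x
  have q₂ : (Susp.map (NonUnitalRingHom.snd A₃ C₁)).comp (Susp.map (π₁.prod π₂)) = Susp.map π₂ :=
    NonUnitalRingHom.ext fun x => Susp.map_map _ _ x
  rw [K0nu.map_map (Susp.map (π₁.prod π₂)), K0nu.map_map (Susp.map (π₁.prod π₂)), q₁, q₂,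
    n₁, n₂] at hsum
  -- The element of `K₀ (Σ (A₃ × C₁))` with components the two first boundaries comes from `Σ E`, so
  -- its boundary, the sum of the two composites, is zero.
  have h0 := boundary_map (Susp.isShortExact hk) (boundary hE x)
  rw [hsum, map_add, ← n₃, ← n₄] at h0
  exact eq_neg_of_add_eq_zero_left h0

/-! ### Polynomial rings, path rings and loop rings -/

namespace Poly

variable {A B C : Type u} [NonUnitalRing A] [NonUnitalRing B] [NonUnitalRing C]

/-- The coefficients of a polynomial. -/
noncomputable def coeff (n : ℕ) : Poly A →+ A where
  toFun p := (p.1.coeff n).part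
  map_zero' := rfl
  map_add' p q := by
    rw [AddMemClass.coe_add, Polynomial.coeff_add]
    rfl

theorem incl_coeff (p : Poly A) (n : ℕ) : Tilde.incl A (coeff n p) = p.1.coeff n :=
  Tilde.incl_part (p.2 n)

theorem ext {p q : Poly A} (h : ∀ n, coeff n p = coeff n q) : p = q :=
  Subtype.ext (Polynomial.ext fun n => by rw [← incl_coeff, ← incl_coeff, h])

theorem exists_bound (p : Poly A) : ∃ N, ∀ n, N ≤ n → coeff n p = 0 :=
  ⟨p.1.natDegree + 1, fun n hn => by
    change (p.1.coeff n).part = 0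
    rw [Polynomial.coeff_eq_zero_of_natDegree_lt (by omega)]
    rfl⟩

theorem coeff_mul (p q : Poly A) (n : ℕ) :
    coeff n (p * q) = ∑ x ∈ Finset.HasAntidiagonal.antidiagonal n, coeff x.1 p * coeff x.2 q := by
  have h : Tilde.incl A (coeff n (p * q)) =
      Tilde.incl A (∑ x ∈ Finset.HasAntidiagonal.antidiagonal n, coeff x.1 p * coeff x.2 q) := by
    rw [incl_coeff, MulMemClass.coe_mul, Polynomial.coeff_mul, map_sum]
    exact Finset.sum_congr rfl fun x _ => by rw [map_mul, incl_coeff, incl_coeff]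
  exact congrArg Tilde.part h

/-- The polynomial with given coefficients. -/
noncomputable def ofFun (a : ℕ → A) (h : ∃ N, ∀ n, N ≤ n → a n = 0) : Poly A :=
  ⟨∑ n ∈ Finset.range h.choose, Polynomial.monomial n (Tilde.incl A (a n)), fun n => by
    rw [Polynomial.finsetSum_coeff, map_sum]
    refine Finset.sum_eq_zero fun k _ => ?_
    rw [Polynomial.coeff_monomial]
    split_ifs <;> simp⟩

@[simp] theorem coeff_ofFun (a : ℕ → A) (h : ∃ N, ∀ n, N ≤ n → a n = 0) (n : ℕ) :
    coeff n (ofFun a h) = a n := by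
  change (Polynomial.coeff (∑ n ∈ Finset.range h.choose, Polynomial.monomial n
    (Tilde.incl A (a n))) n).part = a n
  rw [Polynomial.finsetSum_coeff]
  simp only [Polynomial.coeff_monomial, Finset.sum_ite_eq', Finset.mem_range]
  split_ifs with hn
  · simp
  · exact (h.choose_spec n (by omega)).symm

@[simp] theorem coeff_map (f : A →ₙ+* B) (p : Poly A) (n : ℕ) :
    coeff n (map f p) = f (coeff n p) := by
  change (Polynomial.coeff (p.1.map (Tilde.map f)) n).part = _
  rw [Polynomial.coeff_map, Tilde.part_map]
  rfl

theorem ev_eq_sum (r : ℤ) {p : Poly A} {N : ℕ} (h : ∀ n, N ≤ n → coeff n p = 0) :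
    ev A r p = ∑ n ∈ Finset.range N, r ^ n • coeff n p := by
  -- For `N = 0` the polynomial is zero and its `natDegree` is still `0`, so only the bound `N + 1`
  -- holds; the extra summand vanishes.
  have hN : p.1.natDegree < N + 1 := by
    refine Nat.lt_succ_of_le (Polynomial.natDegree_le_iff_coeff_eq_zero.2 fun n hn => ?_)
    rw [← incl_coeff, h n hn.le, map_zero]
  have hs : evTilde A r p.1 = Tilde.incl A (∑ n ∈ Finset.range N, r ^ n • coeff n p) := by
    rw [evTilde_apply, Polynomial.eval_eq_sum_range' hN, Finset.sum_range_succ, ← incl_coeff p N,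
      h N le_rfl, map_zero, zero_mul, add_zero, map_sum]
    refine Finset.sum_congr rfl fun n _ => ?_
    rw [map_zsmul, incl_coeff, zsmul_eq_mul, Int.cast_pow]
    exact ((Int.cast_commute r _).pow_left n).symm
  exact congrArg Tilde.part hs

theorem ev_zero (p : Poly A) : ev A 0 p = coeff 0 p := by
  obtain ⟨N, hN⟩ := exists_bound p
  rw [ev_eq_sum 0 (N := N + 1) (fun n hn => hN n (by omega)), Finset.sum_range_succ']
  simp

theorem ev_const (r : ℤ) (a : A) : ev A r (const A a) = a := by
  change (evTilde A r (Polynomial.C _)).part = a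
  rw [evTilde_apply, Polynomial.eval_C, Tilde.part_incl]

theorem map_map (f : A →ₙ+* B) (g : B →ₙ+* C) (p : Poly A) :
    map g (map f p) = map (g.comp f) p := ext fun n => by simp

theorem map_id (p : Poly A) : map (NonUnitalRingHom.id A) p = p := ext fun n => by simp

theorem isShortExact {f : A →ₙ+* B} {g : B →ₙ+* C} (h : IsShortExact f g) :
    IsShortExact (map f) (map g) where
  inj p q hpq := ext fun n => h.inj (by rw [← coeff_map, hpq, coeff_map])
  exact b := by
    constructor
    · intro hb
      obtain ⟨N, hN⟩ := exists_bound b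
      choose a ha using fun n => (h.exact (coeff n b)).1 (by rw [← coeff_map, hb, map_zero])
      refine ⟨ofFun a ⟨N, fun n hn => h.inj ?_⟩, ext fun n => ?_⟩
      · rw [ha, hN n hn, map_zero]
      · rw [coeff_map, coeff_ofFun, ha]
    · rintro ⟨a, rfl⟩
      refine ext fun n => ?_
      rw [coeff_map, coeff_map, map_zero]
      exact (h.exact _).2 ⟨_, rfl⟩
  surj c := by
    obtain ⟨N, hN⟩ := exists_bound c
    choose s hs using h.surj
    refine ⟨ofFun (fun n => if n < N then s (coeff n c) else 0)
      ⟨N, fun n hn => if_neg (by omega)⟩, ext fun n => ?_⟩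
    rw [coeff_map, coeff_ofFun]
    split_ifs with hn
    · exact hs _
    · rw [map_zero, hN n (by omega)]

/-- The automorphism of `A[t][s]` exchanging the variables. -/
noncomputable def swap (A : Type u) [NonUnitalRing A] : Poly (Poly A) →ₙ+* Poly (Poly A) := by
  have hb : ∀ p : Poly (Poly A), ∃ N M, ∀ n m, N ≤ n ∨ M ≤ m → coeff m (coeff n p) = 0 := by
    intro p
    obtain ⟨N, hN⟩ := exists_bound p
    choose M hM using fun n => exists_bound (coeff n p)
    refine ⟨N, (Finset.range N).sup M, fun n m h => ?_⟩
    by_cases hn : N ≤ n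
    · rw [hN n hn, map_zero]
    · exact hM n m ((Finset.le_sup (f := M) (Finset.mem_range.2 (by omega))).trans
        (h.resolve_left hn))
  have h1 : ∀ (p : Poly (Poly A)) (m : ℕ), ∃ N, ∀ n, N ≤ n → coeff m (coeff n p) = 0 :=
      fun p m => by
    obtain ⟨N, M, h⟩ := hb p
    exact ⟨N, fun n hn => h n m (Or.inl hn)⟩
  have h2 : ∀ p : Poly (Poly A), ∃ M, ∀ m, M ≤ m →
      ofFun (fun n => coeff m (coeff n p)) (h1 p m) = 0 := fun p => by
    obtain ⟨N, M, h⟩ := hb p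
    refine ⟨M, fun m hm => ext fun n => ?_⟩
    rw [coeff_ofFun, h n m (Or.inr hm), map_zero]
  exact
  { toFun := fun p => ofFun (fun m => ofFun (fun n => coeff m (coeff n p)) (h1 p m)) (h2 p)
    map_zero' := ext fun m => ext fun n => by simp
    map_add' := fun p q => ext fun m => ext fun n => by simp
    map_mul' := fun p q => ext fun m => ext fun n => by
      simp only [coeff_ofFun, coeff_mul, map_sum]
      rw [Finset.sum_comm] }

@[simp] theorem coeff_coeff_swap (p : Poly (Poly A)) (n m : ℕ) :
    coeff n (coeff m (swap A p)) = coeff m (coeff n p) :=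
  (congrArg (coeff n) (coeff_ofFun _ _ m)).trans (coeff_ofFun _ _ n)

theorem map_ev_swap (r : ℤ) (p : Poly (Poly A)) : map (ev A r) (swap A p) = ev (Poly A) r p := by
  obtain ⟨N, hN⟩ := exists_bound p
  refine ext fun m => ?_
  rw [coeff_map, ev_eq_sum r hN, ev_eq_sum r (N := N) (fun n hn => by
    rw [coeff_coeff_swap, hN n hn, map_zero]), map_sum]
  exact Finset.sum_congr rfl fun n _ => by rw [coeff_coeff_swap, map_zsmul]

theorem swap_swap (p : Poly (Poly A)) : swap A (swap A p) = p :=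
  ext fun n => ext fun m => by simp

theorem ev_swap (r : ℤ) (p : Poly (Poly A)) : ev (Poly A) r (swap A p) = map (ev A r) p := by
  rw [← map_ev_swap, swap_swap]

/-- The substitution `t ↦ t s`. -/
noncomputable def subst (A : Type u) [NonUnitalRing A] : Poly A →ₙ+* Poly (Poly A) := by
  have h1 : ∀ (p : Poly A) (m : ℕ), ∃ N, ∀ n, N ≤ n → (if n = m then coeff n p else 0) = 0 :=
    fun p m => ⟨m + 1, fun n hn => if_neg (by omega)⟩
  have h2 : ∀ p : Poly A, ∃ M, ∀ m, M ≤ m →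
      ofFun (fun n => if n = m then coeff n p else 0) (h1 p m) = 0 := fun p => by
    obtain ⟨N, h⟩ := exists_bound p
    refine ⟨N, fun m hm => ext fun n => ?_⟩
    rw [coeff_ofFun, map_zero]
    split_ifs with hn
    · exact h n (by omega)
    · rfl
  exact
  { toFun := fun p => ofFun (fun m => ofFun (fun n => if n = m then coeff n p else 0) (h1 p m))
      (h2 p)
    map_zero' := ext fun m => ext fun n => by simp
    map_add' := fun p q => ext fun m => ext fun n => by
      simp only [coeff_ofFun, map_add]
      split_ifs <;> simp
    map_mul' := fun p q => ext fun m => ext fun n => by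
      simp only [coeff_ofFun, coeff_mul, map_sum]
      rw [Finset.sum_comm]
      -- Only `y = x` can contribute, and `x` lies on the antidiagonal of `m` exactly when `n = m`.
      have h : ∀ x ∈ Finset.HasAntidiagonal.antidiagonal n,
          ∑ y ∈ Finset.HasAntidiagonal.antidiagonal m,
          (if x.1 = y.1 then coeff x.1 p else 0) * (if x.2 = y.2 then coeff x.2 q else 0) =
          if n = m then coeff x.1 p * coeff x.2 q else 0 := by
        intro x hx
        rw [Finset.HasAntidiagonal.mem_antidiagonal] at hx
        split_ifs with hnm
        · rw [Finset.sum_eq_single x]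
          · simp
          · intro y hy hyx
            by_cases h1 : x.1 = y.1
            · by_cases h2 : x.2 = y.2
              · exact absurd (Prod.ext h1.symm h2.symm) hyx
              · rw [if_neg h2, mul_zero]
            · rw [if_neg h1, zero_mul]
          · intro h
            exact absurd (Finset.HasAntidiagonal.mem_antidiagonal.2 (hx.trans hnm)) h
        · refine Finset.sum_eq_zero fun y hy => ?_
          rw [Finset.HasAntidiagonal.mem_antidiagonal] at hy
          by_cases h1 : x.1 = y.1
          · rw [if_neg (c := x.2 = y.2) (by omega), mul_zero]
          · rw [if_neg h1, zero_mul]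
      rw [Finset.sum_congr rfl h]
      split_ifs <;> simp }

@[simp] theorem coeff_coeff_subst (p : Poly A) (n m : ℕ) :
    coeff n (coeff m (subst A p)) = if n = m then coeff n p else 0 :=
  (congrArg (coeff n) (coeff_ofFun _ _ m)).trans (coeff_ofFun _ _ n)

theorem ev_one_subst (p : Poly A) : ev (Poly A) 1 (subst A p) = p := by
  obtain ⟨N, hN⟩ := exists_bound p
  refine ext fun n => ?_
  rw [ev_eq_sum 1 (N := N) (fun m hm => ext fun n => by
    rw [coeff_coeff_subst, map_zero]
    split_ifs with h
    · exact hN n (by omega)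
    · rfl), map_sum]
  simp only [one_pow, one_smul, coeff_coeff_subst, Finset.sum_ite_eq, Finset.mem_range]
  split_ifs with h
  · rfl
  · exact (hN n (by omega)).symm

end Poly

/-- The snake lemma for kernels. -/
theorem IsShortExact.kernelMap {A B C A' B' C' : Type*} [NonUnitalRing A] [NonUnitalRing B]
    [NonUnitalRing C] [NonUnitalRing A'] [NonUnitalRing B'] [NonUnitalRing C']
    {f : A →ₙ+* B} {g : B →ₙ+* C} {f' : A' →ₙ+* B'} {g' : B' →ₙ+* C'} (h : IsShortExact f g)
    (h' : IsShortExact f' g') {α : A →ₙ+* A'} {β : B →ₙ+* B'} {γ : C →ₙ+* C'}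
    (h1 : ∀ x, β (f x) = f' (α x)) (h2 : ∀ x, γ (g x) = g' (β x))
    (hα : Function.Surjective α) :
    IsShortExact (HomotopyK.kernelMap α β f f' h1) (HomotopyK.kernelMap β γ g g' h2) where
  inj x y hxy := Subtype.ext (h.inj (congrArg Subtype.val hxy))
  exact b := by
    constructor
    · intro hb
      obtain ⟨a, ha⟩ := (h.exact b.1).1 (congrArg Subtype.val hb)
      exact ⟨⟨a, h'.inj (by rw [← h1, ha, map_zero]; exact b.2)⟩, Subtype.ext ha⟩
    · rintro ⟨a, rfl⟩
      exact Subtype.ext ((h.exact _).2 ⟨a.1, rfl⟩)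
  surj c := by
    -- A preimage `b` need not lie in the kernel of `β`. The obstruction `β b` comes from `A'`, and
    -- surjectivity of `α` lets it be removed by subtracting an `f a`.
    obtain ⟨b, hb⟩ := h.surj c.1
    obtain ⟨a', ha'⟩ := (h'.exact (β b)).1 (by rw [← h2, hb]; exact c.2)
    obtain ⟨a, rfl⟩ := hα a'
    refine ⟨⟨b - f a, ?_⟩, Subtype.ext ?_⟩
    · rw [mem_kernel, map_sub, h1, ha', sub_self]
    · change g (b - f a) = c.1
      rw [map_sub, (h.exact _).2 ⟨a, rfl⟩, sub_zero, hb]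

section PathLoop

variable {A B C : Type u} [NonUnitalRing A] [NonUnitalRing B] [NonUnitalRing C]

/-- The inclusion of the path ring in the polynomial ring. -/
noncomputable def Path.incl (A : Type u) [NonUnitalRing A] : Path A →ₙ+* Poly A :=
  NonUnitalSubringClass.subtype (Path A)

theorem Path.isShortExact_incl (A : Type u) [NonUnitalRing A] :
    IsShortExact (Path.incl A) (Poly.ev A 0) where
  inj := Subtype.val_injective
  exact p := ⟨fun h => ⟨⟨p, h⟩, rfl⟩, by
    rintro ⟨q, rfl⟩
    exact q.2⟩
  surj a := ⟨Poly.const A a, Poly.ev_const 0 a⟩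

theorem Path.isShortExact {f : A →ₙ+* B} {g : B →ₙ+* C} (h : IsShortExact f g) :
    IsShortExact (Path.map f) (Path.map g) :=
  (Poly.isShortExact h).kernelMap h (Poly.ev_map f 0) (fun p => (Poly.ev_map g 0 p))
    (Path.isShortExact_incl A).surj

theorem Loop.isShortExact_map {f : A →ₙ+* B} {g : B →ₙ+* C} (h : IsShortExact f g) :
    IsShortExact (Loop.map f) (Loop.map g) :=
  (Path.isShortExact h).kernelMap h (Path.ev_map f) (Path.ev_map g) (Loop.isShortExact A).surj

theorem loopIter_isShortExact (m : ℕ) {A B C : Rng.{u}} {f : A.carrier →ₙ+* B.carrier}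
    {g : B.carrier →ₙ+* C.carrier} (h : IsShortExact f g) :
    IsShortExact (loopIterMap m f) (loopIterMap m g) := by
  induction m with
  | zero => exact h
  | succ m ih => exact Loop.isShortExact_map ih

theorem Path.map_map (f : A →ₙ+* B) (g : B →ₙ+* C) (p : Path A) :
    Path.map g (Path.map f p) = Path.map (g.comp f) p :=
  Subtype.ext (Poly.map_map f g p.1)

theorem Path.map_id (p : Path A) : Path.map (NonUnitalRingHom.id A) p = p :=
  Subtype.ext (Poly.map_id p.1)

theorem Loop.map_map (f : A →ₙ+* B) (g : B →ₙ+* C) (p : Loop A) :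
    Loop.map g (Loop.map f p) = Loop.map (g.comp f) p :=
  Subtype.ext (Path.map_map f g p.1)

theorem Loop.map_id (p : Loop A) : Loop.map (NonUnitalRingHom.id A) p = p :=
  Subtype.ext (Path.map_id p.1)

theorem loopIterMap_map (m : ℕ) {A B C : Rng.{u}} (f : A.carrier →ₙ+* B.carrier)
    (g : B.carrier →ₙ+* C.carrier) (x : (loopIter m A).carrier) :
    loopIterMap m g (loopIterMap m f x) = loopIterMap m (g.comp f) x := by
  induction m with
  | zero => rfl
  | succ m ih =>
    refine (Loop.map_map _ _ x).trans ?_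
    exact congrArg (fun k => Loop.map k x) (NonUnitalRingHom.ext ih)

theorem loopIterMap_id (m : ℕ) (A : Rng.{u}) (x : (loopIter m A).carrier) :
    loopIterMap m (NonUnitalRingHom.id A.carrier) x = x := by
  induction m with
  | zero => rfl
  | succ m ih =>
    refine Eq.trans ?_ (Loop.map_id x)
    exact congrArg (fun k => Loop.map k x) (NonUnitalRingHom.ext ih)

theorem Loop.map_bijective {f : A →ₙ+* B} (hf : Function.Bijective f) :
    Function.Bijective (Loop.map f) := by
  obtain ⟨g, h1, h2⟩ := exists_inverse_of_bijective hf
  refine Function.bijective_iff_has_inverse.2 ⟨Loop.map g, fun x => ?_, fun x => ?_⟩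
  · rw [Loop.map_map, show g.comp f = NonUnitalRingHom.id _ from NonUnitalRingHom.ext h1,
      Loop.map_id]
  · rw [Loop.map_map, show f.comp g = NonUnitalRingHom.id _ from NonUnitalRingHom.ext h2,
      Loop.map_id]

/-- The exchange of variables `Ω P A → P Ω A`, for `X = P A` and `Y = Ω A`. -/
theorem exists_loop_path_aux {X Y : Type u} [NonUnitalRing X] [NonUnitalRing Y] {i : X →ₙ+* Poly A}
    {j : Y →ₙ+* X} (hi : IsShortExact i (Poly.ev A 0))
    (hj : IsShortExact j ((Poly.ev A 1).comp i)) :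
    ∃ θ : Loop X →ₙ+* Path Y, ∀ x, i (j (Path.ev Y (θ x))) =
      Poly.map ((Poly.ev A 1).comp i) (Path.incl X (Loop.incl X x)) := by
  let ρ : Loop X →ₙ+* Poly X := (Path.incl X).comp (Loop.incl X)
  have hρ0 : ∀ x, Poly.ev X 0 (ρ x) = 0 := fun x => x.1.2
  have hρ1 : ∀ x, Poly.ev X 1 (ρ x) = 0 := fun x => x.2
  have hρ : ∀ x, ρ x = Path.incl X (Loop.incl X x) := fun _ => rfl
  clear_value ρ
  -- After the exchange the loop variable is the inner one. Vanishing of loops at `0` and at `1`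
  -- makes the coefficients factor through `i` and then through `j`, and vanishing of elements of
  -- `X` at `0` makes the resulting polynomial over `Y` a path.
  let φ : Loop X →ₙ+* Poly (Poly A) := (Poly.swap A).comp ((Poly.map i).comp ρ)
  have hφ : ∀ x, φ x = Poly.swap A (Poly.map i (ρ x)) := fun _ => rfl
  clear_value φ
  obtain ⟨ψ₁, h₁⟩ := (Poly.isShortExact hi).exists_factor φ fun x => by
    rw [hφ, Poly.map_ev_swap, Poly.ev_map, hρ0, map_zero]
  obtain ⟨ψ₂, h₂⟩ := (Poly.isShortExact hj).exists_factor ψ₁ fun x => by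
    rw [← Poly.map_map, h₁, hφ, Poly.map_ev_swap, Poly.ev_map, hρ1, map_zero]
  have h₃ : ∀ r x, i (j (Poly.ev Y r (ψ₂ x))) = Poly.map ((Poly.ev A r).comp i) (ρ x) :=
    fun r x => by
      rw [← Poly.ev_map, ← Poly.ev_map, h₂, h₁, hφ, Poly.ev_swap, Poly.map_map]
  obtain ⟨θ, hθ⟩ := (Path.isShortExact_incl Y).exists_factor ψ₂ fun x =>
    hj.inj (hi.inj (by
      rw [h₃, map_zero, map_zero]
      refine Poly.ext fun n => ?_
      rw [Poly.coeff_map, map_zero]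
      exact (hi.exact _).2 ⟨_, rfl⟩))
  refine ⟨θ, fun x => ?_⟩
  have h₄ : Path.ev Y (θ x) = Poly.ev Y 1 (ψ₂ x) := congrArg (Poly.ev Y 1) (hθ x)
  rw [h₄, h₃]
  exact congrArg _ (hρ x)

/-- The path ring `X = P A` is contractible. -/
theorem exists_path_path_aux {X : Type u} [NonUnitalRing X] {i : X →ₙ+* Poly A}
    (hi : IsShortExact i (Poly.ev A 0)) : ∃ μ : X →ₙ+* Path X, ∀ x, Path.ev X (μ x) = x := by
  have h0 : ∀ x, Poly.coeff 0 (i x) = 0 := fun x => by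
    rw [← Poly.ev_zero]
    exact (hi.exact _).2 ⟨_, rfl⟩
  -- The contraction is `f(t) ↦ f(t s)`: it is `f` at `s = 1` and `f(0) = 0` at `s = 0`.
  obtain ⟨ψ, h₁⟩ := (Poly.isShortExact hi).exists_factor ((Poly.subst A).comp i) fun x =>
    Poly.ext fun n => by
      rw [Poly.coeff_map, Poly.ev_zero, map_zero]
      refine (Poly.coeff_coeff_subst _ _ _).trans ?_
      split_ifs
      · exact h0 x
      · rfl
  have h₂ : ∀ r x, i (Poly.ev X r (ψ x)) = Poly.ev (Poly A) r (Poly.subst A (i x)) := fun r x => by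
    rw [← Poly.ev_map, h₁]
    rfl
  obtain ⟨μ, hμ⟩ := (Path.isShortExact_incl X).exists_factor ψ fun x => hi.inj (by
    rw [h₂, Poly.ev_zero, map_zero]
    refine Poly.ext fun n => ?_
    rw [Poly.coeff_coeff_subst, map_zero]
    split_ifs with h
    · rw [h, h0]
    · rfl)
  refine ⟨μ, fun x => hi.inj ?_⟩
  have h₄ : Path.ev X (μ x) = Poly.ev X 1 (ψ x) := congrArg (Poly.ev X 1) (hμ x)
  rw [h₄, h₂, Poly.ev_one_subst]

/-- A ring with trivial multiplication is contractible. -/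
theorem exists_path_of_mul_eq_zero (hA : ∀ a b : A, a * b = 0) :
    ∃ μ : A →ₙ+* Path A, ∀ x, Path.ev A (μ x) = x := by
  have hb : ∀ a : A, ∃ N, ∀ n, N ≤ n → (if n = 1 then a else 0) = 0 := fun a =>
    ⟨2, fun n hn => if_neg (by omega)⟩
  have h0 : ∀ a : A, Poly.ofFun (fun n => if n = 1 then a else 0) (hb a) ∈ Path A := fun a => by
    rw [mem_kernel, Poly.ev_zero, Poly.coeff_ofFun, if_neg (by omega)]
  -- The map `a ↦ a t` is multiplicative because all products vanish on both sides.
  refine ⟨{ toFun := fun a => ⟨_, h0 a⟩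
            map_zero' := Subtype.ext (Poly.ext fun n => by simp)
            map_add' := fun a b => Subtype.ext (Poly.ext fun n => by
              simp only [Poly.coeff_ofFun, AddMemClass.coe_add, map_add]
              split_ifs <;> simp)
            map_mul' := fun a b => Subtype.ext (Poly.ext fun n => by
              simp only [Poly.coeff_ofFun, MulMemClass.coe_mul, Poly.coeff_mul, hA]
              simp) }, fun x => ?_⟩
  change Poly.ev A 1 (Poly.ofFun (fun n => if n = 1 then x else 0) (hb x)) = x
  rw [Poly.ev_eq_sum 1 (N := 2) (fun n hn => by rw [Poly.coeff_ofFun, if_neg (by omega)])]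
  simp

end PathLoop

/-- Exchanging path and loop variables: `Ω^m P A → P Ω^m A`. -/
theorem exists_loopIter_path_step {L X Y R : Rng.{u}} {i : X.carrier →ₙ+* Poly R.carrier}
    {j : Y.carrier →ₙ+* X.carrier} (hi : IsShortExact i (Poly.ev R.carrier 0))
    (hj : IsShortExact j ((Poly.ev R.carrier 1).comp i)) (θ : L.carrier →ₙ+* X.carrier) :
    ∃ θ' : Loop L.carrier →ₙ+* Path Y.carrier, ∀ x, i (j (Path.ev Y.carrier (θ' x))) =
      Poly.map (((Poly.ev R.carrier 1).comp i).comp θ)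
        (Path.incl L.carrier (Loop.incl L.carrier x)) := by
  obtain ⟨ψ, hψ⟩ := exists_loop_path_aux hi hj
  refine ⟨ψ.comp (Loop.map θ), fun x => (hψ _).trans ?_⟩
  exact Poly.map_map θ _ _

/-- The path variable is moved past the loop variables one at a time. With this, a section of `P A →
A` provides one of `P (Ω^m A) → Ω^m A`. -/
theorem exists_loopIter_path (m : ℕ) (A : Rng.{u}) :
    ∃ θ : (loopIter m ⟨Path A.carrier⟩).carrier →ₙ+* Path (loopIter m A).carrier,
      ∀ x, Path.ev (loopIter m A).carrier (θ x) =
        loopIterMap m (A := ⟨Path A.carrier⟩) (Path.ev A.carrier) x := by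
  induction m with
  | zero => exact ⟨NonUnitalRingHom.id _, fun _ => rfl⟩
  | succ m ih =>
    obtain ⟨θ, hθ⟩ := ih
    have hi := Path.isShortExact_incl (loopIter m A).carrier
    have hj := Loop.isShortExact (loopIter m A).carrier
    obtain ⟨θ', hθ'⟩ := exists_loopIter_path_step (L := loopIter m ⟨Path A.carrier⟩)
      (X := ⟨Path (loopIter m A).carrier⟩) (Y := loopIter (m + 1) A) (R := loopIter m A) hi hj θ
    refine ⟨θ', fun x => hj.inj (hi.inj ((hθ' x).trans ?_))⟩
    have h : ((Poly.ev (loopIter m A).carrier 1).comp (Path.incl (loopIter m A).carrier)).comp θ =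
        loopIterMap m (A := ⟨Path A.carrier⟩) (Path.ev A.carrier) := NonUnitalRingHom.ext hθ
    exact congrArg (fun k => Poly.map k _) h

theorem IsShortExact.exists_bijective {A B C A' B' C' : Type*} [NonUnitalRing A] [NonUnitalRing B]
    [NonUnitalRing C] [NonUnitalRing A'] [NonUnitalRing B'] [NonUnitalRing C'] {f : A →ₙ+* B}
    {g : B →ₙ+* C} {f' : A' →ₙ+* B'} {g' : B' →ₙ+* C'} (h : IsShortExact f g)
    (h' : IsShortExact f' g') {β : B →ₙ+* B'} (hβ : Function.Bijective β)
    (hg : ∀ b, g b = 0 ↔ g' (β b) = 0) :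
    ∃ α : A →ₙ+* A', Function.Bijective α ∧ ∀ a, f' (α a) = β (f a) := by
  obtain ⟨α, hα⟩ := h'.exists_factor (β.comp f) fun a => (hg _).1 ((h.exact _).2 ⟨a, rfl⟩)
  refine ⟨α, ⟨fun x y hxy => h.inj (hβ.1 ?_), fun a' => ?_⟩, hα⟩
  · exact (hα x).symm.trans ((congrArg f' hxy).trans (hα y))
  · obtain ⟨b, hb⟩ := hβ.2 (f' a')
    obtain ⟨a, rfl⟩ := (h.exact b).1 ((hg b).2 (by rw [hb]; exact (h'.exact _).2 ⟨a', rfl⟩))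
    exact ⟨a, h'.inj ((hα a).trans hb)⟩

/-- An isomorphism of `M[t]` with `Q` induces an isomorphism of `Ω M`. -/
theorem exists_bijective_loop {M Q P L : Type u} [NonUnitalRing M] [NonUnitalRing Q]
    [NonUnitalRing P] [NonUnitalRing L] {β : Poly M →ₙ+* Q} (hβ : Function.Bijective β)
    {s₀ s₁ : Q →ₙ+* M} (h₀ : ∀ p, s₀ (β p) = Poly.ev M 0 p) (h₁ : ∀ p, s₁ (β p) = Poly.ev M 1 p)
    {i : P →ₙ+* Q} {j : L →ₙ+* P} (hi : IsShortExact i s₀) (hj : IsShortExact j (s₁.comp i)) :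
    ∃ τ : Loop M →ₙ+* L, Function.Bijective τ ∧
      ∀ x, i (j (τ x)) = β (Path.incl M (Loop.incl M x)) := by
  obtain ⟨α, hα, hα'⟩ := (Path.isShortExact_incl M).exists_bijective hi hβ fun b => by rw [h₀]
  obtain ⟨τ, hτ, hτ'⟩ := (Loop.isShortExact M).exists_bijective hj hα fun b => by
    rw [show (s₁.comp i) (α b) = Path.ev M b from (congrArg s₁ (hα' b)).trans (h₁ _)]
  exact ⟨τ, hτ, fun x => by rw [hτ', hα']⟩

/-- The induction step for `Ω^m (M_∞ A) ≅ M_∞ (Ω^m A)`. -/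
theorem exists_bijective_loop_comp {T M Q P L X : Type u} [NonUnitalRing T] [NonUnitalRing M]
    [NonUnitalRing Q] [NonUnitalRing P] [NonUnitalRing L] [NonUnitalRing X] {β : Poly M →ₙ+* Q}
    (hβ : Function.Bijective β) {s₀ s₁ : Q →ₙ+* M} (h₀ : ∀ p, s₀ (β p) = Poly.ev M 0 p)
    (h₁ : ∀ p, s₁ (β p) = Poly.ev M 1 p) {i : P →ₙ+* Q} {j : L →ₙ+* P} (hi : IsShortExact i s₀)
    (hj : IsShortExact j (s₁.comp i)) {τ : T →ₙ+* M} (hτ : Function.Bijective τ) (κ : X →ₙ+* T) :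
    ∃ σ : Loop T →ₙ+* L, Function.Bijective σ ∧ ∀ x, i (j (σ (Loop.map κ x))) =
      β (Poly.map (τ.comp κ) (Path.incl X (Loop.incl X x))) := by
  obtain ⟨σ, hσ, hσ'⟩ := exists_bijective_loop hβ h₀ h₁ hi hj
  refine ⟨σ.comp (Loop.map τ), hσ.comp (Loop.map_bijective hτ), fun x => (hσ' _).trans ?_⟩
  exact congrArg β (Poly.map_map κ τ _)

/-! ### Polynomials with matrix coefficients as matrices of polynomials -/

namespace FinMat

variable {B : Type u} [NonUnitalRing B]

theorem entry_sum {ι : Type*} (s : Finset ι) (f : ι → finiteMatrices B) (x y : ℕ) :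
    entry (∑ k ∈ s, f k) x y = ∑ k ∈ s, entry (f k) x y := by
  classical
  induction s using Finset.induction_on with
  | empty => rw [Finset.sum_empty, Finset.sum_empty, zero_entry]
  | insert a s ha ih => rw [Finset.sum_insert ha, Finset.sum_insert ha, add_entry, ih]

/-- The entries of matrices as additive maps. -/
noncomputable def entryHom (x y : ℕ) : finiteMatrices B →+ B where
  toFun a := entry a x y
  map_zero' := zero_entry x y
  map_add' a b := add_entry a b x y

/-- The isomorphism `(M_∞ B)[t] ≅ M_∞ (B[t])`. -/
noncomputable def ofPoly (B : Type u) [NonUnitalRing B] :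
    Poly (finiteMatrices B) →ₙ+* finiteMatrices (Poly B) := by
  have hb : ∀ p : Poly (finiteMatrices B), ∃ N M, ∀ n, ∀ x y, N ≤ n ∨ M ≤ x ∨ M ≤ y →
      entry (Poly.coeff n p) x y = 0 := by
    intro p
    obtain ⟨N, hN⟩ := Poly.exists_bound p
    choose M hM using fun n => exists_bound (Poly.coeff n p)
    refine ⟨N, (Finset.range N).sup M, fun n x y h => ?_⟩
    by_cases hn : N ≤ n
    · rw [hN n hn, zero_entry]
    · have := Finset.le_sup (f := M) (Finset.mem_range.2 (show n < N by omega))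
      exact hM n x y (by omega)
  have h1 : ∀ (p : Poly (finiteMatrices B)) (x y : ℕ), ∃ N, ∀ n, N ≤ n →
      entry (Poly.coeff n p) x y = 0 := fun p x y => by
    obtain ⟨N, M, h⟩ := hb p
    exact ⟨N, fun n hn => h n x y (Or.inl hn)⟩
  have h2 : ∀ p : Poly (finiteMatrices B), ∃ M, ∀ x y, M ≤ x ∨ M ≤ y →
      Poly.ofFun (fun n => entry (Poly.coeff n p) x y) (h1 p x y) = 0 := fun p => by
    obtain ⟨N, M, h⟩ := hb p
    refine ⟨M, fun x y hxy => Poly.ext fun n => ?_⟩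
    rw [Poly.coeff_ofFun, h n x y (Or.inr hxy), map_zero]
  exact
  { toFun := fun p => ofFun (fun x y => Poly.ofFun (fun n => entry (Poly.coeff n p) x y)
      (h1 p x y)) (h2 p)
    map_zero' := FinMat.ext fun x y => Poly.ext fun n => by
      rw [ofFun_entry, Poly.coeff_ofFun, map_zero, zero_entry, zero_entry, map_zero]
    map_add' := fun p q => FinMat.ext fun x y => Poly.ext fun n => by
      rw [add_entry, map_add, ofFun_entry, ofFun_entry, ofFun_entry, Poly.coeff_ofFun,
        Poly.coeff_ofFun, Poly.coeff_ofFun, map_add, add_entry]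
    map_mul' := fun p q => FinMat.ext fun x y => Poly.ext fun n => by
      obtain ⟨N, M, h⟩ := hb p
      have hp : ∀ m k, k ∉ Finset.range M → entry (Poly.coeff m p) x k = 0 := fun m k hk =>
        h m x k (Or.inr (Or.inr (by simpa using hk)))
      rw [mul_entry (s := Finset.range M) (fun k hk => Poly.ext fun m => by
        rw [ofFun_entry, Poly.coeff_ofFun, map_zero, hp m k hk]), map_sum, ofFun_entry,
        Poly.coeff_ofFun, Poly.coeff_mul, entry_sum]
      simp only [Poly.coeff_mul, ofFun_entry, Poly.coeff_ofFun]
      rw [Finset.sum_comm]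
      exact Finset.sum_congr rfl fun z _ => mul_entry (hp z.1) _ _ }

theorem coeff_entry_ofPoly (p : Poly (finiteMatrices B)) (x y n : ℕ) :
    Poly.coeff n (entry (ofPoly B p) x y) = entry (Poly.coeff n p) x y :=
  Poly.coeff_ofFun _ _ n

theorem ofPoly_bijective (B : Type u) [NonUnitalRing B] : Function.Bijective (ofPoly B) := by
  constructor
  · intro p q hpq
    refine Poly.ext fun n => FinMat.ext fun x y => ?_
    rw [← coeff_entry_ofPoly, hpq, coeff_entry_ofPoly]
  · intro a
    obtain ⟨M, hM⟩ := exists_bound a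
    choose N hN using fun x y => Poly.exists_bound (entry a x y)
    have h1 : ∀ n, ∃ M, ∀ x y, M ≤ x ∨ M ≤ y → Poly.coeff n (entry a x y) = 0 := fun n =>
      ⟨M, fun x y h => by rw [hM x y h, map_zero]⟩
    have h2 : ∃ K, ∀ n, K ≤ n → ofFun (fun x y => Poly.coeff n (entry a x y)) (h1 n) = 0 := by
      refine ⟨(Finset.range M ×ˢ Finset.range M).sup fun z => N z.1 z.2, fun n hn =>
        FinMat.ext fun x y => ?_⟩
      rw [ofFun_entry, zero_entry]
      by_cases h : M ≤ x ∨ M ≤ y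
      · rw [hM x y h, map_zero]
      · exact hN x y n ((Finset.le_sup (f := fun z : ℕ × ℕ => N z.1 z.2) (b := (x, y))
          (by simp; omega)).trans hn)
    refine ⟨Poly.ofFun _ h2, FinMat.ext fun x y => Poly.ext fun n => ?_⟩
    rw [coeff_entry_ofPoly, Poly.coeff_ofFun, ofFun_entry]

theorem map_ev_ofPoly (r : ℤ) (p : Poly (finiteMatrices B)) :
    map (Poly.ev B r) (ofPoly B p) = Poly.ev (finiteMatrices B) r p := by
  obtain ⟨N, hN⟩ := Poly.exists_bound p
  refine FinMat.ext fun x y => ?_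
  rw [map_entry, Poly.ev_eq_sum r hN, Poly.ev_eq_sum r (N := N) (fun n hn => by
    rw [coeff_entry_ofPoly, hN n hn, zero_entry])]
  refine Eq.trans ?_ (map_sum (entryHom x y) _ _).symm
  refine Finset.sum_congr rfl fun n _ => ?_
  rw [coeff_entry_ofPoly, map_zsmul]
  rfl

theorem ofPoly_map_corner (p : Poly B) : ofPoly B (Poly.map (corner B) p) = corner (Poly B) p := by
  refine FinMat.ext fun x y => Poly.ext fun n => ?_
  rw [coeff_entry_ofPoly, Poly.coeff_map, corner_entry, corner_entry, apply_ite (Poly.coeff n),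
    map_zero]

end FinMat

/-- The isomorphism `Ω^m (M_∞ A) ≅ M_∞ (Ω^m A)`. -/
theorem exists_loopIter_finiteMatrices (m : ℕ) (A : Rng.{u}) :
    ∃ τ : (loopIter m ⟨finiteMatrices A.carrier⟩).carrier →ₙ+*
        finiteMatrices (loopIter m A).carrier,
      Function.Bijective τ ∧ ∀ x, τ (loopIterMap m (B := ⟨finiteMatrices A.carrier⟩)
        (corner A.carrier) x) = corner (loopIter m A).carrier x := by
  induction m with
  | zero => exact ⟨NonUnitalRingHom.id _, Function.bijective_id, fun _ => rfl⟩
  | succ m ih =>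
    obtain ⟨τ, hτ, hτ'⟩ := ih
    have hi := Path.isShortExact_incl (loopIter m A).carrier
    have hj := Loop.isShortExact (loopIter m A).carrier
    have hj' := FinMat.isShortExact hj
    -- By exactness of `M_∞`, the ring `M_∞ (Ω^(m+1) A)` is cut out of `M_∞ ((Ω^m A)[t])` by the
    -- evaluations at `0` and `1`, just as loops are cut out of polynomials over `M_∞ (Ω^m A)`.
    obtain ⟨σ, hσ, hσ'⟩ := exists_bijective_loop_comp
      (FinMat.ofPoly_bijective (loopIter m A).carrier)
      (FinMat.map_ev_ofPoly 0) (FinMat.map_ev_ofPoly 1) (FinMat.isShortExact hi)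
      (L := finiteMatrices (loopIter (m + 1) A).carrier) (j := FinMat.map (Loop.incl _))
      ⟨hj'.inj, hj'.exact, hj'.surj⟩ hτ
      (loopIterMap m (B := ⟨finiteMatrices A.carrier⟩) (corner A.carrier))
    refine ⟨σ, hσ, fun x => hj'.inj ((FinMat.isShortExact hi).inj ((hσ' x).trans ?_))⟩
    have h : τ.comp (loopIterMap m (B := ⟨finiteMatrices A.carrier⟩) (corner A.carrier)) =
      corner (loopIter m A).carrier := NonUnitalRingHom.ext hτ'
    refine (congrArg (fun k => FinMat.ofPoly _ (Poly.map k _)) h).trans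
      ((FinMat.ofPoly_map_corner _).trans ?_)
    exact ((congrArg _ (FinMat.map_corner _ _)).trans (FinMat.map_corner _ _)).symm

/-! ### Elements of homotopy `K`-theory -/

/-- The groups `K₋ₚ (Ω^m A)`. -/
abbrev loopNegK (p m : ℕ) (A : Type u) [NonUnitalRing A] : Type u := negK p (loopIter m ⟨A⟩)

section API

variable {A B C : Type u} [NonUnitalRing A] [NonUnitalRing B] [NonUnitalRing C]

/-- Functoriality of `K₋ₚ (Ω^m A)`. -/
noncomputable def loopNegKMap (p m : ℕ) (f : A →ₙ+* B) : loopNegK p m A →+ loopNegK p m B :=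
  negKMap p (loopIterMap m (A := ⟨A⟩) (B := ⟨B⟩) f)

theorem loopNegKMap_map (p m : ℕ) (f : A →ₙ+* B) (g : B →ₙ+* C) (x : loopNegK p m A) :
    loopNegKMap p m g (loopNegKMap p m f x) = loopNegKMap p m (g.comp f) x := by
  refine (negKMap_map p _ _ x).trans ?_
  exact congrArg (fun k => negKMap p k x) (NonUnitalRingHom.ext fun y =>
    loopIterMap_map m (A := ⟨A⟩) (B := ⟨B⟩) (C := ⟨C⟩) f g y)

theorem loopNegKMap_id (p m : ℕ) (x : loopNegK p m A) :
    loopNegKMap p m (NonUnitalRingHom.id A) x = x := by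
  refine Eq.trans ?_ (negKMap_id p _ x)
  exact congrArg (fun k => negKMap p k x) (NonUnitalRingHom.ext fun y =>
    loopIterMap_id m ⟨A⟩ y)

theorem loopBoundary_map (p m : ℕ) (f : A →ₙ+* B) (x : loopNegK p m A) :
    loopBoundary p m ⟨B⟩ (loopNegKMap p m f x) =
      loopNegKMap (p + 1) (m + 1) f (loopBoundary p m ⟨A⟩ x) :=
  (loopBoundary_naturality p m (A := ⟨A⟩) (B := ⟨B⟩) f x).symm

theorem transition_self (a b : ℕ) (A : Rng.{u}) (i : ℕ) (x) :
    transition a b A i i le_rfl x = x := by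
  simp only [transition, Nat.leRec_self]
  rfl

theorem transition_succ (a b : ℕ) (A : Rng.{u}) (i j : ℕ) (h : i ≤ j) (x) :
    transition a b A i (j + 1) (h.trans (Nat.le_succ j)) x =
      loopBoundary (b + j) (a + j) A (transition a b A i j h x) := by
  simp only [transition, Nat.leRec_succ _ _ h]
  rfl

instance transition_directedSystem (a b : ℕ) (A : Rng.{u}) :
    DirectedSystem (fun k => negK (b + k) (loopIter (a + k) A))
      fun i j h => transition a b A i j h where
  map_self i x := transition_self a b A i x
  map_map k j i hij hjk x := by
    induction k, hjk using Nat.le_induction with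
    | base => exact transition_self a b A _ _
    | succ k hk ih =>
      rw [transition_succ a b A _ k hk, ih, transition_succ a b A _ k (hij.trans hk)]

/-- A class in `K₋ₚ (Ω^m A)` that vanishes in the colimit. -/
inductive LoopNegKNull (A : Type u) [NonUnitalRing A] : ∀ p m : ℕ, loopNegK p m A → Prop
  | zero (p m : ℕ) (x : loopNegK p m A) (h : x = 0) : LoopNegKNull A p m x
  | step (p m : ℕ) (x : loopNegK p m A)
      (h : LoopNegKNull A (p + 1) (m + 1) (loopBoundary p m ⟨A⟩ x)) : LoopNegKNull A p m x

/-- Vanishing at a later stage of the colimit is unwound into single boundary steps, so that diagram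
chases can proceed by induction with free indices `p` and `m`. -/
theorem LoopNegKNull.of_transition (a b i j : ℕ) (h : i ≤ j) (x)
    (hx : LoopNegKNull A (b + j) (a + j) (transition a b ⟨A⟩ i j h x)) :
    LoopNegKNull A (b + i) (a + i) x := by
  induction j, h using Nat.le_induction with
  | base => rwa [transition_self] at hx
  | succ j hj ih =>
    rw [transition_succ a b ⟨A⟩ i j hj] at hx
    exact ih (.step _ _ _ hx)

namespace KH

/-- The canonical maps to the colimit. -/
noncomputable def of (n : ℤ) (A : Type u) [NonUnitalRing A] (k : ℕ) :
    loopNegK ((-n).toNat + k) (n.toNat + k) A →+ KH n A :=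
  AddCommGroup.DirectLimit.of
    (fun k : ℕ => negK ((-n).toNat + k) (loopIter (n.toNat + k) ⟨A⟩))
    (transition n.toNat (-n).toNat ⟨A⟩) k

theorem of_transition (n : ℤ) {i j : ℕ} (h : i ≤ j)
    (x : loopNegK ((-n).toNat + i) (n.toNat + i) A) :
    of n A j (transition n.toNat (-n).toNat ⟨A⟩ i j h x) = of n A i x :=
  AddCommGroup.DirectLimit.of_f (f := transition n.toNat (-n).toNat ⟨A⟩) h x

theorem exists_of (n : ℤ) (z : KH n A) : ∃ k x, of n A k x = z :=
  AddCommGroup.DirectLimit.induction_on (f := transition n.toNat (-n).toNat ⟨A⟩)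
    (C := fun z : KH n A => ∃ k x, of n A k x = z) z fun k x => ⟨k, x, rfl⟩

theorem exists_transition_eq_zero (n : ℤ) {k : ℕ} {x : loopNegK ((-n).toNat + k) (n.toNat + k) A}
    (hx : of n A k x = 0) :
    ∃ j h, transition n.toNat (-n).toNat ⟨A⟩ k j h x = 0 :=
  AddCommGroup.DirectLimit.of.zero_exact (f := transition n.toNat (-n).toNat ⟨A⟩) k x hx

theorem map_of (n : ℤ) (f : A →ₙ+* B) (k : ℕ) (x : loopNegK ((-n).toNat + k) (n.toNat + k) A) :
    KH.map n f (of n A k x) = of n B k (loopNegKMap _ _ f x) :=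
  AddCommGroup.DirectLimit.map_apply_of (f := transition n.toNat (-n).toNat ⟨A⟩) _ _ x

/-- The identification of `K₋ₚ (Ω^m A)` with `K₋q (Ω^l A)` for `p = q` and `m = l`. -/
noncomputable def castHom (A : Type u) [NonUnitalRing A] {p q m l : ℕ} (h : p = q) (h' : m = l) :
    loopNegK p m A →+ loopNegK q l A :=
  h ▸ h' ▸ AddMonoidHom.id _

/-- The canonical map `K₋ₚ (Ω^m A) → KH_n A` for `m = n + p`. -/
noncomputable def cls (n : ℤ) (p m : ℕ) (h : (m : ℤ) = n + p) : loopNegK p m A →+ KH n A :=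
  (of n A (p - (-n).toNat)).comp
      (castHom A (show p = (-n).toNat + (p - (-n).toNat) by omega)
        (show m = n.toNat + (p - (-n).toNat) by omega))

theorem cls_add (n : ℤ) (k : ℕ) (h : ((n.toNat + k : ℕ) : ℤ) = n + ((-n).toNat + k : ℕ))
    (x : loopNegK ((-n).toNat + k) (n.toNat + k) A) :
    cls n ((-n).toNat + k) (n.toNat + k) h x = of n A k x := by
  have key : ∀ l (h1 : (-n).toNat + k = (-n).toNat + l) (h2 : n.toNat + k = n.toNat + l),
      of n A l (castHom A h1 h2 x) = of n A k x := by
    intro l h1 h2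
    obtain rfl : k = l := by omega
    rfl
  exact key _ _ _

theorem exists_index {n : ℤ} {p m : ℕ} (h : (m : ℤ) = n + p) :
    ∃ k, p = (-n).toNat + k ∧ m = n.toNat + k :=
  ⟨p - (-n).toNat, by omega, by omega⟩

theorem cls_loopBoundary (n : ℤ) (p m : ℕ) (h : (m : ℤ) = n + p)
    (h' : ((m + 1 : ℕ) : ℤ) = n + (p + 1 : ℕ)) (x : loopNegK p m A) :
    cls n (p + 1) (m + 1) h' (loopBoundary p m ⟨A⟩ x) = cls n p m h x := by
  obtain ⟨k, rfl, rfl⟩ := exists_index h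
  rw [cls_add]
  refine (cls_add n (k + 1) h' _).trans ?_
  rw [← of_transition n (Nat.le_succ k)]
  congr 1
  refine Eq.trans ?_ (transition_succ n.toNat (-n).toNat ⟨A⟩ k k le_rfl x).symm
  rw [transition_self]

theorem map_cls (n : ℤ) (p m : ℕ) (h : (m : ℤ) = n + p) (f : A →ₙ+* B) (x : loopNegK p m A) :
    KH.map n f (cls n p m h x) = cls n p m h (loopNegKMap p m f x) := by
  obtain ⟨k, rfl, rfl⟩ := exists_index h
  rw [cls_add, cls_add, map_of]

theorem exists_cls (n : ℤ) (z : KH n A) : ∃ p m h x, cls n p m h x = z := by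
  obtain ⟨k, x, rfl⟩ := exists_of n z
  exact ⟨(-n).toNat + k, n.toNat + k, by omega, x, cls_add _ _ _ _⟩

/-- One transition map makes `p` positive. This is needed at `KH_n A`, since exactness at `K₋ₚ A`
involves a boundary map from `K₋ₚ₊₁ C`, available only for `p ≥ 1`. -/
theorem exists_cls_succ (n : ℤ) (z : KH n A) : ∃ p m h x, cls n (p + 1) m h x = z := by
  obtain ⟨p, m, h, x, rfl⟩ := exists_cls n z
  exact ⟨p, m + 1, by omega, loopBoundary p m ⟨A⟩ x, cls_loopBoundary _ _ _ _ _ _⟩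

theorem loopNegKNull_of_cls_eq_zero {n : ℤ} {p m : ℕ} {h : (m : ℤ) = n + p} {x : loopNegK p m A}
    (hx : cls n p m h x = 0) : LoopNegKNull A p m x := by
  obtain ⟨k, rfl, rfl⟩ := exists_index h
  rw [cls_add] at hx
  obtain ⟨j, hj, hx⟩ := exists_transition_eq_zero n hx
  exact .of_transition _ _ _ j hj x (.zero _ _ _ hx)

/-- Homomorphisms out of `KH_n A`. -/
theorem exists_lift (n : ℤ) {G : Type*} [AddCommGroup G]
    (φ : ∀ p m : ℕ, (m : ℤ) = n + (p : ℤ) → (loopNegK p m A →+ G))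
    (hφ : ∀ (p m : ℕ) (h : (m : ℤ) = n + p) (h' : ((m + 1 : ℕ) : ℤ) = n + (p + 1 : ℕ)) x,
      φ (p + 1) (m + 1) h' (loopBoundary p m ⟨A⟩ x) = φ p m h x) :
    ∃ ψ : KH n A →+ G, ∀ (p m : ℕ) (h : (m : ℤ) = n + p) x, ψ (cls n p m h x) = φ p m h x := by
  have hk : ∀ k : ℕ, ((n.toNat + k : ℕ) : ℤ) = n + ((-n).toNat + k : ℕ) := fun k => by omega
  have H : ∀ i j hij x, φ _ _ (hk j) (transition n.toNat (-n).toNat ⟨A⟩ i j hij x) =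
      φ _ _ (hk i) x := by
    intro i j hij x
    induction j, hij using Nat.le_induction with
    | base => rw [transition_self]
    | succ j hij ih =>
      rw [← ih, transition_succ _ _ _ _ _ hij]
      exact hφ _ _ _ _ _
  refine ⟨AddCommGroup.DirectLimit.lift _ (transition n.toNat (-n).toNat ⟨A⟩) G
    (fun k => φ _ _ (hk k)) H, fun p m h x => ?_⟩
  obtain ⟨k, rfl, rfl⟩ := exists_index h
  rw [cls_add]
  exact AddCommGroup.DirectLimit.lift_of G (fun k => φ _ _ (hk k)) H k x

theorem map_map (n : ℤ) (f : A →ₙ+* B) (g : B →ₙ+* C) (z : KH n A) :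
    KH.map n g (KH.map n f z) = KH.map n (g.comp f) z := by
  obtain ⟨p, m, h, x, rfl⟩ := exists_cls n z
  rw [map_cls, map_cls, map_cls, loopNegKMap_map]

theorem map_id (n : ℤ) (z : KH n A) : KH.map n (NonUnitalRingHom.id A) z = z := by
  obtain ⟨p, m, h, x, rfl⟩ := exists_cls n z
  rw [map_cls, loopNegKMap_id]

end KH

end API

/-! ### Excision -/

section Excision

variable {A B C : Type u} [NonUnitalRing A] [NonUnitalRing B] [NonUnitalRing C]
  {f : A →ₙ+* B} {g : B →ₙ+* C}

/-- The boundary map `K₋ₚ (Ω^m C) → K₋ₚ₋₁ (Ω^m A)`. -/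
noncomputable def loopNegKBoundary (p m : ℕ) (h : IsShortExact f g) :
    loopNegK p m C →+ loopNegK (p + 1) m A :=
  negKBoundary p (loopIter_isShortExact m (A := ⟨A⟩) (B := ⟨B⟩) (C := ⟨C⟩) h)

/-- This is the `3 × 3` statement for the path extensions of `Ω^m A`, `Ω^m B` and `Ω^m C`, all
suspended `p` times. -/
theorem loopNegKBoundary_loopBoundary (p m : ℕ) (h : IsShortExact f g) (x : loopNegK p m C) :
    loopNegKBoundary (p + 1) (m + 1) h (loopBoundary p m ⟨C⟩ x) =
      -loopBoundary (p + 1) m ⟨A⟩ (loopNegKBoundary p m h x) := by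
  have H := loopIter_isShortExact m (A := ⟨A⟩) (B := ⟨B⟩) (C := ⟨C⟩) h
  have hP := Path.isShortExact H
  have e₁ : ∀ x, loopIterMap m (A := ⟨B⟩) (B := ⟨C⟩) g (Path.ev _ x) = Path.ev _ (Path.map _ x) :=
    fun x => (Path.ev_map _ x).symm
  have e₂ : ∀ x, loopIterMap m (A := ⟨A⟩) (B := ⟨B⟩) f (Path.ev _ x) = Path.ev _ (Path.map _ x) :=
    fun x => (Path.ev_map _ x).symm
  have hs : ∀ {X Y Z W : Rng.{u}} (f : X.carrier →ₙ+* Y.carrier) (g : Y.carrier →ₙ+* Z.carrier)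
      (f' : X.carrier →ₙ+* W.carrier) (g' : W.carrier →ₙ+* Z.carrier)
      (_ : ∀ x, g (f x) = g' (f' x)) (x : (suspIter p X).carrier),
      suspIterMap p g (suspIterMap p f x) = suspIterMap p g' (suspIterMap p f' x) := by
    intro X Y Z W f g f' g' hfg x
    rw [suspIterMap_map, suspIterMap_map]
    exact congrArg (fun k => suspIterMap p k x) (NonUnitalRingHom.ext hfg)
  refine boundary_boundary
    (suspIter_isShortExact p (A := loopIter (m + 1) ⟨A⟩) (B := ⟨Path (loopIter m ⟨A⟩).carrier⟩)
      (C := loopIter m ⟨A⟩) (Loop.isShortExact _))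
    (suspIter_isShortExact p (A := loopIter (m + 1) ⟨B⟩) (B := ⟨Path (loopIter m ⟨B⟩).carrier⟩)
      (C := loopIter m ⟨B⟩) (Loop.isShortExact _))
    (suspIter_isShortExact p (A := loopIter (m + 1) ⟨C⟩) (B := ⟨Path (loopIter m ⟨C⟩).carrier⟩)
      (C := loopIter m ⟨C⟩) (Loop.isShortExact _))
    (suspIter_isShortExact p (loopIter_isShortExact (m + 1) (A := ⟨A⟩) (B := ⟨B⟩) (C := ⟨C⟩) h))
    (suspIter_isShortExact p (A := ⟨Path (loopIter m ⟨A⟩).carrier⟩)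
      (B := ⟨Path (loopIter m ⟨B⟩).carrier⟩) (C := ⟨Path (loopIter m ⟨C⟩).carrier⟩) hP)
    (suspIter_isShortExact p H)
    (hs (X := loopIter (m + 1) ⟨A⟩) (Y := ⟨Path (loopIter m ⟨A⟩).carrier⟩)
      (Z := ⟨Path (loopIter m ⟨B⟩).carrier⟩) (W := loopIter (m + 1) ⟨B⟩) _ _ _ _ fun _ => rfl)
    (hs (X := loopIter (m + 1) ⟨B⟩) (Y := ⟨Path (loopIter m ⟨B⟩).carrier⟩)
      (Z := ⟨Path (loopIter m ⟨C⟩).carrier⟩) (W := loopIter (m + 1) ⟨C⟩) _ _ _ _ fun _ => rfl)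
    (hs (X := ⟨Path (loopIter m ⟨A⟩).carrier⟩) (Y := loopIter m ⟨A⟩)
      (Z := loopIter m ⟨B⟩) (W := ⟨Path (loopIter m ⟨B⟩).carrier⟩) _ _ _ _ e₂)
    (hs (X := ⟨Path (loopIter m ⟨B⟩).carrier⟩) (Y := loopIter m ⟨B⟩)
      (Z := loopIter m ⟨C⟩) (W := ⟨Path (loopIter m ⟨C⟩).carrier⟩) _ _ _ _ e₁) x

end Excision

namespace KH

/-! ### The connecting homomorphism and the long exact sequence -/

section Excision

variable {A B C : Type u} [NonUnitalRing A] [NonUnitalRing B] [NonUnitalRing C]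
  {f : A →ₙ+* B} {g : B →ₙ+* C}

/-- The boundary maps at the finite stages anticommute with the transition maps, which raise `p` by
one; the sign `(-1)^p` makes them compatible. -/
theorem exists_delta (n : ℤ) (h : IsShortExact f g) :
    ∃ δ : KH (n + 1) C →+ KH n A, ∀ (p m : ℕ) (hm : (m : ℤ) = n + 1 + p)
      (hm' : (m : ℤ) = n + (p + 1 : ℕ)) (x : loopNegK p m C), δ (cls (n + 1) p m hm x) =
        (-1 : ℤ) ^ p • cls n (p + 1) m hm' (loopNegKBoundary p m h x) := by
  have hidx : ∀ p m : ℕ, (m : ℤ) = n + 1 + p → (m : ℤ) = n + (p + 1 : ℕ) := fun p m hm => by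
    push_cast
    omega
  obtain ⟨δ, hδ⟩ := exists_lift (A := C) (n + 1) (G := KH n A)
    (fun p m hm => ((-1 : ℤ) ^ p) • ((cls n (p + 1) m (hidx p m hm)).comp
      (loopNegKBoundary p m h))) fun p m hm hm' x => by
      simp only [AddMonoidHom.smul_apply, AddMonoidHom.comp_apply]
      rw [loopNegKBoundary_loopBoundary, map_neg, smul_neg, pow_succ, mul_neg_one, neg_smul,
        neg_neg, cls_loopBoundary n (p + 1) m (hidx p m hm)]
  exact ⟨δ, fun p m hm hm' x => hδ p m hm x⟩

/-- The connecting homomorphism `KH_{n+1} C → KH_n A`. -/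
noncomputable def delta (n : ℤ) (h : IsShortExact f g) : KH (n + 1) C →+ KH n A :=
  (exists_delta n h).choose

theorem delta_cls (n : ℤ) (h : IsShortExact f g) (p m : ℕ) (hm : (m : ℤ) = n + 1 + p)
    (hm' : (m : ℤ) = n + (p + 1 : ℕ)) (x : loopNegK p m C) : delta n h (cls (n + 1) p m hm x) =
      (-1 : ℤ) ^ p • cls n (p + 1) m hm' (loopNegKBoundary p m h x) :=
  (exists_delta n h).choose_spec p m hm hm' x

theorem delta_naturality {A' B' C' : Type u} [NonUnitalRing A'] [NonUnitalRing B']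
    [NonUnitalRing C'] {f' : A' →ₙ+* B'} {g' : B' →ₙ+* C'} (n : ℤ) (h : IsShortExact f g)
    (h' : IsShortExact f' g') (α : A →ₙ+* A') (β : B →ₙ+* B') (γ : C →ₙ+* C')
    (h1 : ∀ a, β (f a) = f' (α a)) (h2 : ∀ b, γ (g b) = g' (β b)) (z : KH (n + 1) C) :
    KH.map n α (delta n h z) = delta n h' (KH.map (n + 1) γ z) := by
  obtain ⟨p, m, hm, x, rfl⟩ := exists_cls (n + 1) z
  have hm' : (m : ℤ) = n + (p + 1 : ℕ) := by
    push_cast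
    omega
  rw [map_cls, delta_cls n h p m hm hm', delta_cls n h' p m hm hm', map_zsmul, map_cls]
  congr 2
  refine negKBoundary_naturality p (loopIter_isShortExact m (A := ⟨A⟩) (B := ⟨B⟩) (C := ⟨C⟩) h)
    (loopIter_isShortExact m (A := ⟨A'⟩) (B := ⟨B'⟩) (C := ⟨C'⟩) h')
    (loopIterMap m (A := ⟨A⟩) (B := ⟨A'⟩) α) (loopIterMap m (A := ⟨B⟩) (B := ⟨B'⟩) β)
    (loopIterMap m (A := ⟨C⟩) (B := ⟨C'⟩) γ) (fun y => ?_) (fun y => ?_) x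
  · rw [loopIterMap_map, loopIterMap_map]
    exact congrArg (fun k => loopIterMap m k y) (NonUnitalRingHom.ext h1)
  · rw [loopIterMap_map, loopIterMap_map]
    exact congrArg (fun k => loopIterMap m k y) (NonUnitalRingHom.ext h2)

/-- If the image of `x` vanishes only at a later stage, replace `x` by its images under the
transition maps until it vanishes outright, then use exactness of `K₋ₚ` for `Ω^m` of the sequence.
-/
theorem map_exact (n : ℤ) (h : IsShortExact f g) : Function.Exact (KH.map n f) (KH.map n g) := by
  have key : ∀ p m (y : loopNegK p m C), LoopNegKNull C p m y → ∀ (hm : (m : ℤ) = n + p) x,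
      loopNegKMap p m g x = y → ∃ w, KH.map n f w = cls n p m hm x := by
    intro p m y hy
    induction hy with
    | zero p m y hy =>
      rintro hm x rfl
      obtain ⟨w, rfl⟩ := negKMap_exact p
        (loopIter_isShortExact m (A := ⟨A⟩) (B := ⟨B⟩) (C := ⟨C⟩) h) hy
      exact ⟨cls n p m hm w, map_cls _ _ _ _ _ _⟩
    | step p m y _ ih =>
      rintro hm x rfl
      have hm' : ((m + 1 : ℕ) : ℤ) = n + (p + 1 : ℕ) := by
        push_cast
        omega
      obtain ⟨w, hw⟩ := ih hm' (loopBoundary p m ⟨B⟩ x) (loopBoundary_map p m g x).symm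
      exact ⟨w, by rw [hw, cls_loopBoundary n p m hm]⟩
  intro z
  constructor
  · intro hz
    obtain ⟨p, m, hm, x, rfl⟩ := exists_cls n z
    rw [map_cls] at hz
    exact key p m _ (loopNegKNull_of_cls_eq_zero hz) hm x rfl
  · rintro ⟨w, rfl⟩
    obtain ⟨p, m, hm, x, rfl⟩ := exists_cls n w
    rw [map_cls, map_cls, show loopNegKMap p m g (loopNegKMap p m f x) = 0 from
      negKMap_map_eq_zero p (loopIter_isShortExact m (A := ⟨A⟩) (B := ⟨B⟩) (C := ⟨C⟩) h) x,
      map_zero]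

theorem exact_map_delta (n : ℤ) (h : IsShortExact f g) :
    Function.Exact (KH.map (n + 1) g) (delta n h) := by
  -- The class to be tracked is a boundary, hence in degree `q + 1`; the index `p` is kept free for
  -- the induction, and the equality of classes becomes heterogeneous.
  have key : ∀ p m (y : loopNegK p m A), LoopNegKNull A p m y → ∀ q, p = q + 1 →
      ∀ (hm : (m : ℤ) = n + 1 + q) (x : loopNegK q m C), HEq (loopNegKBoundary q m h x) y →
      ∃ w, KH.map (n + 1) g w = cls (n + 1) q m hm x := by
    intro p m y hy
    induction hy with
    | zero p m y hy =>
      rintro q rfl hm x hx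
      obtain rfl := eq_of_heq hx
      obtain ⟨w, rfl⟩ := negKBoundary_exact q
        (loopIter_isShortExact m (A := ⟨A⟩) (B := ⟨B⟩) (C := ⟨C⟩) h) hy
      exact ⟨cls (n + 1) q m hm w, map_cls _ _ _ _ _ _⟩
    | step p m y _ ih =>
      rintro q rfl hm x hx
      obtain rfl := eq_of_heq hx
      have hm' : ((m + 1 : ℕ) : ℤ) = n + 1 + (q + 1 : ℕ) := by
        push_cast
        omega
      -- The minus sign cancels the one from anticommutation.
      obtain ⟨w, hw⟩ := ih (q + 1) rfl hm' (-loopBoundary q m ⟨C⟩ x) (by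
        rw [map_neg, loopNegKBoundary_loopBoundary, neg_neg])
      exact ⟨-w, by rw [map_neg, hw, map_neg, neg_neg, cls_loopBoundary (n + 1) q m hm]⟩
  intro z
  constructor
  · intro hz
    obtain ⟨p, m, hm, x, rfl⟩ := exists_cls (n + 1) z
    have hm' : (m : ℤ) = n + (p + 1 : ℕ) := by
      push_cast
      omega
    rw [delta_cls n h p m hm hm'] at hz
    have hz' : cls n (p + 1) m hm' (loopNegKBoundary p m h x) = 0 := by
      have := congrArg (fun w => (-1 : ℤ) ^ p • w) hz
      simpa [← mul_smul, ← mul_pow] using this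
    exact key _ m _ (loopNegKNull_of_cls_eq_zero hz') p rfl hm x HEq.rfl
  · rintro ⟨w, rfl⟩
    obtain ⟨p, m, hm, x, rfl⟩ := exists_cls (n + 1) w
    have hm' : (m : ℤ) = n + (p + 1 : ℕ) := by
      push_cast
      omega
    rw [map_cls, delta_cls n h p m hm hm',
      show loopNegKBoundary p m h (loopNegKMap p m g x) = 0 from
      negKBoundary_map p (loopIter_isShortExact m (A := ⟨A⟩) (B := ⟨B⟩) (C := ⟨C⟩) h) x,
      map_zero, smul_zero]

theorem exact_delta_map (n : ℤ) (h : IsShortExact f g) :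
    Function.Exact (delta n h) (KH.map n f) := by
  -- Positivity of `p` is needed to lift through a boundary map, and it persists along the
  -- transition maps.
  have key : ∀ p m (y : loopNegK p m B), LoopNegKNull B p m y → p ≠ 0 →
      ∀ (hm : (m : ℤ) = n + p) x, loopNegKMap p m f x = y → ∃ w, delta n h w = cls n p m hm x := by
    intro p m y hy
    induction hy with
    | zero p m y hy =>
      rintro hp hm x rfl
      obtain ⟨q, rfl⟩ := Nat.exists_eq_succ_of_ne_zero hp
      have hm' : (m : ℤ) = n + 1 + q := by
        push_cast at hm
        omega
      obtain ⟨w, rfl⟩ := exists_negKBoundary_eq q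
        (loopIter_isShortExact m (A := ⟨A⟩) (B := ⟨B⟩) (C := ⟨C⟩) h) hy
      refine ⟨(-1 : ℤ) ^ q • cls (n + 1) q m hm' w, ?_⟩
      rw [map_zsmul, delta_cls n h q m hm' hm, ← mul_smul, ← mul_pow, neg_one_mul, neg_neg,
        one_pow, one_smul]
      rfl
    | step p m y _ ih =>
      rintro hp hm x rfl
      have hm' : ((m + 1 : ℕ) : ℤ) = n + (p + 1 : ℕ) := by
        push_cast
        omega
      obtain ⟨w, hw⟩ := ih (Nat.succ_ne_zero p) hm' (loopBoundary p m ⟨A⟩ x)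
        (loopBoundary_map p m f x).symm
      exact ⟨w, by rw [hw, cls_loopBoundary n p m hm]⟩
  intro z
  constructor
  · intro hz
    obtain ⟨p, m, hm, x, rfl⟩ := exists_cls_succ n z
    rw [map_cls] at hz
    exact key _ m _ (loopNegKNull_of_cls_eq_zero hz) (Nat.succ_ne_zero p) hm x rfl
  · rintro ⟨w, rfl⟩
    obtain ⟨p, m, hm, x, rfl⟩ := exists_cls (n + 1) w
    have hm' : (m : ℤ) = n + (p + 1 : ℕ) := by
      push_cast
      omega
    rw [delta_cls n h p m hm hm', map_zsmul, map_cls,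
      show loopNegKMap (p + 1) m f (loopNegKBoundary p m h x) = 0 from
        negKMap_boundary p (loopIter_isShortExact m (A := ⟨A⟩) (B := ⟨B⟩) (C := ⟨C⟩) h) x,
      map_zero, smul_zero]

/-- Injectivity in degree `n` uses `KH_n A = 0`, and surjectivity uses `KH_{n-1} A = 0`. -/
theorem map_bijective_of_kernel (h : IsShortExact f g) (hA : ∀ n (z : KH n A), z = 0) (n : ℤ) :
    Function.Bijective (KH.map n g) := by
  constructor
  · rw [injective_iff_map_eq_zero]
    intro z hz
    obtain ⟨w, rfl⟩ := (map_exact n h z).1 hz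
    rw [hA n w, map_zero]
  · obtain ⟨k, rfl⟩ : ∃ k, n = k + 1 := ⟨n - 1, by omega⟩
    intro z
    exact (exact_map_delta k h z).1 (hA k _)

end Excision

/-! ### Contractible rings and homotopy invariance -/

/-- A section of evaluation at `1` on `A` yields one on `Ω^m A`, so every class of `K₋ₚ (Ω^m A)`
comes from `P (Ω^m A)`. The transition map is the boundary map of the path extension, hence zero on
such classes. -/
theorem eq_zero_of_contractible {A : Type u} [NonUnitalRing A] (μ : A →ₙ+* Path A)
    (hμ : ∀ x, Path.ev A (μ x) = x) (n : ℤ) (z : KH n A) : z = 0 := by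
  obtain ⟨p, m, hm, x, rfl⟩ := exists_cls n z
  have hm' : ((m + 1 : ℕ) : ℤ) = n + (p + 1 : ℕ) := by
    push_cast
    omega
  rw [← cls_loopBoundary n p m hm hm']
  obtain ⟨θ, hθ⟩ := exists_loopIter_path m ⟨A⟩
  have hx : negKMap p (A := ⟨Path (loopIter m ⟨A⟩).carrier⟩) (B := loopIter m ⟨A⟩) (Path.ev _)
      (negKMap p (A := loopIter m ⟨A⟩) (θ.comp (loopIterMap m (A := ⟨A⟩) (B := ⟨Path A⟩) μ)) x) =
      x := by
    rw [negKMap_map]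
    refine Eq.trans ?_ (negKMap_id p _ x)
    refine congrArg (fun k => negKMap p k x) (NonUnitalRingHom.ext fun y => ?_)
    refine (hθ _).trans ((loopIterMap_map m (A := ⟨A⟩) (B := ⟨Path A⟩) (C := ⟨A⟩) μ _ y).trans ?_)
    refine Eq.trans ?_ (loopIterMap_id m ⟨A⟩ y)
    exact congrArg (fun k => loopIterMap m (A := ⟨A⟩) (B := ⟨A⟩) k y) (NonUnitalRingHom.ext hμ)
  have h0 : loopBoundary p m ⟨A⟩ x = 0 := by
    rw [← hx]
    exact negKBoundary_map p (A := loopIter (m + 1) ⟨A⟩) (B := ⟨Path (loopIter m ⟨A⟩).carrier⟩)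
      (C := loopIter m ⟨A⟩) (Loop.isShortExact _) _
  rw [h0, map_zero]

theorem path_eq_zero (A : Type u) [NonUnitalRing A] (n : ℤ) (z : KH n (Path A)) : z = 0 := by
  obtain ⟨μ, hμ⟩ := exists_path_path_aux (Path.isShortExact_incl A)
  exact eq_zero_of_contractible μ hμ n z

/-- The constants are a section of evaluation at `0`, whose kernel `P A` is contractible; excision
makes the evaluation an isomorphism on `KH_n`. -/
theorem map_const_bijective (n : ℤ) (A : Type u) [NonUnitalRing A] :
    Function.Bijective (KH.map n (Poly.const A)) := by
  have h := map_bijective_of_kernel (Path.isShortExact_incl A) (path_eq_zero A) n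
  refine (Function.Bijective.of_comp_iff' h _).1 ?_
  have hid : KH.map n (Poly.ev A 0) ∘ KH.map n (Poly.const A) = id := by
    funext z
    refine (map_map n _ _ z).trans ?_
    rw [show (Poly.ev A 0).comp (Poly.const A) = NonUnitalRingHom.id A from
      NonUnitalRingHom.ext (Poly.ev_const 0), map_id]
    rfl
  rw [hid]
  exact Function.bijective_id

/-! ### Nilinvariance -/

/-- Left multiplication. -/
def leftMul (A : Type u) [NonUnitalRing A] : A →ₙ+* AddMonoid.End A where
  toFun a := AddMonoidHom.mulLeft a
  map_zero' := by
    ext b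
    exact zero_mul b
  map_add' a b := by
    ext c
    exact add_mul a b c
  map_mul' a b := by
    ext c
    exact mul_assoc a b c

theorem foldl_map_mul {A B : Type*} [NonUnitalRing A] [NonUnitalRing B] (f : A →ₙ+* B)
    (l : List A) (a : A) : (l.map f).foldl (· * ·) (f a) = f (l.foldl (· * ·) a) := by
  induction l generalizing a with
  | nil => rfl
  | cons b l ih => simpa using ih (a * b)

/-- Divide by `I`, the elements `a` with `a A = 0`. Multiplication on `I` is zero, so `I` is
contractible. The quotient is the image of `A` in its additive endomorphisms, where shorter products
vanish already: a product acts on `b` as the same product in `A` with one more factor `b`. -/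
theorem eq_zero_of_isNilpotentRing (N : ℕ) : ∀ (A : Type u) [NonUnitalRing A],
    (∀ (a : A) (l : List A), l.length = N → l.foldl (· * ·) a = 0) → ∀ (n : ℤ) (z : KH n A),
      z = 0 := by
  induction N with
  | zero =>
    intro A _ hA
    obtain ⟨μ, hμ⟩ := exists_path_of_mul_eq_zero (A := A) fun a b => hA (a * b) [] rfl
    exact eq_zero_of_contractible μ hμ
  | succ N ih =>
    intro A _ hA n z
    let I := kernel (leftMul A)
    let Q := NonUnitalRingHom.range (leftMul A)
    let i : I →ₙ+* A := NonUnitalSubringClass.subtype I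
    let π : A →ₙ+* Q := (leftMul A).rangeRestrict
    have hπ : Function.Surjective π := (leftMul A).rangeRestrict_surjective
    have h : IsShortExact i π :=
      { inj := Subtype.val_injective
        exact := fun b => ⟨fun hb => ⟨⟨b, congrArg Subtype.val hb⟩, rfl⟩, by
          rintro ⟨a, rfl⟩
          exact Subtype.ext a.2⟩
        surj := hπ }
    have hI : ∀ (n : ℤ) (z : KH n I), z = 0 := by
      obtain ⟨μ, hμ⟩ := exists_path_of_mul_eq_zero (A := I) fun a b =>
        Subtype.ext (DFunLike.congr_fun (mem_kernel.1 a.2) b.1)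
      exact eq_zero_of_contractible μ hμ
    refine (map_bijective_of_kernel h hI n).1 ((ih Q ?_ n _).trans (map_zero _).symm)
    intro a l hl
    obtain ⟨a, rfl⟩ := hπ a
    obtain ⟨l, rfl⟩ := hπ.list_map l
    rw [foldl_map_mul]
    refine Subtype.ext (AddMonoidHom.ext fun b => ?_)
    have := hA a (l ++ [b]) (by simpa using hl)
    rw [List.foldl_append] at this
    exact this

/-! ### Stability -/

/-- A colimit of isomorphisms is an isomorphism; for injectivity, vanishing in the colimit is traced
back step by step to a finite stage. -/
theorem map_bijective_of_loopNegKMap {A B : Type u} [NonUnitalRing A] [NonUnitalRing B]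
    {f : A →ₙ+* B} (hf : ∀ p m, Function.Bijective (loopNegKMap p m f)) (n : ℤ) :
    Function.Bijective (KH.map n f) := by
  constructor
  · have key : ∀ p m (y : loopNegK p m B), LoopNegKNull B p m y → ∀ (hm : (m : ℤ) = n + p) x,
        loopNegKMap p m f x = y → cls n p m hm x = 0 := by
      intro p m y hy
      induction hy with
      | zero p m y hy =>
        rintro hm x rfl
        rw [(injective_iff_map_eq_zero _).1 (hf p m).1 x hy, map_zero]
      | step p m y _ ih =>
        rintro hm x rfl
        have hm' : ((m + 1 : ℕ) : ℤ) = n + (p + 1 : ℕ) := by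
          push_cast
          omega
        rw [← cls_loopBoundary n p m hm hm']
        exact ih hm' _ (loopBoundary_map p m f x).symm
    rw [injective_iff_map_eq_zero]
    intro z hz
    obtain ⟨p, m, hm, x, rfl⟩ := exists_cls n z
    rw [map_cls] at hz
    exact key p m _ (loopNegKNull_of_cls_eq_zero hz) hm x rfl
  · intro z
    obtain ⟨p, m, hm, x, rfl⟩ := exists_cls n z
    obtain ⟨y, rfl⟩ := (hf p m).2 x
    exact ⟨cls n p m hm y, map_cls _ _ _ _ _ _⟩

/-- The isomorphism `Ω^m (M_∞ A) ≅ M_∞ (Ω^m A)` carries `Ω^m` of the corner of `A` to the corner of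
`Ω^m A`, so stability of `K₋ₚ` for `Ω^m A` applies at every stage. -/
theorem map_corner_bijective (n : ℤ) (A : Type u) [NonUnitalRing A] :
    Function.Bijective (KH.map n (corner A)) := by
  refine map_bijective_of_loopNegKMap (fun p m => ?_) n
  obtain ⟨τ, hτ, hτ'⟩ := exists_loopIter_finiteMatrices m ⟨A⟩
  have h := negKMap_bijective p (A := loopIter m ⟨finiteMatrices A⟩)
    (B := ⟨finiteMatrices (loopIter m ⟨A⟩).carrier⟩) hτ
  refine (Function.Bijective.of_comp_iff' h _).1 ?_
  have hcomp : negKMap p (A := loopIter m ⟨finiteMatrices A⟩)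
      (B := ⟨finiteMatrices (loopIter m ⟨A⟩).carrier⟩) τ ∘ loopNegKMap p m (corner A) =
      negKMap p (A := loopIter m ⟨A⟩) (B := ⟨finiteMatrices (loopIter m ⟨A⟩).carrier⟩)
        (corner (loopIter m ⟨A⟩).carrier) := by
    funext x
    refine (negKMap_map p (A := loopIter m ⟨A⟩) (B := loopIter m ⟨finiteMatrices A⟩)
      (C := ⟨finiteMatrices (loopIter m ⟨A⟩).carrier⟩) _ _ x).trans ?_
    exact congrArg (fun k => negKMap p (A := loopIter m ⟨A⟩)
      (B := ⟨finiteMatrices (loopIter m ⟨A⟩).carrier⟩) k x) (NonUnitalRingHom.ext hτ')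
  rw [hcomp]
  exact negKMap_corner_bijective p (loopIter m ⟨A⟩)

end KH

end HomotopyK

/-- Homotopy `K`-theory is homotopy invariant, nilinvariant, `M_∞`-stable and satisfies excision. -/
theorem mainTheorem9 :
    -- homotopy invariance: `A → A[t]` induces an isomorphism
    (∀ (n : ℤ) (A : Type u) [NonUnitalRing A],
      Function.Bijective (HomotopyK.KH.map n (HomotopyK.Poly.const A))) ∧
    -- nilinvariance: a surjection with nilpotent kernel induces an isomorphism
    (∀ (n : ℤ) (A B C : Type u) [NonUnitalRing A] [NonUnitalRing B] [NonUnitalRing C]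
      (f : A →ₙ+* B) (g : B →ₙ+* C), HomotopyK.IsShortExact f g → HomotopyK.IsNilpotentRing A →
      Function.Bijective (HomotopyK.KH.map n g)) ∧
    -- stability: the corner inclusion `A → M_∞ A` induces an isomorphism
    (∀ (n : ℤ) (A : Type u) [NonUnitalRing A],
      Function.Bijective (HomotopyK.KH.map n (HomotopyK.corner A))) ∧
    -- excision: connecting homomorphisms giving natural long exact sequences
    (∃ δ : ∀ (n : ℤ) (A B C : Type u) [NonUnitalRing A] [NonUnitalRing B] [NonUnitalRing C]
        (f : A →ₙ+* B) (g : B →ₙ+* C), HomotopyK.IsShortExact f g →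
        (HomotopyK.KH (n + 1) C →+ HomotopyK.KH n A),
      (∀ (n : ℤ) (A B C : Type u) [NonUnitalRing A] [NonUnitalRing B] [NonUnitalRing C]
        (f : A →ₙ+* B) (g : B →ₙ+* C) (h : HomotopyK.IsShortExact f g),
        Function.Exact (HomotopyK.KH.map (n + 1) g) (δ n A B C f g h) ∧
        Function.Exact (δ n A B C f g h) (HomotopyK.KH.map n f) ∧
        Function.Exact (HomotopyK.KH.map n f) (HomotopyK.KH.map n g)) ∧
      (∀ (n : ℤ) (A B C A' B' C' : Type u)
        [NonUnitalRing A] [NonUnitalRing B] [NonUnitalRing C]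
        [NonUnitalRing A'] [NonUnitalRing B'] [NonUnitalRing C']
        (f : A →ₙ+* B) (g : B →ₙ+* C) (h : HomotopyK.IsShortExact f g)
        (f' : A' →ₙ+* B') (g' : B' →ₙ+* C') (h' : HomotopyK.IsShortExact f' g')
        (α : A →ₙ+* A') (β : B →ₙ+* B') (γ : C →ₙ+* C'),
        (∀ a, β (f a) = f' (α a)) → (∀ b, γ (g b) = g' (β b)) →
        ∀ z, HomotopyK.KH.map n α (δ n A B C f g h z) =
          δ n A' B' C' f' g' h' (HomotopyK.KH.map (n + 1) γ z))) :=
  ⟨HomotopyK.KH.map_const_bijective,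
    fun n A _ _ _ _ _ _ _ h hA => HomotopyK.KH.map_bijective_of_kernel h
      (hA.elim fun N hN => HomotopyK.KH.eq_zero_of_isNilpotentRing N A hN) n,
    HomotopyK.KH.map_corner_bijective,
    fun n _ _ _ _ _ _ _ _ h => HomotopyK.KH.delta n h,
    fun n _ _ _ _ _ _ _ _ h => ⟨HomotopyK.KH.exact_map_delta n h,
      HomotopyK.KH.exact_delta_map n h, HomotopyK.KH.map_exact n h⟩,
    fun n _ _ _ _ _ _ _ _ _ _ _ _ _ _ h _ _ h' α β γ h1 h2 z =>
      HomotopyK.KH.delta_naturality n h h' α β γ h1 h2 z⟩
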